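/- Let $N\ge 1$, $m\ge 1$, $T>0$, $0<\rho\le 1$. Let $D_j=-i\,\partial/\partial x_j$ and let $A(D)=\sum_{|\alpha|=m}a_\alpha D^\alpha$ be a homogeneous differential operator of order $m$ with constant (complex) coefficients which is elliptic ($A(\xi)\ne 0$ for all $\xi\in\mathbb R^N\setminus\{0\}$) and which is symmetric and positive (that is, $(A(D)v,v)\ge 0$) in $L_2(\mathbb T^N)$, $\mathbb T^N=(-\pi,\pi]^N$, on the functions of $C^m(\mathbb R^N)$ that are $2\pi$-periodic in each variable. For a $2\pi$-periodic $g\in L_2(\mathbb T^N)$ put $g_n=(2\pi)^{-N}\int_{\mathbb T^N}g(x)e^{-inx}\,dx$, $n\in\mathbb Z^N$; $g$ belongs to $L_2^a(\mathbb T^N)$ if $\sum_{n}(1+|n|^2)^a|g_n|^2<\infty$. Let $D_t^\rho$ be the Caputo derivative, $D_t^\rho v(t)=\frac1{\Gamma(1-\rho)}\int_0^t\frac{v'(s)\,ds}{(t-s)^\rho}$ for $0<\rho<1$ and $D_t^1v=v'$, and let $E_{\rho,\mu}(z)=\sum_{k\ge 0}\frac{z^k}{\Gamma(\rho k+\mu)}$.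 Consider the inverse problem of finding $\{u,f\}$ with $$D_t^\rho u(x,t)+A(D)u(x,t)=f(x)\quad (x\in\mathbb T^N,\ 0<t\le T),\qquad u(x,0)=\varphi(x),\qquad u(x,T)=\Psi(x).$$ A periodic classical solution is a pair $\{u,f\}$ of functions, $2\pi$-periodic in each $x_j$, such that $f\in C(\mathbb T^N)$, $u\in C(\mathbb T^N\times[0,T])$, $u(\cdot,t)\in C^m$ for $0<t\le T$, the derivative $D_t^\rho u$ exists on $\mathbb T^N\times(0,T]$ (for $\rho<1$: $u(x,\cdot)$ is differentiable on $(0,T)$ and the integral converges absolutely), $D_t^\rho u,\ A(D)u\in C(\mathbb T^N\times(0,T])$, the equation holds, and the two conditions at $t=0$ and $t=T$ hold as equalities of elements of $L_2(\mathbb T^N)$ (hence everywhere, for the continuous representatives of $\varphi$ and $\Psi$). Theorem. Let $\tau>N/2$, $\varphi\in L_2^{\tau}(\mathbb T^N)$ and $\Psi\in L_2^{\tau+m}(\mathbb T^N)$. Then the inverse problem has a unique periodic classical solution $\{u,f\}$. It is given, for $x\in\mathbb T^N$ and $0\le t\le T$, by the absolutely convergent series $$u(x,t)=\sum_{n\in\mathbb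 Z^N}\varphi_nE_{\rho,1}(-A(n)t^\rho)e^{inx}+\sum_{n\in\mathbb Z^N}f_n\,t^\rho E_{\rho,\rho+1}(-A(n)t^\rho)e^{inx},$$ $$f(x)=\sum_{n\in\mathbb Z^N}\frac{\Psi_n}{T^\rho E_{\rho,\rho+1}(-A(n)T^\rho)}e^{inx}-\sum_{n\in\mathbb Z^N}\frac{\varphi_nE_{\rho,1}(-A(n)T^\rho)}{T^\rho E_{\rho,\rho+1}(-A(n)T^\rho)}e^{inx},$$ where $$f_n=\frac{\Psi_n-\varphi_nE_{\rho,1}(-A(n)T^\rho)}{T^\rho E_{\rho,\rho+1}(-A(n)T^\rho)}.$$ -/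

import Mathlib

open MeasureTheory Set

noncomputable section

namespace Subdiffusion

/-- The fundamental cube `(-π, π]^N` of the torus `𝕋^N`. -/
def cube (N : ℕ) : Set (Fin N → ℝ) :=
  Set.pi Set.univ fun _ => Set.Ioc (-Real.pi) Real.pi

/-- `g` is `2π`-periodic in each variable. -/
def IsPeriodic {N : ℕ} (g : (Fin N → ℝ) → ℂ) : Prop :=
  ∀ (x : Fin N → ℝ) (j : Fin N), g (x + Pi.single j (2 * Real.pi)) = g x

/-- The exponential `e^{inx}`. -/
def expMode {N : ℕ} (n : Fin N → ℤ) (x : Fin N → ℝ) : ℂ :=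
  Complex.exp (Complex.I * ∑ j, (n j : ℂ) * (x j : ℂ))

/-- The Fourier coefficient `g_n = (2π)^{-N} ∫_{𝕋^N} g(x) e^{-inx} dx`, normalised so that the
Fourier series of `g` is `∑ g_n e^{inx}`. -/
def fourierCoef {N : ℕ} (g : (Fin N → ℝ) → ℂ) (n : Fin N → ℤ) : ℂ :=
  ((2 * Real.pi : ℝ) : ℂ)⁻¹ ^ N * ∫ x in cube N, g x * expMode (-n) x

/-- Membership in the Sobolev (Liouville) space `L_2^a(𝕋^N)`: a `2π`-periodic function, square
integrable over the torus, with `∑ (1 + |n|²)^a |g_n|² < ∞`. -/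
structure MemSobolev {N : ℕ} (a : ℝ) (g : (Fin N → ℝ) → ℂ) : Prop where
  periodic : IsPeriodic g
  memLp : MemLp g 2 (volume.restrict (cube N))
  summable : Summable fun n : Fin N → ℤ =>
    (1 + ∑ j, (n j : ℝ) ^ 2) ^ a * ‖fourierCoef g n‖ ^ 2

/-- `D_j = -i ∂/∂x_j`. -/
def partialD {N : ℕ} (j : Fin N) (v : (Fin N → ℝ) → ℂ) : (Fin N → ℝ) → ℂ :=
  fun x => -Complex.I * fderiv ℝ v x (Pi.single j 1)

/-- `D^α = D_1^{α_1} ⋯ D_N^{α_N}`. -/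
def multiD {N : ℕ} (α : Fin N →₀ ℕ) (v : (Fin N → ℝ) → ℂ) : (Fin N → ℝ) → ℂ :=
  (List.finRange N).foldr (fun j w => (partialD j)^[α j] w) v

/-- The constant-coefficient operator `A(D) = ∑_α a_α D^α` attached to the polynomial
`A(ξ) = ∑_α a_α ξ^α`. -/
def diffOp {N : ℕ} (A : MvPolynomial (Fin N) ℂ) (v : (Fin N → ℝ) → ℂ) : (Fin N → ℝ) → ℂ :=
  fun x => ∑ α ∈ A.support, A.coeff α * multiD α v x

/-- The value `A(n)` of the symbol at `n ∈ ℤ^N`. -/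
def symbolAt {N : ℕ} (A : MvPolynomial (Fin N) ℂ) (n : Fin N → ℤ) : ℂ :=
  MvPolynomial.eval (fun j => (n j : ℂ)) A

/-- `A(D)` is a homogeneous elliptic symmetric positive operator of order `m`. Symmetry and
positivity are those of the operator `A(D)` in `L_2(𝕋^N)` with domain the `2π`-periodic functions
in `C^m(ℝ^N)`. -/
structure IsEllipticSymmPos {N : ℕ} (m : ℕ) (A : MvPolynomial (Fin N) ℂ) : Prop where
  homogeneous : A.IsHomogeneous m
  elliptic : ∀ ξ : Fin N → ℝ, ξ ≠ 0 → MvPolynomial.eval (fun j => (ξ j : ℂ)) A ≠ 0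
  symmetric : ∀ v w : (Fin N → ℝ) → ℂ, IsPeriodic v → IsPeriodic w →
    ContDiff ℝ m v → ContDiff ℝ m w →
    ∫ x in cube N, diffOp A v x * (starRingEnd ℂ) (w x) =
      ∫ x in cube N, v x * (starRingEnd ℂ) (diffOp A w x)
  positive : ∀ v : (Fin N → ℝ) → ℂ, IsPeriodic v → ContDiff ℝ m v →
    0 ≤ (∫ x in cube N, diffOp A v x * (starRingEnd ℂ) (v x)).re

/-- The two-parameter Mittag-Leffler function `E_{ρ,μ}(z) = ∑_k z^k / Γ(ρk + μ)`. -/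
def mittagLeffler (ρ μ : ℝ) (z : ℂ) : ℂ :=
  ∑' k : ℕ, z ^ k / (Real.Gamma (ρ * k + μ) : ℂ)

/-- Existence at `t ∈ (0, T]` of the Caputo derivative of order `ρ ∈ (0, 1]` of a function `v`
on `[0, T]`. For `ρ = 1` it is the ordinary derivative (one-sided at `t = T`). -/
def HasCaputo (ρ T : ℝ) (v : ℝ → ℂ) (t : ℝ) : Prop :=
  if ρ = 1 then DifferentiableWithinAt ℝ v (Set.Icc 0 T) t
  else (∀ s ∈ Set.Ioo 0 t, DifferentiableAt ℝ v s) ∧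
    IntegrableOn (fun s => (((t - s) ^ (-ρ) : ℝ) : ℂ) * deriv v s) (Set.Ioo 0 t)

/-- The Caputo derivative `D_t^ρ v(t) = Γ(1-ρ)⁻¹ ∫_0^t v'(s) (t-s)^{-ρ} ds` for `0 < ρ < 1`, and
`v'(t)` for `ρ = 1`. -/
def caputo (ρ T : ℝ) (v : ℝ → ℂ) (t : ℝ) : ℂ :=
  if ρ = 1 then derivWithin v (Set.Icc 0 T) t
  else ((Real.Gamma (1 - ρ) : ℝ) : ℂ)⁻¹ *
    ∫ s in Set.Ioo 0 t, (((t - s) ^ (-ρ) : ℝ) : ℂ) * deriv v s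

/-- `{u, f}` is a periodic classical solution of the inverse problem
`D_t^ρ u + A(D) u = f(x)`, `u(x,0) = φ(x)`, `u(x,T) = Ψ(x)`. As `φ` and `Ψ` are elements of `L_2`,
the last two are equalities almost everywhere; where `φ`, `Ψ` are continuous they hold
everywhere, since `u` is continuous. -/
structure IsSolution {N : ℕ} (m : ℕ) (A : MvPolynomial (Fin N) ℂ) (ρ T : ℝ)
    (φ Ψ : (Fin N → ℝ) → ℂ) (u : (Fin N → ℝ) → ℝ → ℂ) (f : (Fin N → ℝ) → ℂ) : Prop where
  periodic_f : IsPeriodic f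
  continuous_f : Continuous f
  periodic_u : ∀ t ∈ Set.Icc 0 T, IsPeriodic fun x => u x t
  continuous_u : ContinuousOn (fun p : (Fin N → ℝ) × ℝ => u p.1 p.2)
    (Set.univ ×ˢ Set.Icc 0 T)
  contDiff_u : ∀ t ∈ Set.Ioc 0 T, ContDiff ℝ m fun x => u x t
  continuous_diffOp : ContinuousOn
    (fun p : (Fin N → ℝ) × ℝ => diffOp A (fun x => u x p.2) p.1) (Set.univ ×ˢ Set.Ioc 0 T)
  hasCaputo : ∀ x, ∀ t ∈ Set.Ioc 0 T, HasCaputo ρ T (u x) t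
  continuous_caputo : ContinuousOn
    (fun p : (Fin N → ℝ) × ℝ => caputo ρ T (u p.1) p.2) (Set.univ ×ˢ Set.Ioc 0 T)
  equation : ∀ x, ∀ t ∈ Set.Ioc 0 T, caputo ρ T (u x) t + diffOp A (fun y => u y t) x = f x
  initial : (fun x => u x 0) =ᵐ[volume] φ
  final : (fun x => u x T) =ᵐ[volume] Ψ

/-- `E_{ρ,μ}(-A(n) t^ρ)`. -/
def mlMode {N : ℕ} (A : MvPolynomial (Fin N) ℂ) (ρ μ t : ℝ) (n : Fin N → ℤ) : ℂ :=
  mittagLeffler ρ μ (-symbolAt A n * ((t ^ ρ : ℝ) : ℂ))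

/-- The part of the coefficient `f_n` that comes from `Ψ`:
`Ψ_n / (T^ρ E_{ρ,ρ+1}(-A(n)T^ρ))`. -/
def sourceCoefFinal {N : ℕ} (A : MvPolynomial (Fin N) ℂ) (ρ T : ℝ)
    (Ψ : (Fin N → ℝ) → ℂ) (n : Fin N → ℤ) : ℂ :=
  fourierCoef Ψ n / (((T ^ ρ : ℝ) : ℂ) * mlMode A ρ (ρ + 1) T n)

/-- The part of the coefficient `f_n` that comes from `φ`:
`φ_n E_{ρ,1}(-A(n)T^ρ) / (T^ρ E_{ρ,ρ+1}(-A(n)T^ρ))`. -/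
def sourceCoefInitial {N : ℕ} (A : MvPolynomial (Fin N) ℂ) (ρ T : ℝ)
    (φ : (Fin N → ℝ) → ℂ) (n : Fin N → ℤ) : ℂ :=
  fourierCoef φ n * mlMode A ρ 1 T n / (((T ^ ρ : ℝ) : ℂ) * mlMode A ρ (ρ + 1) T n)

/-- The coefficient `f_n`. -/
def sourceCoef {N : ℕ} (A : MvPolynomial (Fin N) ℂ) (ρ T : ℝ)
    (φ Ψ : (Fin N → ℝ) → ℂ) (n : Fin N → ℤ) : ℂ :=
  sourceCoefFinal A ρ T Ψ n - sourceCoefInitial A ρ T φ n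

/-- `h` is the sum of the (absolutely) convergent series `∑ c_n` and `∑ d_n`. -/
def IsSumOfTwoSeries {ι : Type*} (h : ℂ) (c d : ι → ℂ) : Prop :=
  Summable c ∧ Summable d ∧ h = (∑' n, c n) + (∑' n, d n)

end Subdiffusion

end

noncomputable section

namespace Subdiffusion

/-! ### Fractional kernels and Riemann-Liouville integrals -/

/-! On the mode e^{inx} the operator A(D) is multiplication by lam = A(n). Symmetry makes lam real,
positivity makes it nonnegative, and ellipticity makes 1 + lam comparable with (1 + |n|)^m
(`exists_eigenval_bounds`). The problem splits into scalar problems D^ρ V + lam V = f_n, V(0) = φ_n,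
solved by V = φ_n y + f_n e, where y = E_{ρ,1}(-lam t^ρ) and e = t^ρ E_{ρ,ρ+1}(-lam t^ρ) satisfy y =
1 - lam e. Since e(T) > 0, the condition V(T) = Ψ_n determines f_n.

Convergence rests on bounds uniform in lam, and these come from the positivity of e' = z = t^{ρ-1}
E_{ρ,ρ}(-lam t^ρ) (`mlFun_self_pos`), proved from the Volterra equation of z. It yields 0 ≤ y ≤ 1,
lam e ≤ 1 and t^ρ y ≤ Γ(ρ+1) e (`rpow_mul_mlFun_one_le`). The last bound has three uses: y(T)/e(T)
is bounded, so φ enters the source without loss; 1/e(T) = O(1 + lam), so Ψ loses m derivatives; lam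
y = O(t^{-ρ}), so the solution is smooth enough for t > 0. The condition τ > N/2 turns the Sobolev
hypotheses into absolute summability with matching weights (`MemSobolev.weightSummable`).

For uniqueness, a classical solution v carries no control of its time derivative that is uniform in
x. Its Caputo derivative is therefore first integrated in time: the result, the integral of order 1
- ρ of v - v(0) (`integral_caputo`), involves only the continuous function v. Its Fourier
coefficients are computed by Fubini, and the Abel-Volterra equation (`eq_zero_of_eq_fracInt`) forces
them to follow the Mittag-Leffler formula (`IsSolution.coef_eq`). Completeness of the exponentials
concludes. -/

/-- The Riemann-Liouville kernel `r^{b-1} / Γ(b)`. -/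
def fracKernel (b r : ℝ) : ℝ := r ^ (b - 1) / Real.Gamma b

/-- The Riemann-Liouville integral of order `b` started at `0`. -/
def fracInt {E : Type*} [NormedAddCommGroup E] [NormedSpace ℝ E] (b : ℝ) (f : ℝ → E) (t : ℝ) : E :=
  ∫ s in Ioo 0 t, fracKernel b (t - s) • f s

lemma fracKernel_pos {b r : ℝ} (hb : 0 < b) (hr : 0 < r) : 0 < fracKernel b r :=
  div_pos (Real.rpow_pos_of_pos hr _) (Real.Gamma_pos_of_pos hb)

lemma measurable_fracKernel (b : ℝ) : Measurable (fracKernel b) := by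
  unfold fracKernel; fun_prop

lemma fracKernel_one (r : ℝ) : fracKernel 1 r = 1 := by simp [fracKernel]

lemma fracKernel_add_one {b r : ℝ} (hb : 0 < b) (hr : 0 < r) :
    b * fracKernel (b + 1) r = r * fracKernel b r := by
  have hG := (Real.Gamma_pos_of_pos hb).ne'
  rw [fracKernel, fracKernel, Real.Gamma_add_one hb.ne', add_sub_cancel_right,
    Real.rpow_sub_one hr.ne']
  field_simp

/-- Convolution of two Riemann-Liouville kernels, a form of the Beta integral. -/
lemma integral_fracKernel_mul {a b t : ℝ} (ha : 0 < a) (hb : 0 < b) (ht : 0 < t) :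
    ∫ s in Ioo 0 t, fracKernel a (t - s) * fracKernel b s = fracKernel (a + b) t := by
  have h1 := Complex.betaIntegral_scaled (b : ℂ) (a : ℂ) ht
  rw [Complex.betaIntegral_eq_Gamma_mul_div _ _ (by simpa) (by simpa)] at h1
  have h2 : ∫ x in (0 : ℝ)..t, ((x : ℂ) ^ ((b : ℂ) - 1) * ((t : ℂ) - x) ^ ((a : ℂ) - 1)) =
      ((∫ x in Ioo 0 t, x ^ (b - 1) * (t - x) ^ (a - 1) : ℝ) : ℂ) := by
    rw [intervalIntegral.integral_of_le ht.le, integral_Ioc_eq_integral_Ioo, ← integral_complex_ofReal]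
    refine setIntegral_congr_fun measurableSet_Ioo fun x hx => ?_
    rw [Complex.ofReal_mul, Complex.ofReal_cpow hx.1.le, Complex.ofReal_cpow (sub_pos.2 hx.2).le]
    push_cast; rfl
  rw [h2, ← Complex.ofReal_add, Complex.Gamma_ofReal, Complex.Gamma_ofReal, Complex.Gamma_ofReal,
    ← Complex.ofReal_one, ← Complex.ofReal_sub, ← Complex.ofReal_cpow ht.le] at h1
  norm_cast at h1
  have hGa := (Real.Gamma_pos_of_pos ha).ne'
  have hGb := (Real.Gamma_pos_of_pos hb).ne'
  have h3 : ∀ s, fracKernel a (t - s) * fracKernel b s =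
      (Real.Gamma a * Real.Gamma b)⁻¹ * (s ^ (b - 1) * (t - s) ^ (a - 1)) := by
    intro s; simp only [fracKernel]; field_simp
  simp_rw [h3]
  rw [integral_const_mul, h1, fracKernel, add_comm b a]
  field_simp

/-- The Bochner integral of a non-integrable function is 0 by convention, so the positive value of
the Beta integral already forces integrability. -/
lemma integrableOn_fracKernel_mul {a b t : ℝ} (ha : 0 < a) (hb : 0 < b) :
    IntegrableOn (fun s => fracKernel a (t - s) * fracKernel b s) (Ioo 0 t) := by
  rcases le_or_gt t 0 with ht | ht
  · simp [Ioo_eq_empty_of_le ht]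
  by_contra h
  have := integral_fracKernel_mul ha hb ht
  rw [integral_undef h] at this
  exact (fracKernel_pos (add_pos ha hb) ht).ne this

lemma integrableOn_fracKernel_sub {a t : ℝ} (ha : 0 < a) :
    IntegrableOn (fun s => fracKernel a (t - s)) (Ioo 0 t) := by
  simpa [fracKernel_one] using integrableOn_fracKernel_mul (t := t) ha one_pos

lemma integral_fracKernel_sub {a t : ℝ} (ha : 0 < a) (ht : 0 < t) :
    ∫ s in Ioo 0 t, fracKernel a (t - s) = fracKernel (a + 1) t := by
  simpa [fracKernel_one] using integral_fracKernel_mul ha one_pos ht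

/-- Beta integral over a general interval. -/
lemma integral_fracKernel_mul_shift {a b r t : ℝ} (ha : 0 < a) (hb : 0 < b) (hrt : r < t) :
    IntegrableOn (fun s => fracKernel a (t - s) * fracKernel b (s - r)) (Ioo r t) ∧
    ∫ s in Ioo r t, fracKernel a (t - s) * fracKernel b (s - r) = fracKernel (a + b) (t - r) := by
  have h1 := integral_fracKernel_mul ha hb (sub_pos.2 hrt)
  have h2 := integrableOn_fracKernel_mul (t := t - r) ha hb
  have hp : MeasurePreserving (fun s : ℝ => s - r) := measurePreserving_sub_right volume r
  have he : MeasurableEmbedding (fun s : ℝ => s - r) :=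
    (Homeomorph.subRight r).measurableEmbedding
  have hs : (fun s : ℝ => s - r) ⁻¹' (Ioo 0 (t - r)) = Ioo r t := by
    ext s; simp
  have hf : (fun s => fracKernel a (t - s) * fracKernel b (s - r)) =
      (fun s => fracKernel a (t - r - s) * fracKernel b s) ∘ (fun s => s - r) := by
    ext s; simp
  constructor
  · rw [hf, ← hs]
    exact (hp.integrableOn_comp_preimage he).2 h2
  · rw [← h1, ← hp.setIntegral_preimage_emb he _ (Ioo 0 (t - r)), hs]
    simp

lemma fracInt_of_nonpos {E : Type*} [NormedAddCommGroup E] [NormedSpace ℝ E] (b : ℝ) (f : ℝ → E)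
    {t : ℝ} (ht : t ≤ 0) : fracInt b f t = 0 := by
  simp [fracInt, Ioo_eq_empty_of_le ht]

lemma fracInt_one {E : Type*} [NormedAddCommGroup E] [NormedSpace ℝ E] (f : ℝ → E) (t : ℝ) :
    fracInt 1 f t = ∫ s in Ioo 0 t, f s := by
  simp [fracInt, fracKernel_one]

lemma fracInt_congr {E : Type*} [NormedAddCommGroup E] [NormedSpace ℝ E] {b t : ℝ} {f g : ℝ → E}
    (h : ∀ s ∈ Ioo 0 t, f s = g s) : fracInt b f t = fracInt b g t :=
  setIntegral_congr_fun measurableSet_Ioo fun s hs => by simp only [h s hs]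

/-- The semigroup property of Riemann-Liouville integrals. -/
lemma fracInt_fracInt {E : Type*} [NormedAddCommGroup E] [NormedSpace ℝ E] [CompleteSpace E]
    {a b t : ℝ} (ha : 0 < a) (hb : 0 < b) (hab : 1 ≤ a + b) {f : ℝ → E}
    (hf : IntegrableOn f (Ioo 0 t)) :
    IntegrableOn (fun s => fracKernel a (t - s) • fracInt b f s) (Ioo 0 t) ∧
    fracInt a (fracInt b f) t = fracInt (a + b) f t := by
  set F : ℝ → ℝ → E := fun s r =>
    (Ioo 0 s).indicator (fun r => (fracKernel a (t - s) * fracKernel b (s - r)) • f r) r with hF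
  have hFr : ∀ r ∈ Ioo 0 t, ∀ s ∈ Ioo 0 t, F s r =
      (Ioo r t).indicator (fun s => (fracKernel a (t - s) * fracKernel b (s - r)) • f r) s := by
    intro r hr s hs
    simp only [hF, indicator_apply, mem_Ioo, hr.1, hs.2, true_and, and_true]
  have hmeas : AEStronglyMeasurable (Function.uncurry F)
      ((volume.restrict (Ioo 0 t)).prod (volume.restrict (Ioo 0 t))) := by
    have : Function.uncurry F = ({p : ℝ × ℝ | 0 < p.2 ∧ p.2 < p.1}).indicator (fun p =>
        (fracKernel a (t - p.1) * fracKernel b (p.1 - p.2)) • f p.2) := by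
      ext p; simp [hF, Function.uncurry, indicator_apply]
    rw [this]
    refine AEStronglyMeasurable.indicator ?_ ?_
    · refine AEStronglyMeasurable.smul ?_ ?_
      · exact (((measurable_fracKernel a).comp (measurable_const.sub measurable_fst)).mul
          ((measurable_fracKernel b).comp
            (measurable_fst.sub measurable_snd))).aestronglyMeasurable
      · exact hf.aestronglyMeasurable.comp_snd
    · exact (measurableSet_lt measurable_const measurable_snd).inter
        (measurableSet_lt measurable_snd measurable_fst)
  have hIoo : ∀ r ∈ Ioo 0 t, Ioo 0 t ∩ Ioo r t = Ioo r t := fun r hr =>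
    inter_eq_right.2 (Ioo_subset_Ioo_left hr.1.le)
  have hint : Integrable (Function.uncurry F)
      ((volume.restrict (Ioo 0 t)).prod (volume.restrict (Ioo 0 t))) := by
    rw [integrable_prod_iff' hmeas]
    constructor
    · filter_upwards [ae_restrict_mem measurableSet_Ioo] with r hr
      refine (integrableOn_congr_fun (hFr r hr) measurableSet_Ioo).2 ?_
      rw [IntegrableOn, integrable_indicator_iff measurableSet_Ioo, IntegrableOn,
        Measure.restrict_restrict measurableSet_Ioo, inter_comm, hIoo r hr]
      exact (integral_fracKernel_mul_shift ha hb hr.2).1.smul_const _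
    · have h1 : ∀ r ∈ Ioo 0 t, ∫ s in Ioo 0 t, ‖Function.uncurry F (s, r)‖ =
          fracKernel (a + b) (t - r) * ‖f r‖ := by
        intro r hr
        rw [setIntegral_congr_fun (g := (Ioo r t).indicator (fun s =>
          (fracKernel a (t - s) * fracKernel b (s - r)) * ‖f r‖)) measurableSet_Ioo]
        · rw [setIntegral_indicator measurableSet_Ioo, hIoo r hr, integral_mul_const,
            (integral_fracKernel_mul_shift ha hb hr.2).2]
        · intro s hs
          simp only [Function.uncurry, hFr r hr s hs, indicator_apply]
          split_ifs with h
          · rw [norm_smul, Real.norm_of_nonneg]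
            exact (mul_pos (fracKernel_pos ha (sub_pos.2 h.2))
              (fracKernel_pos hb (sub_pos.2 h.1))).le
          · simp
      refine (integrableOn_congr_fun h1 measurableSet_Ioo).2 ?_
      -- Here `1 ≤ a + b` matters: the kernel of order a + b is then bounded on (0, t), so mere
      -- integrability of f gives the identity at the given t and not only almost everywhere.
      refine Integrable.bdd_mul (c := t ^ (a + b - 1) / Real.Gamma (a + b)) hf.norm
        ((measurable_fracKernel _).comp (measurable_const.sub measurable_id)).aestronglyMeasurable ?_
      filter_upwards [ae_restrict_mem measurableSet_Ioo] with r hr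
      have hp := fracKernel_pos (add_pos ha hb) (sub_pos.2 hr.2)
      rw [Real.norm_of_nonneg hp.le, fracKernel]
      have := Real.Gamma_pos_of_pos (add_pos ha hb)
      gcongr <;> linarith [hr.1, hr.2]
  have hswap := integral_integral_swap hint
  have hFs : ∀ s ∈ Ioo 0 t, fracKernel a (t - s) • fracInt b f s = ∫ r in Ioo 0 t, F s r := by
    intro s hs
    simp only [hF]
    rw [setIntegral_indicator measurableSet_Ioo,
      inter_eq_right.2 (Ioo_subset_Ioo_right hs.2.le), fracInt, ← integral_smul]
    simp_rw [smul_smul]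
  have hR : fracInt (a + b) f t = ∫ r in Ioo 0 t, ∫ s in Ioo 0 t, F s r := by
    refine setIntegral_congr_fun measurableSet_Ioo fun r hr => ?_
    rw [setIntegral_congr_fun measurableSet_Ioo (hFr r hr),
      setIntegral_indicator measurableSet_Ioo, hIoo r hr, integral_smul_const,
      (integral_fracKernel_mul_shift ha hb hr.2).2]
  refine ⟨(integrableOn_congr_fun hFs measurableSet_Ioo).2 hint.integral_prod_left, ?_⟩
  rw [hR, ← hswap]
  exact setIntegral_congr_fun measurableSet_Ioo hFs

/-! ### The Mittag-Leffler function on the real line -/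

/-- The Mittag-Leffler function of a real argument. -/
def realML (ρ μ x : ℝ) : ℝ := ∑' k : ℕ, x ^ k / Real.Gamma (ρ * k + μ)

/-- `t^{μ-1} E_{ρ,μ}(-lam t^ρ)`. -/
def mlFun (ρ lam μ t : ℝ) : ℝ := t ^ (μ - 1) * realML ρ μ (-lam * t ^ ρ)

/-- Γ outgrows every geometric sequence: the Euler integral is cut down to (R, R+1), where both
factors are bounded below. R is left free so that it can be adapted to the argument of the
Mittag-Leffler series. -/
lemma rpow_mul_exp_le_Gamma {R x : ℝ} (hR : 0 < R) (hx : 1 ≤ x) :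
    R ^ (x - 1) * Real.exp (-(R + 1)) ≤ Real.Gamma x := by
  have hx0 : 0 < x := by linarith
  rw [Real.Gamma_eq_integral hx0]
  have hsub : Ioo R (R + 1) ⊆ Ioi 0 := fun y hy => hR.trans hy.1
  have hint := Real.GammaIntegral_convergent hx0
  calc R ^ (x - 1) * Real.exp (-(R + 1))
      = ∫ _ in Ioo R (R + 1), R ^ (x - 1) * Real.exp (-(R + 1)) := by simp
    _ ≤ ∫ y in Ioo R (R + 1), Real.exp (-y) * y ^ (x - 1) := by
        refine setIntegral_mono_on (integrableOn_const (by simp)) (hint.mono_set hsub) measurableSet_Ioo fun y hy => ?_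
        rw [mul_comm]
        have := hy.1
        have := hy.2
        gcongr
    _ ≤ _ := by
        refine setIntegral_mono_set hint ?_ hsub.eventuallyLE
        filter_upwards [ae_restrict_mem measurableSet_Ioi] with y hy
        exact mul_nonneg (Real.exp_pos _).le (Real.rpow_nonneg (le_of_lt hy) _)

lemma summable_realML_norm {ρ : ℝ} (hρ : 0 < ρ) (μ x : ℝ) :
    Summable fun k : ℕ => ‖x ^ k / Real.Gamma (ρ * k + μ)‖ := by
  -- Chosen so that |x| / R^ρ ≤ 1/2, which gives a geometric majorant; the summand 1 keeps R
  -- positive at x = 0.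
  set R : ℝ := (2 * |x| + 1) ^ (1 / ρ) with hR
  have hR0 : 0 < R := by positivity
  have hRρ : R ^ ρ = 2 * |x| + 1 := by
    rw [hR, ← Real.rpow_mul (by positivity), one_div_mul_cancel hρ.ne', Real.rpow_one]
  have hg : Summable fun k : ℕ => Real.exp (R + 1) * R ^ (1 - μ) * (1 / 2 : ℝ) ^ k :=
    (summable_geometric_of_lt_one (by norm_num) (by norm_num)).mul_left _
  refine Summable.of_norm_bounded_eventually_nat hg ?_
  have hlim : Filter.Tendsto (fun k : ℕ => ρ * (k : ℝ) + μ) Filter.atTop Filter.atTop :=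
    Filter.tendsto_atTop_add_const_right _ _
      (tendsto_natCast_atTop_atTop.const_mul_atTop hρ)
  filter_upwards [hlim.eventually_ge_atTop 1] with k hk
  have hG := rpow_mul_exp_le_Gamma hR0 hk
  have hpos : 0 < R ^ (ρ * k + μ - 1) * Real.exp (-(R + 1)) := by positivity
  rw [norm_norm, norm_div, norm_pow, Real.norm_eq_abs, Real.norm_of_nonneg (hpos.le.trans hG)]
  calc |x| ^ k / Real.Gamma (ρ * k + μ)
      ≤ |x| ^ k / (R ^ (ρ * k + μ - 1) * Real.exp (-(R + 1))) := by gcongr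
    _ = Real.exp (R + 1) * R ^ (1 - μ) * (|x| / (2 * |x| + 1)) ^ k := by
        have : R ^ (ρ * k + μ - 1) = (2 * |x| + 1) ^ k * (R ^ (1 - μ))⁻¹ := by
          rw [← Real.rpow_neg hR0.le, ← hRρ, ← Real.rpow_natCast (R ^ ρ), ← Real.rpow_mul hR0.le,
            ← Real.rpow_add hR0]
          ring_nf
        rw [this, Real.exp_neg, div_pow]
        field_simp
    _ ≤ _ := by
        have : |x| / (2 * |x| + 1) ≤ 1 / 2 := by
          rw [div_le_iff₀ (by positivity)]
          linarith
        exact mul_le_mul_of_nonneg_left (pow_le_pow_left₀ (by positivity) this k) (by positivity)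

lemma summable_realML {ρ : ℝ} (hρ : 0 < ρ) (μ x : ℝ) :
    Summable fun k : ℕ => x ^ k / Real.Gamma (ρ * k + μ) :=
  (summable_realML_norm hρ μ x).of_norm

lemma mittagLeffler_ofReal (ρ μ x : ℝ) : mittagLeffler ρ μ (x : ℂ) = realML ρ μ x := by
  rw [mittagLeffler, realML, Complex.ofReal_tsum]
  simp

lemma continuous_realML {ρ : ℝ} (hρ : 0 < ρ) (μ : ℝ) : Continuous (realML ρ μ) := by
  refine continuous_iff_continuousAt.2 fun x => ?_
  have h : ContinuousOn (realML ρ μ) (Metric.ball 0 (|x| + 1)) := by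
    refine continuousOn_tsum (fun k => by fun_prop) (summable_realML_norm hρ μ (|x| + 1)) ?_
    intro k y hy
    rw [norm_div, norm_div, norm_pow, norm_pow]
    have h1 : ‖y‖ ≤ ‖|x| + 1‖ := by
      rw [Real.norm_of_nonneg (by positivity : 0 ≤ |x| + 1)]
      simpa using (mem_ball_zero_iff.1 hy).le
    gcongr
  exact h.continuousAt (Metric.isOpen_ball.mem_nhds (by simp))

lemma realML_zero (ρ μ : ℝ) : realML ρ μ 0 = 1 / Real.Gamma μ := by
  rw [realML, tsum_eq_single 0]
  · simp
  · intro k hk; simp [hk]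

lemma realML_eq_add {ρ : ℝ} (hρ : 0 < ρ) (μ x : ℝ) :
    realML ρ μ x = 1 / Real.Gamma μ + x * realML ρ (μ + ρ) x := by
  rw [realML, (summable_realML hρ μ x).tsum_eq_zero_add, realML, ← tsum_mul_left]
  congr 1
  · simp
  · congr 1; ext k
    push_cast
    rw [pow_succ']
    ring_nf

/-! ### Volterra equation and positivity of the Mittag-Leffler kernels. -/

section mlFun

variable {ρ lam : ℝ}

lemma continuous_realML_comp (hρ : 0 < ρ) (lam μ : ℝ) :
    Continuous fun t : ℝ => realML ρ μ (-lam * t ^ ρ) :=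
  (continuous_realML hρ μ).comp (continuous_const.mul (Real.continuous_rpow_const hρ.le))

lemma continuousOn_mlFun (hρ : 0 < ρ) (lam μ : ℝ) : ContinuousOn (mlFun ρ lam μ) (Ioi 0) := by
  intro t ht
  exact ((Real.continuousAt_rpow_const t _ (Or.inl (ne_of_gt ht))).mul
    (continuous_realML_comp hρ lam μ).continuousAt).continuousWithinAt

lemma continuous_mlFun (hρ : 0 < ρ) (lam : ℝ) {μ : ℝ} (hμ : 1 ≤ μ) :
    Continuous (mlFun ρ lam μ) :=
  (Real.continuous_rpow_const (by linarith)).mul (continuous_realML_comp hρ lam μ)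

/-- With `fracInt_mlFun` identifying the last term as an integral of order ρ, this is the Volterra
equation w = k_μ - lam I^ρ w for w = `mlFun ρ lam μ`, from which all the bounds are drawn. -/
lemma mlFun_eq_sub (hρ : 0 < ρ) (lam μ : ℝ) {t : ℝ} (ht : 0 < t) :
    mlFun ρ lam μ t = fracKernel μ t - lam * mlFun ρ lam (μ + ρ) t := by
  rw [mlFun, realML_eq_add hρ, mlFun, fracKernel, add_sub_right_comm, Real.rpow_add ht]
  ring

lemma hasSum_mlFun (hρ : 0 < ρ) (lam μ : ℝ) {t : ℝ} (ht : 0 < t) :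
    HasSum (fun k : ℕ => (-lam) ^ k * fracKernel (ρ * k + μ) t) (mlFun ρ lam μ t) := by
  have h := ((summable_realML hρ μ (-lam * t ^ ρ)).hasSum).mul_left (t ^ (μ - 1))
  refine (congrArg (HasSum · _) (funext fun k => ?_)).mpr h
  have : t ^ (ρ * k + μ - 1) = t ^ (μ - 1) * (t ^ ρ) ^ k := by
    rw [← Real.rpow_natCast (t ^ ρ), ← Real.rpow_mul ht.le, ← Real.rpow_add ht]
    ring_nf
  rw [fracKernel, this, mul_pow]
  ring

lemma integrableOn_fracKernel_mul_mlFun (hρ : 0 < ρ) (lam : ℝ) {b μ : ℝ} (hb : 0 < b) (hμ : 0 < μ)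
    (t : ℝ) : IntegrableOn (fun s => fracKernel b (t - s) * mlFun ρ lam μ s) (Ioo 0 t) := by
  have hG := (Real.Gamma_pos_of_pos hμ).ne'
  have h1 : (fun s => fracKernel b (t - s) * mlFun ρ lam μ s) = fun s =>
      (Real.Gamma μ * realML ρ μ (-lam * s ^ ρ)) * (fracKernel b (t - s) * fracKernel μ s) := by
    ext s; simp only [mlFun, fracKernel]; field_simp
  have hc : Continuous fun s : ℝ => Real.Gamma μ * realML ρ μ (-lam * s ^ ρ) :=
    continuous_const.mul (continuous_realML_comp hρ lam μ)
  obtain ⟨C, hC⟩ := (isCompact_Icc (a := 0) (b := t)).exists_bound_of_continuousOn hc.continuousOn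
  rw [h1]
  refine Integrable.bdd_mul (c := C) (integrableOn_fracKernel_mul hb hμ) hc.aestronglyMeasurable ?_
  filter_upwards [ae_restrict_mem measurableSet_Ioo] with s hs
  exact hC s (Ioo_subset_Icc_self hs)

/-- Each term of the series is a multiple of a Riemann-Liouville kernel, whose order is raised by b.
The kernels are positive, so the L¹ norms of the terms are the absolute values of the terms of the
resulting series, and its absolute convergence justifies the interchange. -/
lemma fracInt_mlFun (hρ : 0 < ρ) (lam : ℝ) {b μ : ℝ} (hb : 0 < b) (hμ : 0 < μ) {t : ℝ}
    (ht : 0 < t) : fracInt b (mlFun ρ lam μ) t = mlFun ρ lam (μ + b) t := by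
  have hk : ∀ k : ℕ, 0 < ρ * k + μ := fun k => by positivity
  have hb1 : ∀ k : ℕ, b + (ρ * k + μ) = ρ * k + (μ + b) := fun k => by ring
  have hF : ∀ k : ℕ, IntegrableOn
      (fun s => fracKernel b (t - s) * ((-lam) ^ k * fracKernel (ρ * k + μ) s)) (Ioo 0 t) := by
    intro k
    refine ((integrableOn_fracKernel_mul hb (hk k)).const_mul ((-lam) ^ k)).congr
      (Filter.Eventually.of_forall fun s => ?_)
    ring
  have hI : ∀ k : ℕ, ∀ c : ℝ, ∫ s in Ioo 0 t, fracKernel b (t - s) * (c *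
      fracKernel (ρ * k + μ) s) = c * fracKernel (ρ * k + (μ + b)) t := by
    intro k c
    rw [← hb1, ← integral_fracKernel_mul hb (hk k) ht, ← integral_const_mul]
    congr 1; ext s; ring
  have hs : HasSum (fun k : ℕ => (-lam) ^ k * fracKernel (ρ * k + (μ + b)) t)
      (mlFun ρ lam (μ + b) t) := hasSum_mlFun hρ lam _ ht
  have h := hasSum_integral_of_summable_integral_norm hF ?_
  · simp_rw [hI] at h
    rw [← h.unique hs, fracInt]
    refine setIntegral_congr_fun measurableSet_Ioo fun s hs => ?_
    rw [smul_eq_mul, ← (hasSum_mlFun hρ lam μ hs.1).tsum_eq, tsum_mul_left]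
  · refine hs.summable.norm.congr fun k => ?_
    rw [norm_mul, Real.norm_of_nonneg (fracKernel_pos (by positivity) ht).le, ← hI]
    refine setIntegral_congr_fun measurableSet_Ioo fun s hs => ?_
    rw [norm_mul, norm_mul, Real.norm_of_nonneg (fracKernel_pos hb (sub_pos.2 hs.2)).le,
      Real.norm_of_nonneg (fracKernel_pos (hk k) hs.1).le]

lemma integrableOn_mlFun (hρ : 0 < ρ) (lam : ℝ) {μ : ℝ} (hμ : 0 < μ) (t : ℝ) :
    IntegrableOn (mlFun ρ lam μ) (Ioo 0 t) := by
  simpa [fracKernel_one] using integrableOn_fracKernel_mul_mlFun hρ lam one_pos hμ t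

/-- Log-convexity of the kernel `r^{ρ-1}`. -/
lemma fracKernel_mul_le (hρ : 0 < ρ) (hρ1 : ρ ≤ 1) {s t t₀ : ℝ} (hs : 0 < s) (hst : s < t)
    (htt : t ≤ t₀) :
    fracKernel ρ t * fracKernel ρ (t₀ - s) ≤ fracKernel ρ t₀ * fracKernel ρ (t - s) := by
  have hG := Real.Gamma_pos_of_pos hρ
  have h1 : 0 < t - s := sub_pos.2 hst
  have ht : 0 < t := hs.trans hst
  have ht₀ : 0 < t₀ := ht.trans_le htt
  have h2 : 0 < t₀ - s := by linarith
  have h : (t * (t₀ - s)) ^ (ρ - 1) ≤ (t₀ * (t - s)) ^ (ρ - 1) :=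
    Real.rpow_le_rpow_of_nonpos (by positivity) (by nlinarith) (by linarith)
  rw [Real.mul_rpow ht.le h2.le, Real.mul_rpow ht₀.le h1.le] at h
  simp only [fracKernel, div_mul_div_comm]
  gcongr

/-- Positivity of the resolvent kernel `t^{ρ-1} E_{ρ,ρ}(-lam t^ρ)`. -/
theorem mlFun_self_pos (hρ : 0 < ρ) (hρ1 : ρ ≤ 1) (hlam : 0 ≤ lam) {t : ℝ} (ht : 0 < t) :
    0 < mlFun ρ lam ρ t := by
  by_contra! hneg
  -- The factor t^{ρ-1} may be singular at 0. Without it the function is continuous with value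
  -- 1/Γ(ρ) > 0 at 0, so a first point t₀ > 0 of non-positivity exists.
  set g : ℝ → ℝ := fun t => realML ρ ρ (-lam * t ^ ρ) with hg
  have hgc : Continuous g := continuous_realML_comp hρ lam ρ
  have hzg : ∀ s, 0 < s → (0 < mlFun ρ lam ρ s ↔ 0 < g s) := fun s hs =>
    mul_pos_iff_of_pos_left (Real.rpow_pos_of_pos hs _)
  set B : Set ℝ := Ici 0 ∩ g ⁻¹' (Iic 0) with hB
  have hBc : IsClosed B := isClosed_Ici.inter (isClosed_Iic.preimage hgc)
  have hBne : B.Nonempty := ⟨t, ht.le, not_lt.1 fun h => hneg.not_gt ((hzg t ht).2 h)⟩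
  have hBb : BddBelow B := ⟨0, fun s hs => hs.1⟩
  set t₀ := sInf B with ht₀
  have hmem : t₀ ∈ B := hBc.csInf_mem hBne hBb
  have ht₀pos : 0 < t₀ := by
    refine lt_of_le_of_ne hmem.1 fun h0 => ?_
    have h1 : g 0 ≤ 0 := by have := hmem.2; rwa [← h0] at this
    simp only [hg, Real.zero_rpow hρ.ne', mul_zero, realML_zero] at h1
    exact absurd h1 (not_le.2 (one_div_pos.2 (Real.Gamma_pos_of_pos hρ)))
  set z := mlFun ρ lam ρ with hz
  have hzpos : ∀ s, 0 < s → s < t₀ → 0 < z s := fun s hs hst => by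
    rw [hzg s hs]
    by_contra! h
    exact absurd (csInf_le hBb (⟨hs.le, h⟩ : s ∈ B)) (not_le.2 hst)
  have hz₀ : z t₀ ≤ 0 := not_lt.1 fun h => (not_lt.2 hmem.2) ((hzg t₀ ht₀pos).1 h)
  have hvol : ∀ s, 0 < s → z s = fracKernel ρ s -
      lam * ∫ r in Ioo 0 s, fracKernel ρ (s - r) * z r := by
    intro s hs
    rw [hz, mlFun_eq_sub hρ lam ρ hs, ← fracInt_mlFun hρ lam hρ hρ hs]
    rfl
  have hint : ∀ s, IntegrableOn (fun r => fracKernel ρ (s - r) * z r) (Ioo 0 s) := fun s =>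
    integrableOn_fracKernel_mul_mlFun hρ lam hρ hρ s
  -- The Volterra equation at s is multiplied by k(t₀), the one at t₀ by k(s), and they are
  -- compared. Log-convexity disposes of the common past (0, s), where z > 0, and z(t₀) ≤ 0 has the
  -- right sign; only the integral over (s, t₀) is left.
  have hkey : ∀ s, 0 < s → s < t₀ → fracKernel ρ t₀ * z s ≤
      fracKernel ρ s * (lam * ∫ r in Ioo s t₀, fracKernel ρ (t₀ - r) * z r) := by
    intro s hs hst
    have hsplit : ∫ r in Ioo 0 t₀, fracKernel ρ (t₀ - r) * z r =
        (∫ r in Ioo 0 s, fracKernel ρ (t₀ - r) * z r) +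
          ∫ r in Ioo s t₀, fracKernel ρ (t₀ - r) * z r := by
      simp only [← integral_Ioc_eq_integral_Ioo]
      have hint' := (integrableOn_Ioc_iff_integrableOn_Ioo).2 (hint t₀)
      rw [← Ioc_union_Ioc_eq_Ioc hs.le hst.le, setIntegral_union (Ioc_disjoint_Ioc_of_le le_rfl)
        measurableSet_Ioc (hint'.mono_set (Ioc_subset_Ioc_right hst.le))
        (hint'.mono_set (Ioc_subset_Ioc_left hs.le))]
    have hcmp : fracKernel ρ s * ∫ r in Ioo 0 s, fracKernel ρ (t₀ - r) * z r ≤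
        fracKernel ρ t₀ * ∫ r in Ioo 0 s, fracKernel ρ (s - r) * z r := by
      rw [← integral_const_mul, ← integral_const_mul]
      refine setIntegral_mono_on (((hint t₀).mono_set (Ioo_subset_Ioo_right hst.le)).const_mul _)
        ((hint s).const_mul _) measurableSet_Ioo fun r hr => ?_
      rw [← mul_assoc, ← mul_assoc]
      exact mul_le_mul_of_nonneg_right (fracKernel_mul_le hρ hρ1 hr.1 hr.2 hst.le)
        (hzpos r hr.1 (hr.2.trans hst)).le
    have h0 := hvol t₀ ht₀pos
    rw [hsplit] at h0
    rw [hvol s hs]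
    have hks := fracKernel_pos hρ hs
    nlinarith [mul_le_mul_of_nonneg_left hcmp hlam, mul_nonneg hks.le (neg_nonneg.2 hz₀)]
  have hkhalf : ∀ s, t₀ / 2 ≤ s → fracKernel ρ s ≤ 2 * fracKernel ρ t₀ := by
    intro s hs
    have hG := Real.Gamma_pos_of_pos hρ
    have h1 : s ^ (ρ - 1) ≤ (t₀ / 2) ^ (ρ - 1) :=
      Real.rpow_le_rpow_of_nonpos (by positivity) hs (by linarith)
    have h2 : (t₀ / 2) ^ (ρ - 1) ≤ 2 * t₀ ^ (ρ - 1) := by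
      rw [Real.div_rpow ht₀pos.le zero_le_two, div_eq_mul_inv, ← Real.rpow_neg zero_le_two, mul_comm]
      gcongr
      calc (2 : ℝ) ^ (-(ρ - 1)) ≤ 2 ^ (1 : ℝ) :=
            Real.rpow_le_rpow_of_exponent_le one_le_two (by linarith)
        _ = 2 := Real.rpow_one 2
    rw [fracKernel, fracKernel, ← mul_div_assoc]
    gcongr
    exact h1.trans h2
  have hlim : Filter.Tendsto (fun δ : ℝ => 2 * lam * (δ ^ ρ / Real.Gamma (ρ + 1)))
      (nhdsWithin 0 (Ioi 0)) (nhds 0) := by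
    have hc : Continuous fun δ : ℝ => 2 * lam * (δ ^ ρ / Real.Gamma (ρ + 1)) :=
      continuous_const.mul ((Real.continuous_rpow_const hρ.le).div_const _)
    have := hc.tendsto 0
    simp only [Real.zero_rpow hρ.ne', zero_div, mul_zero] at this
    exact this.mono_left nhdsWithin_le_nhds
  -- δ makes 2 lam δ^ρ/Γ(ρ+1) < 1, where 2 is the constant of `hkhalf`; δ < t₀/2 keeps [t₀ - δ, t₀]
  -- in the range of that estimate.
  obtain ⟨δ, hδ1, hδ0, hδ2⟩ := ((hlim.eventually_lt_const one_pos).and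
    (Ioo_mem_nhdsGT (half_pos ht₀pos))).exists
  set a := t₀ - δ with ha
  have ha0 : t₀ / 2 < a := by rw [ha]; linarith
  have hapos : 0 < a := by linarith
  have hat : a < t₀ := by rw [ha]; linarith
  -- At a maximum s of z on [t₀ - δ, t₀], `hkey` yields z(s) ≤ 2 lam (δ^ρ/Γ(ρ+1)) z(s) < z(s), a
  -- contradiction.
  obtain ⟨s, hs, hmax⟩ := isCompact_Icc.exists_isMaxOn (nonempty_Icc.2 hat.le)
    ((continuousOn_mlFun hρ lam ρ).mono fun r (hr : r ∈ Icc a t₀) => hapos.trans_le hr.1)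
  have hM : 0 < z s := (hzpos a hapos hat).trans_le (hmax (left_mem_Icc.2 hat.le))
  have hst : s < t₀ := lt_of_le_of_ne hs.2 fun h => by rw [h] at hM; exact hz₀.not_gt hM
  have hspos : 0 < s := hapos.trans_le hs.1
  have hI : ∫ r in Ioo s t₀, fracKernel ρ (t₀ - r) * z r ≤ z s * (δ ^ ρ / Real.Gamma (ρ + 1)) := by
    have hsh := integral_fracKernel_mul_shift hρ one_pos hst
    simp only [fracKernel_one, mul_one] at hsh
    calc ∫ r in Ioo s t₀, fracKernel ρ (t₀ - r) * z r
        ≤ ∫ r in Ioo s t₀, fracKernel ρ (t₀ - r) * z s := by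
          refine setIntegral_mono_on ((hint t₀).mono_set (Ioo_subset_Ioo_left hspos.le))
            (hsh.1.mul_const _) measurableSet_Ioo fun r hr => ?_
          exact mul_le_mul_of_nonneg_left (hmax ⟨hs.1.trans hr.1.le, hr.2.le⟩)
            (fracKernel_pos hρ (sub_pos.2 hr.2)).le
      _ = z s * fracKernel (ρ + 1) (t₀ - s) := by rw [integral_mul_const, hsh.2, mul_comm]
      _ ≤ _ := by
          have hG := Real.Gamma_pos_of_pos (add_pos hρ one_pos)
          rw [fracKernel, add_sub_cancel_right]
          have h1 : t₀ - s ≤ δ := by linarith [hs.1]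
          have h2 : 0 ≤ t₀ - s := by linarith
          gcongr
  have hk0 := fracKernel_pos hρ ht₀pos
  have hks := fracKernel_pos hρ hspos
  have h1 := hkey s hspos hst
  have hd : 0 ≤ δ ^ ρ / Real.Gamma (ρ + 1) :=
    div_nonneg (Real.rpow_nonneg hδ0.le _) (Real.Gamma_pos_of_pos (by linarith)).le
  have h2 : fracKernel ρ t₀ * z s ≤
      2 * fracKernel ρ t₀ * (lam * (z s * (δ ^ ρ / Real.Gamma (ρ + 1)))) := by
    refine h1.trans ?_
    calc _ ≤ fracKernel ρ s * (lam * (z s * (δ ^ ρ / Real.Gamma (ρ + 1)))) := by gcongr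
      _ ≤ _ := mul_le_mul_of_nonneg_right (hkhalf s (ha0.le.trans hs.1)) (by positivity)
  have h3 : fracKernel ρ t₀ * z s * (2 * lam * (δ ^ ρ / Real.Gamma (ρ + 1))) <
      fracKernel ρ t₀ * z s * 1 := by gcongr
  linarith

end mlFun

/-! ### Bounds uniform in the spectral parameter, and uniqueness for the Abel-Volterra equation. -/

section mlBounds

variable {ρ lam : ℝ}

lemma mlFun_one (ρ lam t : ℝ) : mlFun ρ lam 1 t = realML ρ 1 (-lam * t ^ ρ) := by
  simp [mlFun]

lemma mlFun_add_one (ρ lam t : ℝ) :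
    mlFun ρ lam (ρ + 1) t = t ^ ρ * realML ρ (ρ + 1) (-lam * t ^ ρ) := by
  simp [mlFun]

lemma mlFun_one_eq (hρ : 0 < ρ) (lam t : ℝ) :
    mlFun ρ lam 1 t = 1 - lam * mlFun ρ lam (ρ + 1) t := by
  rw [mlFun_one, mlFun_add_one, realML_eq_add hρ, Real.Gamma_one, add_comm 1 ρ]
  ring

lemma mlFun_one_zero (hρ : 0 < ρ) (lam : ℝ) : mlFun ρ lam 1 0 = 1 := by
  simp [mlFun_one, Real.zero_rpow hρ.ne', realML_zero]

lemma mlFun_add_one_zero (hρ : 0 < ρ) (lam : ℝ) : mlFun ρ lam (ρ + 1) 0 = 0 := by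
  simp [mlFun_add_one, Real.zero_rpow hρ.ne']

/-- For ρ < 1 this function is the integral of order 1 - ρ of the positive resolvent kernel; for ρ =
1 it is that kernel. -/
lemma mlFun_one_nonneg (hρ : 0 < ρ) (hρ1 : ρ ≤ 1) (hlam : 0 ≤ lam) {t : ℝ} (ht : 0 ≤ t) :
    0 ≤ mlFun ρ lam 1 t := by
  rcases ht.eq_or_lt with rfl | ht
  · rw [mlFun_one_zero hρ]; exact zero_le_one
  rcases hρ1.eq_or_lt with rfl | hρ1'
  · exact (mlFun_self_pos hρ hρ1 hlam ht).le
  have h := fracInt_mlFun hρ lam (sub_pos.2 hρ1') hρ ht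
  rw [add_sub_cancel] at h
  rw [← h, fracInt]
  refine setIntegral_nonneg measurableSet_Ioo fun s hs => ?_
  exact mul_nonneg (fracKernel_pos (sub_pos.2 hρ1') (sub_pos.2 hs.2)).le
    (mlFun_self_pos hρ hρ1 hlam hs.1).le

lemma mlFun_add_one_eq_integral (hρ : 0 < ρ) (lam : ℝ) {t : ℝ} (ht : 0 < t) :
    mlFun ρ lam (ρ + 1) t = ∫ s in Ioo 0 t, mlFun ρ lam ρ s := by
  rw [← fracInt_mlFun hρ lam one_pos hρ ht, fracInt_one]

lemma mlFun_add_one_nonneg (hρ : 0 < ρ) (hρ1 : ρ ≤ 1) (hlam : 0 ≤ lam) {t : ℝ} (ht : 0 ≤ t) :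
    0 ≤ mlFun ρ lam (ρ + 1) t := by
  rcases ht.eq_or_lt with rfl | ht
  · rw [mlFun_add_one_zero hρ]
  rw [mlFun_add_one_eq_integral hρ lam ht]
  exact setIntegral_nonneg measurableSet_Ioo fun s hs => (mlFun_self_pos hρ hρ1 hlam hs.1).le

lemma mlFun_add_one_mono (hρ : 0 < ρ) (hρ1 : ρ ≤ 1) (hlam : 0 ≤ lam) {s t : ℝ} (hs : 0 < s)
    (hst : s ≤ t) : mlFun ρ lam (ρ + 1) s ≤ mlFun ρ lam (ρ + 1) t := by
  rw [mlFun_add_one_eq_integral hρ lam hs, mlFun_add_one_eq_integral hρ lam (hs.trans_le hst)]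
  refine setIntegral_mono_set (integrableOn_mlFun hρ lam hρ t) ?_
    (Ioo_subset_Ioo_right hst).eventuallyLE
  filter_upwards [ae_restrict_mem measurableSet_Ioo] with r hr
  exact (mlFun_self_pos hρ hρ1 hlam hr.1).le

lemma mlFun_one_le_one (hρ : 0 < ρ) (hρ1 : ρ ≤ 1) (hlam : 0 ≤ lam) {t : ℝ} (ht : 0 ≤ t) :
    mlFun ρ lam 1 t ≤ 1 := by
  rw [mlFun_one_eq hρ]
  linarith [mul_nonneg hlam (mlFun_add_one_nonneg hρ hρ1 hlam ht)]

lemma lam_mul_mlFun_add_one_le (hρ : 0 < ρ) (hρ1 : ρ ≤ 1) (hlam : 0 ≤ lam) {t : ℝ} (ht : 0 ≤ t) :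
    lam * mlFun ρ lam (ρ + 1) t ≤ 1 := by
  have h := mlFun_one_nonneg hρ hρ1 hlam ht
  rw [mlFun_one_eq hρ] at h
  linarith

lemma mlFun_add_one_eq_sub (hρ : 0 < ρ) (lam : ℝ) {t : ℝ} (ht : 0 < t) :
    mlFun ρ lam (ρ + 1) t = t ^ ρ / Real.Gamma (ρ + 1) -
      lam * ∫ s in Ioo 0 t, fracKernel ρ (t - s) * mlFun ρ lam (ρ + 1) s := by
  rw [mlFun_eq_sub hρ lam _ ht, ← fracInt_mlFun hρ lam hρ (by linarith) ht, fracKernel,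
    add_sub_cancel_right]
  rfl

/-- Write e = `mlFun ρ lam (ρ + 1)`. As e increases, I^ρ e(t) ≤ (t^ρ/Γ(ρ+1)) e(t); inserted in e =
t^ρ/Γ(ρ+1) - lam I^ρ e this gives e ≥ (t^ρ/Γ(ρ+1)) (1 - lam e), and 1 - lam e is `mlFun ρ lam 1`.
The decay of `mlFun ρ lam 1` in lam and the lower bound for e both follow. -/
lemma rpow_mul_mlFun_one_le (hρ : 0 < ρ) (hρ1 : ρ ≤ 1) (hlam : 0 ≤ lam) {t : ℝ} (ht : 0 < t) :
    t ^ ρ * mlFun ρ lam 1 t ≤ Real.Gamma (ρ + 1) * mlFun ρ lam (ρ + 1) t := by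
  have hG := Real.Gamma_pos_of_pos (add_pos hρ one_pos)
  have h : ∫ s in Ioo 0 t, fracKernel ρ (t - s) * mlFun ρ lam (ρ + 1) s ≤
      t ^ ρ / Real.Gamma (ρ + 1) * mlFun ρ lam (ρ + 1) t := by
    have h1 := integral_fracKernel_sub hρ ht
    rw [fracKernel, add_sub_cancel_right] at h1
    rw [← h1, ← integral_mul_const]
    refine setIntegral_mono_on (integrableOn_fracKernel_mul_mlFun hρ lam hρ (by linarith) t)
      ((integrableOn_fracKernel_sub hρ).mul_const _) measurableSet_Ioo fun s hs => ?_
    exact mul_le_mul_of_nonneg_left (mlFun_add_one_mono hρ hρ1 hlam hs.1 hs.2.le)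
      (fracKernel_pos hρ (sub_pos.2 hs.2)).le
  have h2 := mlFun_add_one_eq_sub hρ lam ht
  have h3 : t ^ ρ / Real.Gamma (ρ + 1) * mlFun ρ lam 1 t ≤ mlFun ρ lam (ρ + 1) t := by
    rw [mlFun_one_eq hρ]
    linarith [mul_le_mul_of_nonneg_left h hlam]
  rw [div_mul_eq_mul_div, div_le_iff₀ hG] at h3
  linarith

lemma lam_mul_mlFun_one_le (hρ : 0 < ρ) (hρ1 : ρ ≤ 1) (hlam : 0 ≤ lam) {t : ℝ} (ht : 0 < t) :
    lam * mlFun ρ lam 1 t ≤ Real.Gamma (ρ + 1) / t ^ ρ := by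
  have hG := Real.Gamma_pos_of_pos (add_pos hρ one_pos)
  have hp := Real.rpow_pos_of_pos ht ρ
  rw [le_div_iff₀ hp]
  nlinarith [mul_le_mul_of_nonneg_left (rpow_mul_mlFun_one_le hρ hρ1 hlam ht) hlam,
    mul_le_mul_of_nonneg_left (lam_mul_mlFun_add_one_le hρ hρ1 hlam ht.le) hG.le]

lemma mlFun_add_one_le (hρ : 0 < ρ) (hρ1 : ρ ≤ 1) (hlam : 0 ≤ lam) {t : ℝ} (ht : 0 ≤ t) :
    mlFun ρ lam (ρ + 1) t ≤ t ^ ρ / Real.Gamma (ρ + 1) := by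
  rcases ht.eq_or_lt with rfl | ht
  · simp [mlFun_add_one_zero hρ, Real.zero_rpow hρ.ne']
  rw [mlFun_add_one_eq_sub hρ lam ht, sub_le_self_iff]
  exact mul_nonneg hlam (setIntegral_nonneg measurableSet_Ioo fun s hs =>
    mul_nonneg (fracKernel_pos hρ (sub_pos.2 hs.2)).le (mlFun_add_one_nonneg hρ hρ1 hlam hs.1.le))

/-- This lower bound controls division by e(T) in the source coefficients, at the cost of one factor
1 + lam. -/
lemma rpow_le_mul_mlFun_add_one (hρ : 0 < ρ) (hρ1 : ρ ≤ 1) (hlam : 0 ≤ lam) {t : ℝ} (ht : 0 < t) :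
    t ^ ρ ≤ (Real.Gamma (ρ + 1) + lam * t ^ ρ) * mlFun ρ lam (ρ + 1) t := by
  have h := rpow_mul_mlFun_one_le hρ hρ1 hlam ht
  rw [mlFun_one_eq hρ] at h
  linarith

lemma mlFun_add_one_pos (hρ : 0 < ρ) (hρ1 : ρ ≤ 1) (hlam : 0 ≤ lam) {t : ℝ} (ht : 0 < t) :
    0 < mlFun ρ lam (ρ + 1) t := by
  refine lt_of_le_of_ne (mlFun_add_one_nonneg hρ hρ1 hlam ht.le) fun h => ?_
  have h1 := rpow_le_mul_mlFun_add_one hρ hρ1 hlam ht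
  rw [← h, mul_zero] at h1
  exact absurd h1 (not_le.2 (Real.rpow_pos_of_pos ht ρ))

lemma mlFun_self_le (hρ : 0 < ρ) (hρ1 : ρ ≤ 1) (hlam : 0 ≤ lam) {t : ℝ} (ht : 0 < t) :
    mlFun ρ lam ρ t ≤ fracKernel ρ t := by
  rw [mlFun_eq_sub hρ lam ρ ht, sub_le_self_iff, ← fracInt_mlFun hρ lam hρ hρ ht]
  exact mul_nonneg hlam (setIntegral_nonneg measurableSet_Ioo fun s hs =>
    mul_nonneg (fracKernel_pos hρ (sub_pos.2 hs.2)).le (mlFun_self_pos hρ hρ1 hlam hs.1).le)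

/-- Decay of the resolvent kernel, uniform in the spectral parameter. -/
lemma lam_mul_mlFun_self_le (hρ : 0 < ρ) (hρ1 : ρ ≤ 1) (hlam : 0 ≤ lam) {t : ℝ} (ht : 0 < t) :
    lam * mlFun ρ lam ρ t ≤ ρ / t := by
  -- Both sides are fractional integrals of z. Pointwise ρ k_{ρ+1}(r) = r k_ρ(r) with r = t - s ≤ t.
  have h1 : ρ * mlFun ρ lam (ρ + (ρ + 1)) t ≤ t * mlFun ρ lam (ρ + ρ) t := by
    rw [← fracInt_mlFun hρ lam hρ hρ ht, ← fracInt_mlFun hρ lam (by linarith) hρ ht, fracInt,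
      fracInt, ← integral_const_mul, ← integral_const_mul]
    refine setIntegral_mono_on
      ((integrableOn_fracKernel_mul_mlFun hρ lam (by linarith) hρ t).const_mul _)
      ((integrableOn_fracKernel_mul_mlFun hρ lam hρ hρ t).const_mul _)
      measurableSet_Ioo fun s hs => ?_
    have hts := sub_pos.2 hs.2
    have hz := mlFun_self_pos hρ hρ1 hlam hs.1
    have hk := fracKernel_pos hρ hts
    rw [smul_eq_mul, smul_eq_mul, ← mul_assoc, ← mul_assoc, fracKernel_add_one hρ hts]
    have := hs.1
    gcongr
    linarith
  have h2 := mlFun_eq_sub hρ lam ρ ht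
  have h3 := mlFun_eq_sub hρ lam (ρ + 1) ht
  rw [show ρ + 1 + ρ = ρ + (ρ + 1) by ring] at h3
  have h4 := fracKernel_add_one hρ ht
  -- In the two Volterra equations the free terms agree, t k_ρ(t) = ρ k_{ρ+1}(t), so `h1` decides
  -- the comparison; multiplying by lam and using lam e ≤ 1 then gives the decay.
  have h5 : t * mlFun ρ lam ρ t ≤ ρ * mlFun ρ lam (ρ + 1) t := by
    rw [h2, h3]
    nlinarith [mul_le_mul_of_nonneg_left h1 hlam]
  rw [le_div_iff₀ ht]
  nlinarith [mul_le_mul_of_nonneg_left h5 hlam,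
    mul_le_mul_of_nonneg_left (lam_mul_mlFun_add_one_le hρ hρ1 hlam ht.le) hρ.le]

lemma hasDerivAt_mlFun_add_one (hρ : 0 < ρ) (lam : ℝ) {t : ℝ} (ht : 0 < t) :
    HasDerivAt (mlFun ρ lam (ρ + 1)) (mlFun ρ lam ρ t) t := by
  have hii : IntervalIntegrable (mlFun ρ lam ρ) volume 0 t := by
    rw [intervalIntegrable_iff_integrableOn_Ioo_of_le ht.le]
    exact integrableOn_mlFun hρ lam hρ t
  have h := intervalIntegral.integral_hasDerivAt_right hii
    ((continuousOn_mlFun hρ lam ρ).stronglyMeasurableAtFilter isOpen_Ioi t ht)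
    ((continuousOn_mlFun hρ lam ρ).continuousAt (Ioi_mem_nhds ht))
  refine h.congr_of_eventuallyEq ?_
  filter_upwards [Ioi_mem_nhds ht] with s hs
  rw [mlFun_add_one_eq_integral hρ lam hs, intervalIntegral.integral_of_le (le_of_lt hs),
    integral_Ioc_eq_integral_Ioo]

lemma hasDerivAt_mlFun_one (hρ : 0 < ρ) (lam : ℝ) {t : ℝ} (ht : 0 < t) :
    HasDerivAt (mlFun ρ lam 1) (-lam * mlFun ρ lam ρ t) t := by
  have h := ((hasDerivAt_mlFun_add_one hρ lam ht).const_mul lam).const_sub 1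
  rw [neg_mul]
  exact h.congr_of_eventuallyEq (Filter.Eventually.of_forall fun s => mlFun_one_eq hρ lam s)

/-- The homogeneous Abel-Volterra equation has only the trivial continuous solution. -/
theorem eq_zero_of_eq_fracInt (hρ : 0 < ρ) {T : ℝ} (lam : ℝ) {Y : ℝ → ℂ}
    (hY : ContinuousOn Y (Icc 0 T)) (h : ∀ t ∈ Icc 0 T, Y t = -(lam : ℂ) * fracInt ρ Y t) :
    ∀ t ∈ Icc 0 T, Y t = 0 := by
  obtain ⟨M, hM⟩ := isCompact_Icc.exists_bound_of_continuousOn hY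
  -- Iterating the equation k times bounds Y by M times the k-th term of a Mittag-Leffler series
  -- with parameter -|lam|; terms of a convergent series tend to 0.
  have hbound : ∀ k : ℕ, ∀ t ∈ Ioc 0 T, ‖Y t‖ ≤ M * (|lam| ^ k * fracKernel (ρ * k + 1) t) := by
    intro k
    induction k with
    | zero =>
      intro t ht
      simpa [fracKernel_one] using hM t (Ioc_subset_Icc_self ht)
    | succ k ih =>
      intro t ht
      have hk : 0 < ρ * k + 1 := by positivity
      rw [h t (Ioc_subset_Icc_self ht), norm_mul, norm_neg, Complex.norm_real, Real.norm_eq_abs]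
      have h1 : ‖fracInt ρ Y t‖ ≤ ∫ s in Ioo 0 t,
          M * |lam| ^ k * (fracKernel ρ (t - s) * fracKernel (ρ * k + 1) s) := by
        refine norm_integral_le_of_norm_le ((integrableOn_fracKernel_mul hρ hk).const_mul _) ?_
        filter_upwards [ae_restrict_mem measurableSet_Ioo] with s hs
        have hp := fracKernel_pos hρ (sub_pos.2 hs.2)
        rw [norm_smul, Real.norm_of_nonneg hp.le]
        calc _ ≤ fracKernel ρ (t - s) * (M * (|lam| ^ k * fracKernel (ρ * k + 1) s)) := by
              gcongr
              exact ih s ⟨hs.1, hs.2.le.trans ht.2⟩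
          _ = _ := by ring
      rw [integral_const_mul, integral_fracKernel_mul hρ hk ht.1] at h1
      calc _ ≤ |lam| * (M * |lam| ^ k * fracKernel (ρ + (ρ * k + 1)) t) := by gcongr
        _ = _ := by
          rw [show ρ + (ρ * k + 1) = ρ * ((k + 1 : ℕ) : ℝ) + 1 by push_cast; ring, pow_succ]
          ring
  intro t ht
  rcases ht.1.eq_or_lt with rfl | ht0
  · rw [h _ ht, fracInt_of_nonpos _ _ le_rfl, mul_zero]
  have hs := (hasSum_mlFun hρ (-|lam|) 1 ht0).summable.tendsto_atTop_zero.const_mul M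
  simp only [neg_neg, mul_zero] at hs
  exact norm_le_zero_iff.1 (ge_of_tendsto' hs fun k => hbound k t ⟨ht0, ht.2⟩)

end mlBounds

/-! ### Trigonometric series -/

variable {N : ℕ}

/-- The trigonometric series with coefficients `c`. -/
def trigSeries (c : (Fin N → ℤ) → ℂ) (x : Fin N → ℝ) : ℂ := ∑' n, c n * expMode n x

/-- Summability of `c` with the weight `(1 + ‖n‖)^k`. -/
def WeightSummable (k : ℕ) (c : (Fin N → ℤ) → ℂ) : Prop :=
  Summable fun n => (1 + ‖n‖) ^ k * ‖c n‖

/-- The linear form `x ↦ ∑ n_j x_j`. -/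
def phase (n : Fin N → ℤ) : (Fin N → ℝ) →L[ℝ] ℂ :=
  ∑ j, (n j : ℂ) • (Complex.ofRealCLM.comp (ContinuousLinearMap.proj j))

lemma phase_apply (n : Fin N → ℤ) (x : Fin N → ℝ) : phase n x = ∑ j, (n j : ℂ) * (x j : ℂ) := by
  simp [phase]

lemma phase_single (n : Fin N → ℤ) (j : Fin N) (r : ℝ) :
    phase n (Pi.single j r) = n j * r := by
  rw [phase_apply, Finset.sum_eq_single j]
  · simp
  · intro i _ hi; simp [hi]
  · simp

lemma norm_phase_le (n : Fin N → ℤ) : ‖phase n‖ ≤ N * ‖n‖ := by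
  refine ContinuousLinearMap.opNorm_le_bound _ (by positivity) fun x => ?_
  rw [phase_apply]
  refine (norm_sum_le _ _).trans ?_
  calc ∑ j, ‖(n j : ℂ) * (x j : ℂ)‖ ≤ ∑ _j : Fin N, ‖n‖ * ‖x‖ := by
        refine Finset.sum_le_sum fun j _ => ?_
        rw [norm_mul, Complex.norm_real, Complex.norm_intCast, ← Int.norm_eq_abs]
        gcongr
        · exact norm_le_pi_norm n j
        · exact norm_le_pi_norm x j
    _ = N * ‖n‖ * ‖x‖ := by simp [mul_assoc]

lemma expMode_eq (n : Fin N → ℤ) (x : Fin N → ℝ) :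
    expMode n x = Complex.exp (Complex.I * phase n x) := by
  rw [expMode, phase_apply]

lemma norm_expMode (n : Fin N → ℤ) (x : Fin N → ℝ) : ‖expMode n x‖ = 1 := by
  have : ∑ j, (n j : ℂ) * (x j : ℂ) = ((∑ j, (n j : ℝ) * x j : ℝ) : ℂ) := by push_cast; rfl
  rw [expMode, this, mul_comm, Complex.norm_exp_ofReal_mul_I]

lemma continuous_expMode (n : Fin N → ℤ) : Continuous (expMode n) := by
  simp_rw [funext (expMode_eq n)]
  exact Complex.continuous_exp.comp (continuous_const.mul (phase n).continuous)

lemma isPeriodic_expMode (n : Fin N → ℤ) : IsPeriodic (expMode n) := by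
  intro x j
  rw [expMode_eq, expMode_eq, map_add, phase_single, mul_add, Complex.exp_add]
  have : Complex.exp (Complex.I * (n j * ((2 * Real.pi : ℝ) : ℂ))) = 1 := by
    rw [Complex.exp_eq_one_iff]
    exact ⟨n j, by push_cast; ring⟩
  rw [this, mul_one]

lemma conj_expMode (n : Fin N → ℤ) (x : Fin N → ℝ) :
    (starRingEnd ℂ) (expMode n x) = expMode (-n) x := by
  simp [expMode, ← Complex.exp_conj]

lemma hasFDerivAt_expMode (n : Fin N → ℤ) (x : Fin N → ℝ) :
    HasFDerivAt (expMode n) ((expMode n x * Complex.I) • phase n) x := by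
  have h := (((phase n).hasFDerivAt (x := x)).const_mul Complex.I).cexp
  simp_rw [funext (expMode_eq n)]
  rwa [smul_smul] at h

lemma WeightSummable.mono {k l : ℕ} {c : (Fin N → ℤ) → ℂ} (h : WeightSummable l c) (hkl : k ≤ l) :
    WeightSummable k c := by
  refine Summable.of_nonneg_of_le (fun n => by positivity) (fun n => ?_) h
  gcongr
  linarith [norm_nonneg n]

lemma WeightSummable.norm {k : ℕ} {c : (Fin N → ℤ) → ℂ} (h : WeightSummable k c) :
    Summable fun n => ‖c n‖ := by
  simpa [WeightSummable] using h.mono (Nat.zero_le k)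

lemma weightSummable_zero {c : (Fin N → ℤ) → ℂ} :
    WeightSummable 0 c ↔ Summable fun n => ‖c n‖ := by
  simp [WeightSummable]

lemma WeightSummable.mul_coord {k : ℕ} {c : (Fin N → ℤ) → ℂ} (h : WeightSummable (k + 1) c)
    (j : Fin N) : WeightSummable k fun n => (n j : ℂ) * c n := by
  refine Summable.of_nonneg_of_le (fun n => by positivity) (fun n => ?_) h
  rw [norm_mul, Complex.norm_intCast, ← Int.norm_eq_abs, pow_succ, mul_assoc]
  gcongr
  linarith [norm_le_pi_norm n j]

lemma WeightSummable.mul_coord_pow {k l : ℕ} {c : (Fin N → ℤ) → ℂ} (h : WeightSummable (k + l) c)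
    (j : Fin N) : WeightSummable k fun n => (n j : ℂ) ^ l * c n := by
  induction l generalizing k with
  | zero => simpa using h
  | succ l ih =>
    have := (ih (k := k + 1) (by rwa [add_right_comm])).mul_coord j
    simpa only [pow_succ', mul_assoc] using this

lemma summable_trigSeries {c : (Fin N → ℤ) → ℂ} (h : Summable fun n => ‖c n‖) (x : Fin N → ℝ) :
    Summable fun n => c n * expMode n x :=
  Summable.of_norm (by simpa [norm_expMode] using h)

lemma continuous_trigSeries {c : (Fin N → ℤ) → ℂ} (h : Summable fun n => ‖c n‖) :
    Continuous (trigSeries c) :=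
  continuous_tsum (fun n => continuous_const.mul (continuous_expMode n)) h
    fun n x => by simp [norm_expMode]

lemma isPeriodic_trigSeries (c : (Fin N → ℤ) → ℂ) : IsPeriodic (trigSeries c) := by
  intro x j
  simp only [trigSeries, isPeriodic_expMode _ x j]

lemma hasFDerivAt_trigSeries {c : (Fin N → ℤ) → ℂ} (h : WeightSummable 1 c) (x : Fin N → ℝ) :
    HasFDerivAt (trigSeries c) (∑' n, (c n * (expMode n x * Complex.I)) • phase n) x := by
  have hu : Summable fun n => N * ((1 + ‖n‖) ^ 1 * ‖c n‖) := Summable.mul_left _ h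
  refine hasFDerivAt_tsum (f := fun n x => c n * expMode n x)
    (f' := fun n x => (c n * (expMode n x * Complex.I)) • phase n) hu (fun n x => ?_)
    (fun n x => ?_) (x₀ := 0) (summable_trigSeries h.norm 0) x
  · have := (hasFDerivAt_expMode n x).const_mul (c n)
    rwa [smul_smul] at this
  · rw [norm_smul, norm_mul, norm_mul, norm_expMode, Complex.norm_I, mul_one, mul_one, pow_one]
    calc ‖c n‖ * ‖phase n‖ ≤ ‖c n‖ * (N * ‖n‖) := by gcongr; exact norm_phase_le n
      _ ≤ ‖c n‖ * (N * (1 + ‖n‖)) := by gcongr; linarith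
      _ = _ := by ring

lemma fderiv_trigSeries_apply {c : (Fin N → ℤ) → ℂ} (h : WeightSummable 1 c) (x y : Fin N → ℝ) :
    fderiv ℝ (trigSeries c) x y = ∑ j, Complex.I * (y j : ℂ) *
      trigSeries (fun n => (n j : ℂ) * c n) x := by
  have hs : Summable fun n => (c n * (expMode n x * Complex.I)) • phase n := by
    refine Summable.of_norm_bounded (g := fun n => N * ((1 + ‖n‖) ^ 1 * ‖c n‖))
      (Summable.mul_left _ h) fun n => ?_
    rw [norm_smul, norm_mul, norm_mul, norm_expMode, Complex.norm_I, mul_one, mul_one, pow_one]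
    calc ‖c n‖ * ‖phase n‖ ≤ ‖c n‖ * (N * ‖n‖) := by gcongr; exact norm_phase_le n
      _ ≤ ‖c n‖ * (N * (1 + ‖n‖)) := by gcongr; linarith
      _ = _ := by ring
  rw [(hasFDerivAt_trigSeries h x).fderiv]
  have h1 := (ContinuousLinearMap.apply ℝ ℂ y).map_tsum hs
  simp only [ContinuousLinearMap.apply_apply] at h1
  have hj : ∀ j : Fin N, Summable fun n : Fin N → ℤ => Complex.I * (y j : ℂ) *
      ((n j : ℂ) * c n * expMode n x) := fun j =>
    (summable_trigSeries (WeightSummable.mul_coord (k := 0) h j).norm x).mul_left _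
  simp only [trigSeries, ← tsum_mul_left]
  rw [h1, ← Summable.tsum_finsetSum fun j _ => hj j]
  congr 1; ext n
  rw [smul_apply, phase_apply, smul_eq_mul, Finset.mul_sum]
  exact Finset.sum_congr rfl fun j _ => by ring

lemma partialD_trigSeries {c : (Fin N → ℤ) → ℂ} (h : WeightSummable 1 c) (j : Fin N) :
    partialD j (trigSeries c) = trigSeries fun n => (n j : ℂ) * c n := by
  ext x
  rw [partialD, fderiv_trigSeries_apply h, Finset.sum_eq_single j]
  · simp only [Pi.single_eq_same, Complex.ofReal_one, mul_one, ← mul_assoc]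
    simp
  · intro i _ hi; simp [hi]
  · simp

lemma contDiff_trigSeries {k : ℕ} {c : (Fin N → ℤ) → ℂ} (h : WeightSummable k c) :
    ContDiff ℝ k (trigSeries c) := by
  induction k generalizing c with
  | zero => exact contDiff_zero.2 (continuous_trigSeries h.norm)
  | succ k ih =>
    have h1 : WeightSummable 1 c := h.mono (Nat.le_add_left 1 k)
    rw [Nat.cast_succ, contDiff_succ_iff_fderiv_apply]
    refine ⟨fun x => (hasFDerivAt_trigSeries h1 x).differentiableAt, by simp, fun y => ?_⟩
    simp_rw [fderiv_trigSeries_apply h1]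
    exact ContDiff.sum fun j _ => contDiff_const.mul (ih (h.mul_coord j))

lemma partialD_iterate_trigSeries {l : ℕ} {c : (Fin N → ℤ) → ℂ} (h : WeightSummable l c)
    (j : Fin N) : (partialD j)^[l] (trigSeries c) = trigSeries fun n => (n j : ℂ) ^ l * c n := by
  induction l with
  | zero => simp
  | succ l ih =>
    rw [Function.iterate_succ_apply', ih (h.mono (Nat.le_succ l)),
      partialD_trigSeries (WeightSummable.mul_coord_pow (k := 1) (by rwa [add_comm]) j)]
    simp only [pow_succ', mul_assoc]

lemma foldr_partialD_trigSeries (α : Fin N →₀ ℕ) (l : List (Fin N)) {k : ℕ}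
    {c : (Fin N → ℤ) → ℂ} (h : WeightSummable (k + (l.map α).sum) c) :
    WeightSummable k (fun n => (l.map fun j => (n j : ℂ) ^ α j).prod * c n) ∧
    l.foldr (fun j w => (partialD j)^[α j] w) (trigSeries c) =
      trigSeries fun n => (l.map fun j => (n j : ℂ) ^ α j).prod * c n := by
  induction l generalizing k with
  | nil => simpa using h
  | cons a l ih =>
    rw [List.map_cons, List.sum_cons, ← add_assoc] at h
    obtain ⟨h1, h2⟩ := ih h
    simp only [List.map_cons, List.prod_cons, mul_assoc, List.foldr_cons]
    refine ⟨h1.mul_coord_pow a, ?_⟩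
    rw [h2, partialD_iterate_trigSeries (h1.mono (Nat.le_add_left _ _))]

lemma multiD_trigSeries {m : ℕ} (α : Fin N →₀ ℕ) (hα : ∑ j, α j = m) {c : (Fin N → ℤ) → ℂ}
    (h : WeightSummable m c) :
    WeightSummable 0 (fun n => (∏ j, (n j : ℂ) ^ α j) * c n) ∧
    multiD α (trigSeries c) = trigSeries fun n => (∏ j, (n j : ℂ) ^ α j) * c n := by
  have hp : ∀ n : Fin N → ℤ, ((List.finRange N).map fun j => (n j : ℂ) ^ α j).prod =
      ∏ j, (n j : ℂ) ^ α j := fun n => by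
    rw [← List.ofFn_eq_map, List.prod_ofFn]
  have h' := foldr_partialD_trigSeries α (List.finRange N) (k := 0) (c := c)
    (by rwa [zero_add, ← List.ofFn_eq_map, List.sum_ofFn, hα])
  simpa only [hp, multiD] using h'

lemma diffOp_trigSeries {m : ℕ} {A : MvPolynomial (Fin N) ℂ} (hA : A.IsHomogeneous m)
    {c : (Fin N → ℤ) → ℂ} (h : WeightSummable m c) :
    diffOp A (trigSeries c) = trigSeries fun n => symbolAt A n * c n := by
  -- Homogeneity: every monomial costs exactly m powers of the weight.
  have hα : ∀ α ∈ A.support, ∑ j, α j = m := fun α hα => by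
    have h1 := hA (MvPolynomial.mem_support_iff.1 hα)
    rw [← h1, Finsupp.weight_apply, Finsupp.sum_fintype _ _ (by simp)]
    simp
  ext x
  have hs : ∀ α ∈ A.support, Summable fun n : Fin N → ℤ =>
      A.coeff α * ((∏ j, (n j : ℂ) ^ α j) * c n * expMode n x) := fun α h1 =>
    (summable_trigSeries (multiD_trigSeries α (hα α h1) h).1.norm x).mul_left _
  rw [diffOp, trigSeries]
  calc ∑ α ∈ A.support, A.coeff α * multiD α (trigSeries c) x
      = ∑ α ∈ A.support, ∑' n : Fin N → ℤ,
          A.coeff α * ((∏ j, (n j : ℂ) ^ α j) * c n * expMode n x) := by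
        refine Finset.sum_congr rfl fun α h1 => ?_
        rw [(multiD_trigSeries α (hα α h1) h).2, trigSeries, tsum_mul_left]
    _ = _ := by
        rw [← Summable.tsum_finsetSum hs]
        congr 1; ext n
        rw [symbolAt, MvPolynomial.eval_eq', Finset.sum_mul, Finset.sum_mul]
        exact Finset.sum_congr rfl fun α _ => by ring

lemma weightSummable_single (k : ℕ) (n : Fin N → ℤ) : WeightSummable k (Pi.single n (1 : ℂ)) := by
  refine summable_of_ne_finset_zero (s := {n}) fun l hl => ?_
  simp only [Finset.mem_singleton] at hl
  simp [hl]

/-- Through this identity the exponentials inherit smoothness and the eigenfunction relation from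
the lemmas on series. -/
lemma trigSeries_single (n : Fin N → ℤ) : trigSeries (Pi.single n (1 : ℂ)) = expMode n := by
  ext x
  rw [trigSeries, tsum_eq_single n]
  · simp
  · intro l hl; simp [hl]

lemma contDiff_expMode (k : ℕ) (n : Fin N → ℤ) : ContDiff ℝ k (expMode n) := by
  rw [← trigSeries_single]
  exact contDiff_trigSeries (weightSummable_single k n)

lemma diffOp_expMode {m : ℕ} {A : MvPolynomial (Fin N) ℂ} (hA : A.IsHomogeneous m)
    (n : Fin N → ℤ) (x : Fin N → ℝ) :
    diffOp A (expMode n) x = symbolAt A n * expMode n x := by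
  rw [← trigSeries_single, diffOp_trigSeries hA (weightSummable_single m n), trigSeries,
    trigSeries, ← tsum_mul_left, tsum_eq_single n, tsum_eq_single n]
  · simp
  · intro l hl; simp [hl]
  · intro l hl; simp [hl]

/-! ### Fourier coefficients on the cube -/

/-! ### Transfer of Fourier theory from the unit torus to the cube. -/

section Transfer

local instance : MeasureSpace UnitAddCircle := ⟨AddCircle.haarAddCircle⟩

local instance : IsProbabilityMeasure (volume : Measure UnitAddCircle) :=
  inferInstanceAs (IsProbabilityMeasure AddCircle.haarAddCircle)

/-- The section of the covering of the torus with values in the cube. -/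
def torusSection (N : ℕ) (y : UnitAddTorus (Fin N)) : Fin N → ℝ :=
  (2 * Real.pi) • (UnitAddTorus.measurableEquivPiIoc (fun _ : Fin N => (-1 / 2 : ℝ)) y).1

lemma measurableSet_cube (N : ℕ) : MeasurableSet (cube N) :=
  MeasurableSet.univ_pi fun _ => measurableSet_Ioc

lemma measurableEmbedding_torusSection (N : ℕ) : MeasurableEmbedding (torusSection N) := by
  have h1 : MeasurableEmbedding fun x : Fin N → ℝ => (2 * Real.pi) • x :=
    (Homeomorph.smulOfNeZero (2 * Real.pi) Real.two_pi_pos.ne').measurableEmbedding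
  have h2 : MeasurableSet {x : Fin N → ℝ | ∀ i, x i ∈ Ioc (-1 / 2 : ℝ) (-1 / 2 + 1)} :=
    MeasurableSet.univ_pi' fun _ => measurableSet_Ioc
  exact h1.comp ((MeasurableEmbedding.subtype_coe h2).comp
    (UnitAddTorus.measurableEquivPiIoc _).measurableEmbedding)

/-- The section is a bijection onto (-1/2, 1/2]^N followed by dilation by 2π. The resulting factor
(2π)^{-N} is the normalisation of `fourierCoef`, so the two kinds of coefficients agree without a
constant. -/
lemma map_torusSection (N : ℕ) : Measure.map (torusSection N) volume =
    ENNReal.ofReal ((2 * Real.pi) ^ N)⁻¹ • volume.restrict (cube N) := by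
  have h1 : MeasurableEmbedding fun x : Fin N → ℝ => (2 * Real.pi) • x :=
    (Homeomorph.smulOfNeZero (2 * Real.pi) Real.two_pi_pos.ne').measurableEmbedding
  have h2 : MeasurableSet {x : Fin N → ℝ | ∀ i, x i ∈ Ioc (-1 / 2 : ℝ) (-1 / 2 + 1)} :=
    MeasurableSet.univ_pi' fun _ => measurableSet_Ioc
  have hpre : (fun x : Fin N → ℝ => (2 * Real.pi) • x) ⁻¹' cube N =
      {x : Fin N → ℝ | ∀ i, x i ∈ Ioc (-1 / 2 : ℝ) (-1 / 2 + 1)} := by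
    ext x
    have hpi := Real.pi_pos
    simp only [cube, mem_preimage, mem_pi, mem_univ, true_implies, mem_ofPred_eq, Pi.smul_apply,
      smul_eq_mul, mem_Ioc]
    refine forall_congr' fun i => and_congr ?_ ?_ <;> constructor <;> intro h <;> nlinarith
  have h3 : Measure.map (torusSection N) volume = Measure.map (fun x => (2 * Real.pi) • x)
      (Measure.map Subtype.val (Measure.map
        (UnitAddTorus.measurableEquivPiIoc (fun _ : Fin N => (-1 / 2 : ℝ))) volume)) := by
    rw [Measure.map_map measurable_subtype_coe (MeasurableEquiv.measurable _),
      Measure.map_map h1.measurable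
        (measurable_subtype_coe.comp (MeasurableEquiv.measurable _))]
    rfl
  have h4 : Measure.map
      (Subtype.val : {x : Fin N → ℝ // ∀ i, x i ∈ Ioc (-1 / 2 : ℝ) (-1 / 2 + 1)} → Fin N → ℝ)
      (Measure.comap Subtype.val volume) =
      volume.restrict {x : Fin N → ℝ | ∀ i, x i ∈ Ioc (-1 / 2 : ℝ) (-1 / 2 + 1)} :=
    map_comap_subtype_coe h2 volume
  rw [h3, (UnitAddTorus.measurePreserving_equivPiIoc _).map_eq, h4, ← hpre, ← h1.restrict_map,
    Measure.map_addHaar_smul _ Real.two_pi_pos.ne', Measure.restrict_smul]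
  simp [abs_of_pos Real.pi_pos]

lemma mFourier_eq_expMode (n : Fin N → ℤ) (y : UnitAddTorus (Fin N)) :
    UnitAddTorus.mFourier n y = expMode n (torusSection N y) := by
  have hy : ∀ j, y j = (((UnitAddTorus.measurableEquivPiIoc
      (fun _ : Fin N => (-1 / 2 : ℝ)) y).1 j : ℝ) : UnitAddCircle) := fun j =>
    (congrFun ((UnitAddTorus.measurableEquivPiIoc (fun _ : Fin N => (-1 / 2 : ℝ))).symm_apply_apply
      y) j).symm
  rw [expMode, Finset.mul_sum, Complex.exp_sum]
  change ∏ j, fourier (n j) (y j) = _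
  refine Finset.prod_congr rfl fun j _ => ?_
  rw [hy j, fourier_coe_apply]
  congr 1
  simp only [torusSection, Pi.smul_apply, smul_eq_mul]
  push_cast
  ring

lemma fourierCoef_eq_mFourierCoeff (g : (Fin N → ℝ) → ℂ) (n : Fin N → ℤ) :
    fourierCoef g n = UnitAddTorus.mFourierCoeff (g ∘ torusSection N) n := by
  have h := (measurableEmbedding_torusSection N).integral_map (μ := volume)
    (fun x => expMode (-n) x * g x)
  rw [map_torusSection, integral_smul_measure, ENNReal.toReal_ofReal (by positivity)] at h
  simp only [UnitAddTorus.mFourierCoeff, mFourier_eq_expMode, smul_eq_mul, Function.comp]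
  rw [← h, fourierCoef, Complex.real_smul]
  push_cast
  rw [inv_pow]
  simp only [mul_comm]

lemma fourierCoef_expMode (l n : Fin N → ℤ) :
    fourierCoef (expMode l) n = if l = n then 1 else 0 := by
  have h := orthonormal_iff_ite.1 (UnitAddTorus.orthonormal_mFourier (d := Fin N)) n l
  simp only [ContinuousMap.inner_toLp] at h
  rw [fourierCoef_eq_mFourierCoeff, UnitAddTorus.mFourierCoeff]
  simp only [eq_comm (a := l), ← h, Function.comp, ← mFourier_eq_expMode, smul_eq_mul,
    UnitAddTorus.mFourier_neg, mul_comm]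

/-- Completeness of the exponentials in `L_2` of the cube. -/
lemma ae_eq_zero_of_fourierCoef {g : (Fin N → ℝ) → ℂ}
    (hg : MemLp g 2 (volume.restrict (cube N))) (h : ∀ n, fourierCoef g n = 0) :
    g =ᵐ[volume.restrict (cube N)] 0 := by
  have hθ := measurableEmbedding_torusSection N
  have hc : ENNReal.ofReal ((2 * Real.pi) ^ N)⁻¹ ≠ 0 := by
    rw [Ne, ENNReal.ofReal_eq_zero, not_le]; positivity
  have hG : MemLp (g ∘ torusSection N) 2 volume := by
    rw [← hθ.memLp_map_measure_iff, map_torusSection]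
    exact hg.smul_measure ENNReal.ofReal_ne_top
  have h0 : hG.toLp = 0 := by
    apply UnitAddTorus.mFourierBasis.repr.injective
    rw [map_zero]
    ext n
    rw [UnitAddTorus.mFourierBasis_repr]
    have : UnitAddTorus.mFourierCoeff (hG.toLp) n =
        UnitAddTorus.mFourierCoeff (g ∘ torusSection N) n := by
      refine integral_congr_ae ?_
      filter_upwards [hG.coeFn_toLp] with y hy
      rw [hy]
    rw [this, ← fourierCoef_eq_mFourierCoeff, h n]
    rfl
  have h1 : g ∘ torusSection N =ᵐ[volume] 0 := by
    refine hG.coeFn_toLp.symm.trans ?_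
    rw [h0]
    exact Lp.coeFn_zero _ _ _
  have h2 : ∀ᵐ x ∂(Measure.map (torusSection N) volume), g x = 0 := by
    rw [hθ.ae_map_iff]; exact h1
  rw [map_torusSection] at h2
  exact (Measure.ae_ennreal_smul_measure_iff hc).1 h2

end Transfer

lemma volume_cube_lt_top (N : ℕ) : volume (cube N) < ⊤ := by
  rw [cube, volume_pi_pi]
  exact ENNReal.prod_lt_top fun _ _ => by simp

lemma continuous_integrableOn_cube {g : (Fin N → ℝ) → ℂ} (hg : Continuous g) :
    IntegrableOn g (cube N) :=
  (hg.continuousOn.integrableOn_compact (isCompact_univ_pi fun _ => isCompact_Icc)).mono_set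
    (pi_mono fun _ _ => Ioc_subset_Icc_self)

lemma memLp_cube_of_continuous {g : (Fin N → ℝ) → ℂ} (hg : Continuous g) :
    MemLp g 2 (volume.restrict (cube N)) := by
  obtain ⟨C, hC⟩ := (isCompact_univ_pi fun _ : Fin N =>
    isCompact_Icc (a := -Real.pi) (b := Real.pi)).exists_bound_of_continuousOn hg.continuousOn
  have : IsFiniteMeasure (volume.restrict (cube N)) := ⟨by simpa using volume_cube_lt_top N⟩
  refine MemLp.of_bound hg.aestronglyMeasurable C ?_
  filter_upwards [ae_restrict_mem (measurableSet_cube N)] with x hx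
  exact hC x fun i hi => Ioc_subset_Icc_self (hx i hi)

lemma fourierCoef_sub {g h : (Fin N → ℝ) → ℂ} (hg : MemLp g 2 (volume.restrict (cube N)))
    (hh : MemLp h 2 (volume.restrict (cube N))) (n : Fin N → ℤ) :
    fourierCoef (g - h) n = fourierCoef g n - fourierCoef h n := by
  have : IsFiniteMeasure (volume.restrict (cube N)) := ⟨by simpa using volume_cube_lt_top N⟩
  have hint : ∀ {g : (Fin N → ℝ) → ℂ}, MemLp g 2 (volume.restrict (cube N)) →
      IntegrableOn (fun x => g x * expMode (-n) x) (cube N) := fun {g} hg => by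
    refine (hg.integrable one_le_two).mul_bdd (c := 1)
      (continuous_expMode (-n)).aestronglyMeasurable ?_
    exact Filter.Eventually.of_forall fun x => (norm_expMode _ _).le
  simp only [fourierCoef, Pi.sub_apply, sub_mul]
  rw [integral_sub (hint hg) (hint hh), mul_sub]

lemma fourierCoef_trigSeries {c : (Fin N → ℤ) → ℂ} (h : Summable fun n => ‖c n‖) (n : Fin N → ℤ) :
    fourierCoef (trigSeries c) n = c n := by
  have hF : ∀ l : Fin N → ℤ, IntegrableOn (fun x => c l * (expMode l x * expMode (-n) x))
      (cube N) := fun l => continuous_integrableOn_cube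
    (continuous_const.mul ((continuous_expMode l).mul (continuous_expMode _)))
  have hs : Summable fun l : Fin N → ℤ =>
      ∫ x in cube N, ‖c l * (expMode l x * expMode (-n) x)‖ := by
    simp only [norm_mul, norm_expMode, mul_one, integral_const, smul_eq_mul]
    exact h.mul_left _
  have hsum := integral_tsum_of_summable_integral_norm hF hs
  have h1 : ∀ x, trigSeries c x * expMode (-n) x =
      ∑' l, c l * (expMode l x * expMode (-n) x) := fun x => by
    rw [trigSeries, ← tsum_mul_right]
    simp only [mul_assoc]
  rw [fourierCoef]
  simp_rw [h1]
  rw [← hsum, ← tsum_mul_left, tsum_eq_single n]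
  · have := fourierCoef_expMode n n
    rw [fourierCoef, if_pos rfl] at this
    rw [integral_const_mul, mul_left_comm, this, mul_one]
  · intro l hl
    have := fourierCoef_expMode l n
    rw [fourierCoef, if_neg hl] at this
    rw [integral_const_mul, mul_left_comm, this, mul_zero]

lemma IsPeriodic.add_int_smul {g : (Fin N → ℝ) → ℂ} (hg : IsPeriodic g) (k : Fin N → ℤ)
    (x : Fin N → ℝ) : g (x + fun j => k j * (2 * Real.pi)) = g x := by
  let P : AddSubgroup (Fin N → ℝ) :=
    { carrier := {p | ∀ x, g (x + p) = g x}
      zero_mem' := fun x => by simp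
      add_mem' := fun {p q} hp hq x => by rw [← add_assoc, hq, hp]
      neg_mem' := fun {p} hp x => by
        have := hp (x + -p)
        rw [neg_add_cancel_right] at this
        exact this.symm }
  have h1 : ∀ j, (Pi.single j (2 * Real.pi) : Fin N → ℝ) ∈ P := fun j x => hg x j
  have h2 : ∑ j, k j • (Pi.single j (2 * Real.pi) : Fin N → ℝ) ∈ P :=
    sum_mem fun j _ => zsmul_mem (h1 j) _
  have h3 : ∑ j, k j • (Pi.single j (2 * Real.pi) : Fin N → ℝ) = fun j => k j * (2 * Real.pi) := by
    ext i
    rw [Finset.sum_apply, Finset.sum_eq_single i]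
    · simp
    · intro j _ hj; simp [Pi.single_eq_of_ne hj.symm]
    · simp
  rw [← h3]
  exact h2 x

/-- The translates of the cube by 2πℤ^N cover ℝ^N, and countably many translates of a null set form
a null set. -/
lemma IsPeriodic.ae_eq_zero {g : (Fin N → ℝ) → ℂ} (hg : IsPeriodic g)
    (h : g =ᵐ[volume.restrict (cube N)] 0) : g =ᵐ[volume] 0 := by
  have h0 : ∀ᵐ x, x ∈ cube N → g x = 0 := (ae_restrict_iff' (measurableSet_cube N)).1 h
  have h1 : ∀ k : Fin N → ℤ, ∀ᵐ x : Fin N → ℝ, (x + fun j => k j * (2 * Real.pi)) ∈ cube N →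
      g (x + fun j => k j * (2 * Real.pi)) = 0 := fun k =>
    (measurePreserving_add_right volume (fun j => (k j : ℝ) * (2 * Real.pi))).quasiMeasurePreserving.ae
      h0
  filter_upwards [ae_all_iff.2 h1] with x hx
  choose k hk using fun j => (existsUnique_add_zsmul_mem_Ioc Real.two_pi_pos (x j)
    (-Real.pi)).exists
  have hmem : (x + fun j => k j * (2 * Real.pi)) ∈ cube N := fun j _ => by
    have := hk j
    rw [show -Real.pi + 2 * Real.pi = Real.pi by ring, zsmul_eq_mul] at this
    exact this
  have := hx k hmem
  rwa [hg.add_int_smul] at this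

lemma IsPeriodic.sub {g h : (Fin N → ℝ) → ℂ} (hg : IsPeriodic g) (hh : IsPeriodic h) :
    IsPeriodic (g - h) := fun x j => by simp [hg x j, hh x j]

lemma ae_eq_of_fourierCoef_eq {g h : (Fin N → ℝ) → ℂ} (hg : IsPeriodic g) (hh : IsPeriodic h)
    (hgm : MemLp g 2 (volume.restrict (cube N))) (hhm : MemLp h 2 (volume.restrict (cube N)))
    (heq : ∀ n, fourierCoef g n = fourierCoef h n) : g =ᵐ[volume] h := by
  have := (hg.sub hh).ae_eq_zero (ae_eq_zero_of_fourierCoef (hgm.sub hhm) fun n => by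
    rw [fourierCoef_sub hgm hhm, heq, sub_self])
  filter_upwards [this] with x hx
  exact sub_eq_zero.1 hx

lemma eq_of_fourierCoef_eq {g h : (Fin N → ℝ) → ℂ} (hg : IsPeriodic g) (hh : IsPeriodic h)
    (hgc : Continuous g) (hhc : Continuous h)
    (heq : ∀ n, fourierCoef g n = fourierCoef h n) : g = h :=
  (hgc.ae_eq_iff_eq volume hhc).1 (ae_eq_of_fourierCoef_eq hg hh (memLp_cube_of_continuous hgc)
    (memLp_cube_of_continuous hhc) heq)

/-! ### The symbol of the operator and Sobolev coefficients -/

/-- The real value of the symbol at `n`. -/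
def eigenval (A : MvPolynomial (Fin N) ℂ) (n : Fin N → ℤ) : ℝ := (symbolAt A n).re

lemma expMode_mul_neg (n : Fin N → ℤ) (x : Fin N → ℝ) : expMode n x * expMode (-n) x = 1 := by
  rw [← conj_expMode, Complex.mul_conj, Complex.normSq_eq_norm_sq, norm_expMode]
  simp

lemma volume_real_cube_pos (N : ℕ) : 0 < volume.real (cube N) := by
  rw [cube, measureReal_def, volume_pi_pi, ENNReal.toReal_prod]
  refine Finset.prod_pos fun j _ => ?_
  rw [Real.volume_Ioc, ENNReal.toReal_ofReal (by linarith [Real.pi_pos])]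
  linarith [Real.pi_pos]

section Symbol

variable {m : ℕ} {A : MvPolynomial (Fin N) ℂ}

/-- Symmetry tested on v = w = e^{inx} reads A(n)|cube| = conj(A(n))|cube|. -/
lemma symbolAt_eq_eigenval (hA : IsEllipticSymmPos m A) (n : Fin N → ℤ) :
    symbolAt A n = (eigenval A n : ℂ) := by
  have h := hA.symmetric _ _ (isPeriodic_expMode n) (isPeriodic_expMode n) (contDiff_expMode m n)
    (contDiff_expMode m n)
  simp only [diffOp_expMode hA.homogeneous, map_mul, conj_expMode] at h
  simp only [mul_assoc, mul_left_comm (expMode n _), expMode_mul_neg, mul_one, integral_const,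
    MeasurableSet.univ, measureReal_restrict_apply, univ_inter] at h
  have hV := (volume_real_cube_pos N).ne'
  have h1 : symbolAt A n = (starRingEnd ℂ) (symbolAt A n) := smul_right_injective ℂ hV h
  exact (Complex.conj_eq_iff_re.1 h1.symm).symm

lemma eigenval_nonneg (hA : IsEllipticSymmPos m A) (n : Fin N → ℤ) : 0 ≤ eigenval A n := by
  have h := hA.positive _ (isPeriodic_expMode n) (contDiff_expMode m n)
  simp only [diffOp_expMode hA.homogeneous, conj_expMode, mul_assoc, expMode_mul_neg, mul_one,
    integral_const, MeasurableSet.univ, measureReal_restrict_apply, univ_inter,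
    Complex.smul_re, smul_eq_mul] at h
  exact nonneg_of_mul_nonneg_right h (volume_real_cube_pos N)

/-- Symmetry tested against w = e^{inx} takes the place of integration by parts. -/
lemma fourierCoef_diffOp (hA : IsEllipticSymmPos m A) {v : (Fin N → ℝ) → ℂ} (hv : IsPeriodic v)
    (hvm : ContDiff ℝ m v) (n : Fin N → ℤ) :
    fourierCoef (diffOp A v) n = eigenval A n * fourierCoef v n := by
  have h := hA.symmetric _ _ hv (isPeriodic_expMode n) hvm (contDiff_expMode m n)
  simp only [diffOp_expMode hA.homogeneous, map_mul, conj_expMode, symbolAt_eq_eigenval hA,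
    Complex.conj_ofReal] at h
  simp only [mul_left_comm (v _)] at h
  rw [fourierCoef, h, fourierCoef, integral_const_mul, mul_left_comm]

lemma eval_smul_of_isHomogeneous (hA : A.IsHomogeneous m) (r : ℝ) (ξ : Fin N → ℝ) :
    MvPolynomial.eval (fun j => (((r • ξ) j : ℝ) : ℂ)) A =
      (r : ℂ) ^ m * MvPolynomial.eval (fun j => (ξ j : ℂ)) A := by
  rw [MvPolynomial.eval_eq', MvPolynomial.eval_eq', Finset.mul_sum]
  refine Finset.sum_congr rfl fun α hα => ?_
  have h1 : ∑ j, α j = m := by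
    rw [← hA (MvPolynomial.mem_support_iff.1 hα), Finsupp.weight_apply,
      Finsupp.sum_fintype _ _ (by simp)]
    simp
  simp only [Pi.smul_apply, smul_eq_mul, Complex.ofReal_mul, mul_pow, Finset.prod_mul_distrib,
    Finset.prod_pow_eq_pow_sum, h1]
  ring

lemma symbolAt_eq_norm_pow_mul (hA : A.IsHomogeneous m) {n : Fin N → ℤ} (hn : n ≠ 0) :
    symbolAt A n = ((‖n‖ : ℝ) : ℂ) ^ m *
      MvPolynomial.eval (fun j => (((‖n‖⁻¹ • fun i => (n i : ℝ)) j : ℝ) : ℂ)) A := by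
  rw [← eval_smul_of_isHomogeneous hA, smul_smul, mul_inv_cancel₀ (norm_ne_zero_iff.2 hn), one_smul,
    symbolAt]
  simp

lemma norm_intCast_vec (n : Fin N → ℤ) : ‖fun i => (n i : ℝ)‖ = ‖n‖ := by
  simp only [Pi.norm_def]
  congr 2

lemma one_le_norm_of_ne_zero {n : Fin N → ℤ} (hn : n ≠ 0) : 1 ≤ ‖n‖ := by
  obtain ⟨j, hj⟩ := Function.ne_iff.1 hn
  refine le_trans ?_ (norm_le_pi_norm n j)
  rw [Int.norm_eq_abs]
  exact_mod_cast Int.one_le_abs hj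

lemma continuous_eval_ofReal (A : MvPolynomial (Fin N) ℂ) :
    Continuous fun ξ : Fin N → ℝ => MvPolynomial.eval (fun j => (ξ j : ℂ)) A :=
  (MvPolynomial.continuous_eval A).comp (by fun_prop)

/-- Two-sided bound for the symbol of an elliptic operator at lattice points. -/
lemma exists_eigenval_bounds (hA : IsEllipticSymmPos m A) : ∃ C : ℝ, 0 < C ∧
    ∀ n : Fin N → ℤ, (1 + ‖n‖) ^ m ≤ C * (1 + eigenval A n) ∧
      1 + eigenval A n ≤ C * (1 + ‖n‖) ^ m := by
  have hcpt : IsCompact (Metric.sphere (0 : Fin N → ℝ) 1) := isCompact_sphere 0 1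
  have hc := (continuous_eval_ofReal A).norm.continuousOn (s := Metric.sphere (0 : Fin N → ℝ) 1)
  have hlow : ∃ c : ℝ, 0 < c ∧ ∀ ξ ∈ Metric.sphere (0 : Fin N → ℝ) 1,
      c ≤ ‖MvPolynomial.eval (fun j => (ξ j : ℂ)) A‖ := by
    -- The sphere is empty when N = 0; any positive constant then serves.
    rcases (Metric.sphere (0 : Fin N → ℝ) 1).eq_empty_or_nonempty with he | hne
    · exact ⟨1, one_pos, by simp [he]⟩
    obtain ⟨ξ, hξ, hmin⟩ := hcpt.exists_isMinOn hne hc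
    refine ⟨_, norm_pos_iff.2 (hA.elliptic ξ fun h => ?_), fun η hη => hmin hη⟩
    simp [h] at hξ
  obtain ⟨c, hc0, hc1⟩ := hlow
  obtain ⟨C, hC⟩ := hcpt.exists_bound_of_continuousOn hc
  have hval : ∀ n, eigenval A n = ‖symbolAt A n‖ := fun n => by
    rw [symbolAt_eq_eigenval hA, Complex.norm_real, Real.norm_of_nonneg (eigenval_nonneg hA n)]
  have hmem : ∀ n : Fin N → ℤ, n ≠ 0 →
      (‖n‖⁻¹ • fun i => (n i : ℝ)) ∈ Metric.sphere (0 : Fin N → ℝ) 1 := fun n hn => by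
    rw [mem_sphere_zero_iff_norm, norm_smul, norm_intCast_vec, norm_inv, norm_norm,
      inv_mul_cancel₀ (norm_ne_zero_iff.2 hn)]
  -- One constant for all cases: 1 + A(0) settles n = 0, 2^m/c the lower bound through 1 + ‖n‖ ≤
  -- 2‖n‖, and 1 + |C| the upper bound.
  refine ⟨1 + eigenval A 0 + 2 ^ m / c + (1 + |C|), ?_, fun n => ?_⟩
  · have := eigenval_nonneg hA 0
    positivity
  have h0 := eigenval_nonneg hA 0
  rcases eq_or_ne n 0 with rfl | hn
  · have h1 : 0 ≤ 2 ^ m / c := by positivity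
    have h2 := abs_nonneg C
    simp only [norm_zero, add_zero, one_pow, mul_one]
    constructor
    · nlinarith
    · linarith
  have hn1 := one_le_norm_of_ne_zero hn
  have hS := symbolAt_eq_norm_pow_mul hA.homogeneous hn
  have hE : eigenval A n = ‖n‖ ^ m *
      ‖MvPolynomial.eval (fun j => (((‖n‖⁻¹ • fun i => (n i : ℝ)) j : ℝ) : ℂ)) A‖ := by
    rw [hval, hS, norm_mul, norm_pow, Complex.norm_real, norm_norm]
  have hl := hc1 _ (hmem n hn)
  have hu := hC _ (hmem n hn)
  rw [norm_norm] at hu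
  set q := ‖MvPolynomial.eval (fun j => (((‖n‖⁻¹ • fun i => (n i : ℝ)) j : ℝ) : ℂ)) A‖
  have hpow : 0 ≤ ‖n‖ ^ m := by positivity
  constructor
  · have h1 : (1 + ‖n‖) ^ m ≤ 2 ^ m * ‖n‖ ^ m := by
      rw [← mul_pow]; gcongr; linarith
    have h2 : 2 ^ m * ‖n‖ ^ m ≤ 2 ^ m / c * eigenval A n := by
      rw [hE, div_mul_eq_mul_div, le_div_iff₀ hc0]
      have := mul_le_mul_of_nonneg_left hl hpow
      nlinarith [pow_pos (zero_lt_two (α := ℝ)) m]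
    have h3 := eigenval_nonneg hA n
    have h4 : 0 ≤ 2 ^ m / c := by positivity
    have h5 := abs_nonneg C
    nlinarith [mul_nonneg h0 h3, mul_nonneg h5 h3]
  · have h1 : ‖n‖ ^ m ≤ (1 + ‖n‖) ^ m := by gcongr; linarith
    have h2 : 1 ≤ (1 + ‖n‖) ^ m := one_le_pow₀ (by linarith)
    have h3 : eigenval A n ≤ |C| * (1 + ‖n‖) ^ m := by
      rw [hE, mul_comm]
      exact mul_le_mul (hu.trans (le_abs_self C)) h1 hpow (abs_nonneg C)
    have h4 : 0 ≤ 2 ^ m / c := by positivity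
    have h5 : 0 ≤ (1 + ‖n‖) ^ m := by positivity
    nlinarith [mul_nonneg h0 h5, mul_nonneg h4 h5]

end Symbol

/-! ### Lattice sums and weighted summability of Sobolev coefficients. -/

lemma summable_norm_int_rpow {r : ℝ} (hr : r < -N) : Summable fun n : Fin N → ℤ => ‖n‖ ^ r := by
  let L : Submodule ℤ (Fin N → ℝ) := Submodule.span ℤ (Set.range (Pi.basisFun ℝ (Fin N)))
  have hrank : Module.finrank ℤ L = N := by
    rw [ZLattice.rank ℝ L]; simp
  have hL := ZLattice.summable_norm_rpow L r (by rw [hrank]; exact hr)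
  have hmem : ∀ n : Fin N → ℤ, (fun i => (n i : ℝ)) ∈ L := fun n => by
    rw [Module.Basis.mem_span_iff_repr_mem]
    intro i
    exact ⟨n i, by simp⟩
  let ι : (Fin N → ℤ) → L := fun n => ⟨fun i => (n i : ℝ), hmem n⟩
  have hι : Function.Injective ι := fun a b hab => by
    ext i
    have : (a i : ℝ) = b i := congrFun (congrArg Subtype.val hab) i
    exact_mod_cast this
  refine (hL.comp_injective hι).congr fun n => ?_
  rw [Function.comp, ← norm_intCast_vec n]
  rfl

lemma one_add_norm_sq_le (n : Fin N → ℤ) : 1 + ‖n‖ ^ 2 ≤ 1 + ∑ j, (n j : ℝ) ^ 2 := by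
  gcongr
  have h0 : 0 ≤ ∑ j, (n j : ℝ) ^ 2 := Finset.sum_nonneg fun j _ => sq_nonneg _
  rw [← Real.sq_sqrt h0]
  gcongr
  refine (pi_norm_le_iff_of_nonneg (Real.sqrt_nonneg _)).2 fun j => ?_
  rw [Int.norm_eq_abs, ← Real.sqrt_sq_eq_abs]
  exact Real.sqrt_le_sqrt (Finset.single_le_sum (f := fun j => (n j : ℝ) ^ 2)
    (fun i _ => sq_nonneg _) (Finset.mem_univ j))

lemma summable_one_add_sq_rpow {τ : ℝ} (hτ : (N : ℝ) / 2 < τ) :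
    Summable fun n : Fin N → ℤ => (1 + ∑ j, (n j : ℝ) ^ 2) ^ (-τ) := by
  have h := summable_norm_int_rpow (N := N) (r := -2 * τ) (by linarith)
  have hτ0 : 0 < τ := lt_of_le_of_lt (by positivity) hτ
  refine Summable.of_norm_bounded_eventually h ?_
  -- The point n = 0 is excluded because there the left side is 1, while ‖0‖ to a negative power is
  -- 0 by convention.
  refine (Set.finite_singleton (0 : Fin N → ℤ)).subset fun n hn => ?_
  by_contra hn0
  refine hn (?_ : ‖(1 + ∑ j, (n j : ℝ) ^ 2) ^ (-τ)‖ ≤ ‖n‖ ^ (-2 * τ))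
  have hpos : 0 < ‖n‖ := norm_pos_iff.2 hn0
  rw [Real.norm_of_nonneg (by positivity), neg_mul, ← mul_neg, Real.rpow_mul hpos.le]
  refine Real.rpow_le_rpow_of_nonpos (by positivity) ?_ (by linarith)
  have := one_add_norm_sq_le n
  rw [Real.rpow_two]
  linarith

/-- With q = 1 + |n|², the factorisation q^{k/2}|g_n| = q^{-τ/2} · q^{(τ+k)/2}|g_n| and ab ≤ a² + b²
leave two convergent series, one by τ > N/2 and one by hypothesis. It is needed for k = 0 (φ) and k
= m (Ψ). -/
lemma MemSobolev.weightSummable {τ : ℝ} (hτ : (N : ℝ) / 2 < τ) {k : ℕ} {g : (Fin N → ℝ) → ℂ}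
    (hg : MemSobolev (τ + k) g) : WeightSummable k (fourierCoef g) := by
  refine Summable.of_nonneg_of_le (fun n => by positivity) (fun n => ?_)
    (((summable_one_add_sq_rpow hτ).add hg.summable).mul_left (2 ^ k))
  set q : ℝ := 1 + ∑ j, (n j : ℝ) ^ 2 with hq
  have hq0 : 0 < q := by positivity
  have h1 : 1 + ‖n‖ ≤ 2 * q ^ (1 / 2 : ℝ) := by
    rw [← Real.sqrt_eq_rpow]
    have h2 : (1 + ‖n‖) ^ 2 ≤ (2 * Real.sqrt q) ^ 2 := by
      rw [mul_pow, Real.sq_sqrt hq0.le]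
      nlinarith [one_add_norm_sq_le n, sq_nonneg (1 - ‖n‖)]
    exact abs_le_of_sq_le_sq' h2 (by positivity) |>.2
  have h2 : (1 + ‖n‖) ^ k ≤ 2 ^ k * q ^ ((k : ℝ) / 2) := by
    calc (1 + ‖n‖) ^ k ≤ (2 * q ^ (1 / 2 : ℝ)) ^ k := by gcongr
      _ = _ := by
        rw [mul_pow, ← Real.rpow_natCast (q ^ (1 / 2 : ℝ)), ← Real.rpow_mul hq0.le]
        ring_nf
  set a := q ^ (-τ / 2) with ha
  set b := q ^ ((τ + k) / 2) * ‖fourierCoef g n‖ with hb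
  have hab : a * b = q ^ ((k : ℝ) / 2) * ‖fourierCoef g n‖ := by
    rw [ha, hb, ← mul_assoc, ← Real.rpow_add hq0]
    ring_nf
  have ha2 : a ^ 2 = q ^ (-τ) := by
    rw [ha, ← Real.rpow_natCast, ← Real.rpow_mul hq0.le]; norm_num
  have hb2 : b ^ 2 = q ^ (τ + k) * ‖fourierCoef g n‖ ^ 2 := by
    rw [hb, mul_pow, ← Real.rpow_natCast, ← Real.rpow_mul hq0.le]; norm_num
  calc (1 + ‖n‖) ^ k * ‖fourierCoef g n‖
      ≤ 2 ^ k * q ^ ((k : ℝ) / 2) * ‖fourierCoef g n‖ := by gcongr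
    _ = 2 ^ k * (a * b) := by rw [hab, mul_assoc]
    _ ≤ 2 ^ k * (a ^ 2 + b ^ 2) := by
        gcongr
        nlinarith [sq_nonneg (a - b), sq_nonneg a, sq_nonneg b]
    _ = _ := by rw [ha2, hb2]

/-! ### The series solution -/

lemma integrable_tsum_of_summable_integral_norm {α ι E : Type*} [MeasurableSpace α]
    {μ : Measure α} [NormedAddCommGroup E] [NormedSpace ℝ E] [Countable ι] {F : ι → α → E}
    (hF : ∀ i, Integrable (F i) μ) (hs : Summable fun i => ∫ a, ‖F i a‖ ∂μ)
    (hm : AEStronglyMeasurable (fun a => ∑' i, F i a) μ) :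
    Integrable (fun a => ∑' i, F i a) μ := by
  refine ⟨hm, ?_⟩
  calc ∫⁻ a, ‖∑' i, F i a‖ₑ ∂μ ≤ ∫⁻ a, ∑' i, ‖F i a‖ₑ ∂μ :=
        lintegral_mono fun a => enorm_tsum_le_tsum_enorm
    _ = ∑' i, ∫⁻ a, ‖F i a‖ₑ ∂μ := lintegral_tsum fun i => (hF i).1.enorm
    _ = ∑' i, ENNReal.ofReal (∫ a, ‖F i a‖ ∂μ) := by
        congr 1; ext i; rw [ofReal_integral_norm_eq_lintegral_enorm (hF i)]
    _ < ⊤ := by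
        rw [← ENNReal.ofReal_tsum_of_nonneg (fun i => integral_nonneg fun a => norm_nonneg _) hs]
        exact ENNReal.ofReal_lt_top

lemma continuousOn_trigSeries_of_bound {c : ℝ → (Fin N → ℤ) → ℂ} {s : Set ℝ}
    {g : (Fin N → ℤ) → ℝ} (hc : ∀ n, ContinuousOn (fun t => c t n) s) (hg : Summable g)
    (hcg : ∀ n, ∀ t ∈ s, ‖c t n‖ ≤ g n) :
    ContinuousOn (fun p : (Fin N → ℝ) × ℝ => trigSeries (c p.2) p.1) (univ ×ˢ s) := by
  refine continuousOn_tsum (fun n => ?_) hg fun n p hp => ?_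
  · exact ((hc n).comp continuousOn_snd fun p hp => hp.2).mul
      ((continuous_expMode n).comp continuous_fst).continuousOn
  · rw [norm_mul, norm_expMode, mul_one]
    exact hcg n _ hp.2

/-- The majorants deteriorate as t → 0, but continuity at t only needs the one for ε = t/2. -/
lemma continuousOn_trigSeries_Ioi {c : ℝ → (Fin N → ℤ) → ℂ}
    {g : ℝ → (Fin N → ℤ) → ℝ} (hc : ∀ n, ContinuousOn (fun t => c t n) (Ioi 0))
    (hg : ∀ ε > 0, Summable (g ε)) (hcg : ∀ ε > 0, ∀ n, ∀ t ∈ Ioi ε, ‖c t n‖ ≤ g ε n) :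
    ContinuousOn (fun p : (Fin N → ℝ) × ℝ => trigSeries (c p.2) p.1) (univ ×ˢ Ioi 0) := by
  rintro ⟨x, t⟩ ⟨-, ht⟩
  have ht0 : 0 < t := ht
  have h := continuousOn_trigSeries_of_bound
    (fun n => (hc n).mono (Ioi_subset_Ioi (half_pos ht0).le)) (hg (t / 2) (half_pos ht0))
    (hcg (t / 2) (half_pos ht0))
  refine (h.continuousAt ?_).continuousWithinAt
  exact (isOpen_univ.prod isOpen_Ioi).mem_nhds ⟨mem_univ _, half_lt_self ht0⟩

/-- The Fourier coefficients at time `t` of the solution with initial coefficients `a` and source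
coefficients `b`. -/
def solCoef (A : MvPolynomial (Fin N) ℂ) (ρ : ℝ) (a b : (Fin N → ℤ) → ℂ) (t : ℝ)
    (n : Fin N → ℤ) : ℂ :=
  a n * mlFun ρ (eigenval A n) 1 t + b n * mlFun ρ (eigenval A n) (ρ + 1) t

/-- The Fourier coefficients of the Caputo derivative of the solution. -/
def caputoCoef (A : MvPolynomial (Fin N) ℂ) (ρ : ℝ) (a b : (Fin N → ℤ) → ℂ) (t : ℝ)
    (n : Fin N → ℤ) : ℂ :=
  (b n - eigenval A n * a n) * mlFun ρ (eigenval A n) 1 t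

/-- The Fourier coefficients of the time derivative of the solution. -/
def derivCoef (A : MvPolynomial (Fin N) ℂ) (ρ : ℝ) (a b : (Fin N → ℤ) → ℂ) (t : ℝ)
    (n : Fin N → ℤ) : ℂ :=
  (b n - eigenval A n * a n) * mlFun ρ (eigenval A n) ρ t

/-! ### Bounds, regularity and Caputo derivative of the series. -/

section Series

variable {m : ℕ} {A : MvPolynomial (Fin N) ℂ} {ρ : ℝ} {a b : (Fin N → ℤ) → ℂ}

/-- The equation on a single mode, an algebraic consequence of y = 1 - lam e. It also trades the
unbounded factor lam for summable quantities. -/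
lemma eigenval_mul_solCoef (hρ : 0 < ρ) (t : ℝ) (n : Fin N → ℤ) :
    eigenval A n * solCoef A ρ a b t n = b n - caputoCoef A ρ a b t n := by
  have h : ((mlFun ρ (eigenval A n) 1 t : ℝ) : ℂ) =
      1 - eigenval A n * mlFun ρ (eigenval A n) (ρ + 1) t := by
    rw [mlFun_one_eq hρ]; push_cast; rfl
  rw [solCoef, caputoCoef, h]
  ring

lemma norm_ofReal_nonneg {r : ℝ} (hr : 0 ≤ r) : ‖(r : ℂ)‖ = r := by
  rw [Complex.norm_real, Real.norm_of_nonneg hr]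

lemma norm_solCoef_le (hA : IsEllipticSymmPos m A) (hρ : 0 < ρ) (hρ1 : ρ ≤ 1) {t T : ℝ}
    (ht : t ∈ Icc 0 T) (n : Fin N → ℤ) :
    ‖solCoef A ρ a b t n‖ ≤ ‖a n‖ + ‖b n‖ * (T ^ ρ / Real.Gamma (ρ + 1)) := by
  have hl := eigenval_nonneg hA n
  have hG := Real.Gamma_pos_of_pos (add_pos hρ one_pos)
  refine (norm_add_le _ _).trans (add_le_add ?_ ?_)
  · rw [norm_mul, norm_ofReal_nonneg (mlFun_one_nonneg hρ hρ1 hl ht.1)]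
    exact mul_le_of_le_one_right (norm_nonneg _) (mlFun_one_le_one hρ hρ1 hl ht.1)
  · rw [norm_mul, norm_ofReal_nonneg (mlFun_add_one_nonneg hρ hρ1 hl ht.1)]
    gcongr
    refine (mlFun_add_one_le hρ hρ1 hl ht.1).trans ?_
    have h1 := ht.1
    have h2 := ht.2
    gcongr

lemma summable_solCoef_bound (ha : Summable fun n => ‖a n‖) (hb : Summable fun n => ‖b n‖)
    (C : ℝ) : Summable fun n => ‖a n‖ + ‖b n‖ * C := ha.add (hb.mul_right C)

lemma summable_solCoef (hA : IsEllipticSymmPos m A) (hρ : 0 < ρ) (hρ1 : ρ ≤ 1)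
    (ha : Summable fun n => ‖a n‖) (hb : Summable fun n => ‖b n‖) {t : ℝ} (ht : 0 ≤ t) :
    Summable fun n => ‖solCoef A ρ a b t n‖ :=
  Summable.of_nonneg_of_le (fun _ => norm_nonneg _)
    (fun n => norm_solCoef_le hA hρ hρ1 (right_mem_Icc.2 ht) n) (summable_solCoef_bound ha hb _)

lemma continuousOn_solution (hA : IsEllipticSymmPos m A) (hρ : 0 < ρ) (hρ1 : ρ ≤ 1)
    (ha : Summable fun n => ‖a n‖) (hb : Summable fun n => ‖b n‖) (T : ℝ) :
    ContinuousOn (fun p : (Fin N → ℝ) × ℝ => trigSeries (solCoef A ρ a b p.2) p.1)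
      (univ ×ˢ Icc 0 T) := by
  refine continuousOn_trigSeries_of_bound (fun n => ?_)
    (summable_solCoef_bound ha hb (T ^ ρ / Real.Gamma (ρ + 1)))
    fun n t ht => norm_solCoef_le hA hρ hρ1 ht n
  have h1 := continuous_mlFun hρ (eigenval A n) (le_refl (1 : ℝ))
  have h2 := continuous_mlFun hρ (eigenval A n) (show 1 ≤ ρ + 1 by linarith)
  unfold solCoef
  exact Continuous.continuousOn (by fun_prop)

/-- Summability of a says nothing about lam · a; the factor lam is absorbed by lam y ≤ Γ(ρ+1)/t^ρ,
hence the restriction to t ≥ ε. -/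
lemma norm_caputoCoef_le (hA : IsEllipticSymmPos m A) (hρ : 0 < ρ) (hρ1 : ρ ≤ 1) {ε t : ℝ}
    (hε : 0 < ε) (ht : ε ≤ t) (n : Fin N → ℤ) :
    ‖caputoCoef A ρ a b t n‖ ≤ ‖b n‖ + ‖a n‖ * (Real.Gamma (ρ + 1) / ε ^ ρ) := by
  have hl := eigenval_nonneg hA n
  have ht0 : 0 < t := hε.trans_le ht
  have hG := Real.Gamma_pos_of_pos (add_pos hρ one_pos)
  have hy := mlFun_one_nonneg hρ hρ1 hl ht0.le
  have hy1 := mlFun_one_le_one hρ hρ1 hl ht0.le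
  have h1 : eigenval A n * mlFun ρ (eigenval A n) 1 t ≤ Real.Gamma (ρ + 1) / ε ^ ρ :=
    (lam_mul_mlFun_one_le hρ hρ1 hl ht0).trans (by gcongr)
  rw [caputoCoef, norm_mul, norm_ofReal_nonneg hy]
  calc _ ≤ (‖b n‖ + ‖(eigenval A n : ℂ) * a n‖) * mlFun ρ (eigenval A n) 1 t := by
        gcongr; exact norm_sub_le _ _
    _ = ‖b n‖ * mlFun ρ (eigenval A n) 1 t +
        ‖a n‖ * (eigenval A n * mlFun ρ (eigenval A n) 1 t) := by
        rw [norm_mul, norm_ofReal_nonneg hl]; ring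
    _ ≤ _ := by
        gcongr
        exact mul_le_of_le_one_right (norm_nonneg _) hy1

lemma summable_caputoCoef (hA : IsEllipticSymmPos m A) (hρ : 0 < ρ) (hρ1 : ρ ≤ 1)
    (ha : Summable fun n => ‖a n‖) (hb : Summable fun n => ‖b n‖) {t : ℝ} (ht : 0 < t) :
    Summable fun n => ‖caputoCoef A ρ a b t n‖ :=
  Summable.of_nonneg_of_le (fun _ => norm_nonneg _)
    (fun n => norm_caputoCoef_le hA hρ hρ1 ht le_rfl n) (summable_solCoef_bound hb ha _)

lemma continuousOn_caputoSeries (hA : IsEllipticSymmPos m A) (hρ : 0 < ρ) (hρ1 : ρ ≤ 1)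
    (ha : Summable fun n => ‖a n‖) (hb : Summable fun n => ‖b n‖) :
    ContinuousOn (fun p : (Fin N → ℝ) × ℝ => trigSeries (caputoCoef A ρ a b p.2) p.1)
      (univ ×ˢ Ioi 0) := by
  refine continuousOn_trigSeries_Ioi (fun n => ?_)
    (fun ε _ => summable_solCoef_bound hb ha (Real.Gamma (ρ + 1) / ε ^ ρ))
    fun ε hε n t ht => norm_caputoCoef_le hA hρ hρ1 hε (le_of_lt ht) n
  have h1 := continuous_mlFun hρ (eigenval A n) (le_refl (1 : ℝ))
  unfold caputoCoef
  exact Continuous.continuousOn (by fun_prop)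

/-- Smoothing for t > 0: ellipticity replaces the weight by 1 + lam, and `eigenval_mul_solCoef`
expresses lam times the coefficient by summable sequences. -/
lemma weightSummable_solCoef (hA : IsEllipticSymmPos m A) (hρ : 0 < ρ) (hρ1 : ρ ≤ 1)
    (ha : Summable fun n => ‖a n‖) (hb : Summable fun n => ‖b n‖) {t : ℝ} (ht : 0 < t) :
    WeightSummable m (solCoef A ρ a b t) := by
  obtain ⟨C, hC, hbd⟩ := exists_eigenval_bounds hA
  have hs : Summable fun n => C * (‖solCoef A ρ a b t n‖ +
      (‖b n‖ + ‖caputoCoef A ρ a b t n‖)) :=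
    ((summable_solCoef hA hρ hρ1 ha hb ht.le).add
      (hb.add (summable_caputoCoef hA hρ hρ1 ha hb ht))).mul_left C
  refine Summable.of_nonneg_of_le (fun n => by positivity) (fun n => ?_) hs
  calc (1 + ‖n‖) ^ m * ‖solCoef A ρ a b t n‖
      ≤ C * (1 + eigenval A n) * ‖solCoef A ρ a b t n‖ := by
        gcongr; exact (hbd n).1
    _ = C * (‖solCoef A ρ a b t n‖ + ‖(eigenval A n : ℂ) * solCoef A ρ a b t n‖) := by
        rw [norm_mul, norm_ofReal_nonneg (eigenval_nonneg hA n)]; ring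
    _ ≤ _ := by
        rw [eigenval_mul_solCoef hρ]
        gcongr
        exact norm_sub_le _ _

lemma diffOp_solution (hA : IsEllipticSymmPos m A) (hρ : 0 < ρ) (hρ1 : ρ ≤ 1)
    (ha : Summable fun n => ‖a n‖) (hb : Summable fun n => ‖b n‖) {t : ℝ} (ht : 0 < t)
    (x : Fin N → ℝ) :
    diffOp A (trigSeries (solCoef A ρ a b t)) x =
      trigSeries b x - trigSeries (caputoCoef A ρ a b t) x := by
  rw [diffOp_trigSeries hA.homogeneous (weightSummable_solCoef hA hρ hρ1 ha hb ht)]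
  simp only [symbolAt_eq_eigenval hA, eigenval_mul_solCoef hρ, trigSeries, sub_mul]
  exact (summable_trigSeries hb x).tsum_sub
    (summable_trigSeries (summable_caputoCoef hA hρ hρ1 ha hb ht) x)

lemma norm_derivCoef_le (hA : IsEllipticSymmPos m A) (hρ : 0 < ρ) (hρ1 : ρ ≤ 1) {ε t : ℝ}
    (hε : 0 < ε) (ht : ε ≤ t) (n : Fin N → ℤ) :
    ‖derivCoef A ρ a b t n‖ ≤ ‖b n‖ * fracKernel ρ ε + ‖a n‖ * (ρ / ε) := by
  have hl := eigenval_nonneg hA n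
  have ht0 : 0 < t := hε.trans_le ht
  have hz := mlFun_self_pos hρ hρ1 hl ht0
  have hG := Real.Gamma_pos_of_pos hρ
  have h1 : eigenval A n * mlFun ρ (eigenval A n) ρ t ≤ ρ / ε :=
    (lam_mul_mlFun_self_le hρ hρ1 hl ht0).trans (by gcongr)
  have h2 : mlFun ρ (eigenval A n) ρ t ≤ fracKernel ρ ε := by
    refine (mlFun_self_le hρ hρ1 hl ht0).trans ?_
    rw [fracKernel, fracKernel]
    have := Real.rpow_le_rpow_of_nonpos hε ht (show ρ - 1 ≤ 0 by linarith)
    gcongr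
  rw [derivCoef, norm_mul, norm_ofReal_nonneg hz.le]
  calc _ ≤ (‖b n‖ + ‖(eigenval A n : ℂ) * a n‖) * mlFun ρ (eigenval A n) ρ t := by
        gcongr; exact norm_sub_le _ _
    _ = ‖b n‖ * mlFun ρ (eigenval A n) ρ t +
        ‖a n‖ * (eigenval A n * mlFun ρ (eigenval A n) ρ t) := by
        rw [norm_mul, norm_ofReal_nonneg hl]; ring
    _ ≤ _ := by gcongr

lemma hasDerivAt_solCoef (hρ : 0 < ρ) {t : ℝ} (ht : 0 < t) (n : Fin N → ℤ) :
    HasDerivAt (fun t => solCoef A ρ a b t n) (derivCoef A ρ a b t n) t := by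
  have h1 := ((hasDerivAt_mlFun_one hρ (eigenval A n) ht).ofReal_comp.const_mul (a n)).add
    ((hasDerivAt_mlFun_add_one hρ (eigenval A n) ht).ofReal_comp.const_mul (b n))
  refine h1.congr_deriv ?_
  rw [derivCoef]
  push_cast
  ring

lemma hasDerivAt_solution (hA : IsEllipticSymmPos m A) (hρ : 0 < ρ) (hρ1 : ρ ≤ 1)
    (ha : Summable fun n => ‖a n‖) (hb : Summable fun n => ‖b n‖) {t : ℝ} (ht : 0 < t)
    (x : Fin N → ℝ) :
    HasDerivAt (fun t => trigSeries (solCoef A ρ a b t) x)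
      (trigSeries (derivCoef A ρ a b t) x) t := by
  have hε := half_pos ht
  refine hasDerivAt_tsum_of_isPreconnected (t := Ioi (t / 2)) (y₀ := t)
    (g := fun n t => solCoef A ρ a b t n * expMode n x)
    (g' := fun n t => derivCoef A ρ a b t n * expMode n x)
    ((hb.mul_right (fracKernel ρ (t / 2))).add (ha.mul_right (ρ / (t / 2)))) isOpen_Ioi
    isPreconnected_Ioi (fun n s hs => ?_) (fun n s hs => ?_) (half_lt_self ht)
    (summable_trigSeries (summable_solCoef hA hρ hρ1 ha hb ht.le) x) (half_lt_self ht)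
  · exact (hasDerivAt_solCoef hρ (hε.trans hs) n).mul_const _
  · rw [norm_mul, norm_expMode, mul_one]
    exact norm_derivCoef_le hA hρ hρ1 hε (le_of_lt hs) n

lemma rpow_neg_eq_fracKernel (hρ1 : ρ < 1) (r : ℝ) :
    r ^ (-ρ) = Real.Gamma (1 - ρ) * fracKernel (1 - ρ) r := by
  have := (Real.Gamma_pos_of_pos (sub_pos.2 hρ1)).ne'
  rw [fracKernel, sub_sub_cancel_left]
  field_simp

lemma fracInt_mlFun_self (hρ : 0 < ρ) (hρ1 : ρ < 1) (lam : ℝ) {t : ℝ} (ht : 0 < t) :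
    ∫ s in Ioo 0 t, (t - s) ^ (-ρ) * mlFun ρ lam ρ s = Real.Gamma (1 - ρ) * mlFun ρ lam 1 t := by
  have h := fracInt_mlFun hρ lam (sub_pos.2 hρ1) hρ ht
  rw [add_sub_cancel, fracInt] at h
  rw [← h, ← integral_const_mul]
  simp only [rpow_neg_eq_fracKernel hρ1, smul_eq_mul, mul_assoc]

lemma integrableOn_rpow_mul_mlFun_self (hρ : 0 < ρ) (hρ1 : ρ < 1) (lam t : ℝ) :
    IntegrableOn (fun s => (t - s) ^ (-ρ) * mlFun ρ lam ρ s) (Ioo 0 t) := by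
  simp only [rpow_neg_eq_fracKernel hρ1, mul_assoc]
  exact (integrableOn_fracKernel_mul_mlFun hρ lam (sub_pos.2 hρ1) hρ t).const_mul _

theorem caputo_solution (hA : IsEllipticSymmPos m A) (hρ : 0 < ρ) (hρ1 : ρ ≤ 1)
    (ha : Summable fun n => ‖a n‖) (hb : Summable fun n => ‖b n‖) {t T : ℝ} (ht : t ∈ Ioc 0 T)
    (x : Fin N → ℝ) :
    HasCaputo ρ T (fun t => trigSeries (solCoef A ρ a b t) x) t ∧
    caputo ρ T (fun t => trigSeries (solCoef A ρ a b t) x) t =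
      trigSeries (caputoCoef A ρ a b t) x := by
  rcases hρ1.eq_or_lt with rfl | hρ1'
  · have h := (hasDerivAt_solution hA hρ hρ1 ha hb ht.1 x).hasDerivWithinAt (s := Icc 0 T)
    rw [HasCaputo, caputo, if_pos rfl, if_pos rfl]
    refine ⟨h.differentiableWithinAt, ?_⟩
    rw [h.derivWithin (uniqueDiffOn_Icc (ht.1.trans_le ht.2) t (Ioc_subset_Icc_self ht))]
    rfl
  set v : ℝ → ℂ := fun t => trigSeries (solCoef A ρ a b t) x with hv
  have hG := Real.Gamma_pos_of_pos (sub_pos.2 hρ1')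
  have hderiv : ∀ s, 0 < s → HasDerivAt v (trigSeries (derivCoef A ρ a b s) x) s := fun s hs =>
    hasDerivAt_solution hA hρ hρ1 ha hb hs x
  set F : (Fin N → ℤ) → ℝ → ℂ := fun n s =>
    (((t - s) ^ (-ρ) : ℝ) : ℂ) * (derivCoef A ρ a b s n * expMode n x) with hF
  have hFeq : ∀ n s, F n s = ((b n - eigenval A n * a n) * expMode n x) *
      (((t - s) ^ (-ρ) * mlFun ρ (eigenval A n) ρ s : ℝ) : ℂ) := fun n s => by
    simp only [hF, derivCoef]; push_cast; ring
  have hFint : ∀ n, IntegrableOn (F n) (Ioo 0 t) := fun n => by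
    rw [funext (hFeq n)]
    exact (integrableOn_rpow_mul_mlFun_self hρ hρ1' _ t).ofReal.const_mul _
  have hFI : ∀ n, ∫ s in Ioo 0 t, F n s =
      Real.Gamma (1 - ρ) * (caputoCoef A ρ a b t n * expMode n x) := fun n => by
    simp only [hFeq]
    rw [integral_const_mul, integral_complex_ofReal, fracInt_mlFun_self hρ hρ1' _ ht.1, caputoCoef]
    push_cast; ring
  -- The bound of order 1/s for the time derivative is not integrable at 0. Positivity of the
  -- resolvent kernel gives instead the exact L¹ norm of each term, which is summable at the fixed t
  -- > 0.
  have hFn : ∀ n, ∫ s in Ioo 0 t, ‖F n s‖ =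
      Real.Gamma (1 - ρ) * ‖caputoCoef A ρ a b t n‖ := fun n => by
    have hl := eigenval_nonneg hA n
    have h1 : ∫ s in Ioo 0 t, ‖F n s‖ = ∫ s in Ioo 0 t, ‖b n - eigenval A n * a n‖ *
        ((t - s) ^ (-ρ) * mlFun ρ (eigenval A n) ρ s) := by
      refine setIntegral_congr_fun measurableSet_Ioo fun s hs => ?_
      rw [hFeq, norm_mul, norm_mul, norm_expMode, mul_one, norm_ofReal_nonneg]
      exact mul_nonneg (Real.rpow_nonneg (sub_pos.2 hs.2).le _) (mlFun_self_pos hρ hρ1 hl hs.1).le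
    rw [h1, integral_const_mul, fracInt_mlFun_self hρ hρ1' _ ht.1, caputoCoef, norm_mul,
      norm_ofReal_nonneg (mlFun_one_nonneg hρ hρ1 hl ht.1.le)]
    ring
  have hsum : Summable fun n => ∫ s in Ioo 0 t, ‖F n s‖ := by
    simp only [hFn]
    exact (summable_caputoCoef hA hρ hρ1 ha hb ht.1).mul_left _
  have hEq : ∀ s ∈ Ioo 0 t, (((t - s) ^ (-ρ) : ℝ) : ℂ) * deriv v s = ∑' n, F n s := fun s hs => by
    rw [(hderiv s hs.1).deriv, trigSeries, ← tsum_mul_left]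
  rw [HasCaputo, caputo, if_neg hρ1'.ne, if_neg hρ1'.ne]
  refine ⟨⟨fun s hs => (hderiv s hs.1).differentiableAt, ?_⟩, ?_⟩
  · rw [integrableOn_congr_fun hEq measurableSet_Ioo]
    refine integrable_tsum_of_summable_integral_norm hFint hsum ?_
    have hm : AEStronglyMeasurable (fun s => (((t - s) ^ (-ρ) : ℝ) : ℂ) * deriv v s)
        (volume.restrict (Ioo 0 t)) := by
      have h1 : Measurable fun s : ℝ => (((t - s) ^ (-ρ) : ℝ) : ℂ) := by fun_prop
      exact (h1.mul (measurable_deriv v)).aestronglyMeasurable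
    refine hm.congr ?_
    filter_upwards [ae_restrict_mem measurableSet_Ioo] with s hs
    exact hEq s hs
  · rw [setIntegral_congr_fun measurableSet_Ioo hEq,
      ← integral_tsum_of_summable_integral_norm hFint hsum]
    simp only [hFI]
    rw [tsum_mul_left, ← mul_assoc, inv_mul_cancel₀ (by exact_mod_cast hG.ne'), one_mul, trigSeries]

end Series

/-! ### Uniqueness -/

/-! ### The Caputo derivative integrated in time. -/

section Caputo

variable {ρ T t : ℝ} {v : ℝ → ℂ}

lemma caputo_eq_fracInt (hρ1 : ρ < 1) (T : ℝ) (v : ℝ → ℂ) (t : ℝ) :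
    caputo ρ T v t = fracInt (1 - ρ) (deriv v) t := by
  have hG := (Real.Gamma_pos_of_pos (sub_pos.2 hρ1)).ne'
  rw [caputo, if_neg hρ1.ne, fracInt, ← integral_const_mul]
  congr 1; ext s
  rw [rpow_neg_eq_fracKernel hρ1, Complex.real_smul]
  push_cast
  rw [mul_assoc, inv_mul_cancel_left₀ (by exact_mod_cast hG)]

/-- The bounded weight (t - s)^ρ cancels the singular kernel. -/
lemma integrableOn_deriv_of_hasCaputo (hρ : 0 < ρ) (hρ1 : ρ < 1) (hc : HasCaputo ρ T v t) :
    IntegrableOn (deriv v) (Ioo 0 t) := by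
  rw [HasCaputo, if_neg hρ1.ne] at hc
  have hm : Measurable fun s : ℝ => (((t - s) ^ ρ : ℝ) : ℂ) := by fun_prop
  have h : IntegrableOn (fun s => (((t - s) ^ ρ : ℝ) : ℂ) *
      ((((t - s) ^ (-ρ) : ℝ) : ℂ) * deriv v s)) (Ioo 0 t) := by
    refine Integrable.bdd_mul (c := t ^ ρ) hc.2 hm.aestronglyMeasurable ?_
    filter_upwards [ae_restrict_mem measurableSet_Ioo] with s hs
    have h1 : 0 ≤ t - s := (sub_pos.2 hs.2).le
    rw [norm_ofReal_nonneg (Real.rpow_nonneg h1 _)]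
    have := hs.1
    gcongr
    linarith
  refine (integrableOn_congr_fun (fun s hs => ?_) measurableSet_Ioo).1 h
  rw [← mul_assoc, ← Complex.ofReal_mul, ← Real.rpow_add (sub_pos.2 hs.2), add_neg_cancel,
    Real.rpow_zero, Complex.ofReal_one, one_mul]

/-- By the semigroup property I^1 I^{1-ρ} v' = I^{1-ρ} I^1 v', and I^1 v' = v - v(0). The right side
no longer contains v'. -/
lemma integral_caputo (hρ : 0 < ρ) (hρ1 : ρ < 1) (hv : ContinuousOn v (Icc 0 T))
    (ht : t ∈ Ioc 0 T) (hc : HasCaputo ρ T v t) :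
    IntegrableOn (caputo ρ T v) (Ioo 0 t) ∧
    ∫ s in Ioo 0 t, caputo ρ T v s = fracInt (1 - ρ) (fun s => v s - v 0) t := by
  have hd := integrableOn_deriv_of_hasCaputo hρ hρ1 hc
  rw [HasCaputo, if_neg hρ1.ne] at hc
  have h1ρ : 0 < 1 - ρ := sub_pos.2 hρ1
  obtain ⟨h1, h2⟩ := fracInt_fracInt one_pos h1ρ (by linarith) hd
  obtain ⟨-, h3⟩ := fracInt_fracInt h1ρ one_pos (by linarith) hd
  simp only [fracKernel_one, one_smul] at h1
  rw [fracInt_one] at h2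
  rw [funext (caputo_eq_fracInt hρ1 T v)]
  refine ⟨h1, ?_⟩
  rw [h2, add_comm, ← h3]
  refine fracInt_congr fun s hs => ?_
  have hs' : IntervalIntegrable (deriv v) volume 0 s := by
    rw [intervalIntegrable_iff_integrableOn_Ioo_of_le hs.1.le]
    exact hd.mono_set (Ioo_subset_Ioo_right hs.2.le)
  rw [fracInt_one, ← integral_Ioc_eq_integral_Ioo, ← intervalIntegral.integral_of_le hs.1.le]
  refine intervalIntegral.integral_eq_sub_of_hasDerivAt_of_le hs.1.le
    (hv.mono (Icc_subset_Icc_right (hs.2.le.trans ht.2))) (fun r hr => ?_) hs'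
  exact (hc.1 r ⟨hr.1, hr.2.trans hs.2⟩).hasDerivAt

end Caputo

/-! ### Fractional integrals of continuous functions and homogeneous equations. -/

section Volterra

variable {ρ T : ℝ}

lemma integrableOn_fracKernel_smul {b t : ℝ} (hb : 0 < b) {f : ℝ → ℂ}
    (hf : ContinuousOn f (Icc 0 T)) (htT : t ≤ T) :
    IntegrableOn (fun s => fracKernel b (t - s) • f s) (Ioo 0 t) := by
  obtain ⟨M, hM⟩ := isCompact_Icc.exists_bound_of_continuousOn hf
  have hsub : Ioo 0 t ⊆ Icc 0 T := fun s hs => ⟨hs.1.le, hs.2.le.trans htT⟩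
  refine Integrable.smul_bdd (C := M) (integrableOn_fracKernel_sub hb)
    ((hf.mono hsub).aestronglyMeasurable measurableSet_Ioo) ?_
  filter_upwards [ae_restrict_mem measurableSet_Ioo] with s hs
  exact hM s (hsub hs)

lemma norm_fracInt_le {b t M : ℝ} (hb : 0 < b) {f : ℝ → ℂ} (ht : 0 < t)
    (hM : ∀ s ∈ Ioo 0 t, ‖f s‖ ≤ M) : ‖fracInt b f t‖ ≤ fracKernel (b + 1) t * M := by
  rw [← integral_fracKernel_sub hb ht, ← integral_mul_const]
  refine norm_integral_le_of_norm_le ((integrableOn_fracKernel_sub hb).mul_const M) ?_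
  filter_upwards [ae_restrict_mem measurableSet_Ioo] with s hs
  have hp := fracKernel_pos hb (sub_pos.2 hs.2)
  rw [norm_smul, Real.norm_of_nonneg hp.le]
  gcongr
  exact hM s hs

lemma fracInt_sub_fun {b t : ℝ} (hb : 0 < b) {f g : ℝ → ℂ}
    (hf : ContinuousOn f (Icc 0 T)) (hg : ContinuousOn g (Icc 0 T)) (htT : t ≤ T) :
    fracInt b (fun s => f s - g s) t = fracInt b f t - fracInt b g t := by
  simp only [fracInt, smul_sub]
  exact integral_sub (integrableOn_fracKernel_smul hb hf htT)
    (integrableOn_fracKernel_smul hb hg htT)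

lemma fracInt_const_mul (b t : ℝ) (c : ℂ) (f : ℝ → ℂ) :
    fracInt b (fun s => c * f s) t = c * fracInt b f t := by
  simp only [fracInt, Complex.real_smul]
  rw [← integral_const_mul]
  congr 1; ext s; ring

lemma fracInt_ofReal (b t : ℝ) (f : ℝ → ℝ) :
    fracInt b (fun s => (f s : ℂ)) t = ((fracInt b f t : ℝ) : ℂ) := by
  rw [fracInt, fracInt, ← integral_complex_ofReal]
  simp

/-- A continuous function that solves the homogeneous equation of order `ρ < 1` with zero initial
value vanishes. -/
lemma eq_zero_of_fracInt_eq (hρ : 0 < ρ) (hρ1 : ρ < 1) (hT : 0 < T) (lam : ℝ) {D : ℝ → ℂ}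
    (hD : ContinuousOn D (Icc 0 T))
    (h : ∀ t ∈ Ioc 0 T, fracInt (1 - ρ) D t = -(lam : ℂ) * fracInt 1 D t) :
    ∀ t ∈ Icc 0 T, D t = 0 := by
  have h1ρ : 0 < 1 - ρ := sub_pos.2 hρ1
  -- The constant extension beyond [0, T] is continuous on ℝ, so its primitive Y is differentiable
  -- everywhere.
  have hext : Continuous (IccExtend hT.le (domRestrict (Icc 0 T) D)) :=
    (continuousOn_iff_continuous_domRestrict.1 hD).Icc_extend'
  set D' := IccExtend hT.le (domRestrict (Icc 0 T) D) with hD'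
  have hDD : ∀ t ∈ Icc 0 T, D' t = D t := fun t ht => by
    rw [hD', IccExtend_of_mem hT.le _ ht, domRestrict_apply]
  set Y : ℝ → ℂ := fun t => ∫ s in (0 : ℝ)..t, D' s with hY
  have hYc : Continuous Y := intervalIntegral.continuous_primitive
    (fun a b => hext.intervalIntegrable a b) 0
  have hYeq : ∀ t ∈ Icc 0 T, Y t = fracInt 1 D t := fun t ht => by
    rw [hY, fracInt_one]
    simp only
    rw [intervalIntegral.integral_of_le ht.1, integral_Ioc_eq_integral_Ioo]
    exact setIntegral_congr_fun measurableSet_Ioo fun s hs => hDD s ⟨hs.1.le, hs.2.le.trans ht.2⟩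
  have hDint : ∀ t ∈ Icc 0 T, IntegrableOn D (Ioo 0 t) := fun t ht =>
    (hD.integrableOn_compact isCompact_Icc).mono_set
      fun s hs => ⟨hs.1.le, hs.2.le.trans ht.2⟩
  -- Applying I^ρ to the hypothesis: Y = I^1 D = I^ρ I^{1-ρ} D = -lam I^ρ Y. Hence Y = 0, then D =
  -- Y' = 0 inside the interval, and at the end points by continuity.
  have hYv : ∀ t ∈ Icc 0 T, Y t = -(lam : ℂ) * fracInt ρ Y t := by
    intro t ht
    have h1 := (fracInt_fracInt hρ h1ρ (by linarith) (hDint t ht)).2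
    rw [add_sub_cancel] at h1
    rw [hYeq t ht, ← h1, ← fracInt_const_mul]
    refine fracInt_congr fun s hs => ?_
    have hs' : s ∈ Ioc 0 T := ⟨hs.1, hs.2.le.trans ht.2⟩
    rw [h s hs', hYeq s (Ioc_subset_Icc_self hs')]
  have hY0 := eq_zero_of_eq_fracInt hρ lam hYc.continuousOn hYv
  have hint : ∀ t ∈ Ioo 0 T, D' t = 0 := by
    intro t ht
    rw [← Continuous.deriv_integral D' hext 0 t]
    have : (fun u => ∫ x in (0 : ℝ)..u, D' x) =ᶠ[nhds t] fun _ => 0 := by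
      filter_upwards [Ioo_mem_nhds ht.1 ht.2] with u hu
      exact hY0 u (Ioo_subset_Icc_self hu)
    rw [this.deriv_eq, deriv_const]
  have hcl : Icc 0 T ⊆ D' ⁻¹' {0} := by
    rw [← closure_Ioo hT.ne]
    exact closure_minimal hint (isClosed_singleton.preimage hext)
  intro t ht
  rw [← hDD t ht]
  exact hcl ht

/-- The equation for a classical solution is available only for t > 0, so increments are computed on
[a, b] with a > 0, and then a → 0. -/
lemma eq_integral_of_tendsto_zero {J G : ℝ → ℂ} (hG : ContinuousOn G (Icc 0 T))
    (hJ : ∀ a b, 0 < a → a ≤ b → b ≤ T → J b - J a = ∫ s in Ioc a b, G s)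
    (hlim : Filter.Tendsto J (nhdsWithin 0 (Ioi 0)) (nhds 0)) {t : ℝ} (ht : t ∈ Ioc 0 T) :
    J t = fracInt 1 G t := by
  have hGi : IntegrableOn G (Icc 0 T) := hG.integrableOn_compact isCompact_Icc
  obtain ⟨M, hM⟩ := isCompact_Icc.exists_bound_of_continuousOn hG
  have h1 : Filter.Tendsto (fun a => ∫ s in Ioc 0 a, G s) (nhdsWithin 0 (Ioi 0)) (nhds 0) := by
    refine squeeze_zero_norm' (a := fun a => M * a) ?_ ?_
    · filter_upwards [Ioc_mem_nhdsGT ht.1] with a ha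
      have := norm_setIntegral_le_of_norm_le_const (μ := volume) (s := Ioc 0 a) (f := G) (C := M)
        (by simp) fun s hs => hM s ⟨hs.1.le, hs.2.trans (ha.2.trans ht.2)⟩
      simpa [max_eq_left ha.1.le] using this
    · have : Filter.Tendsto (fun a : ℝ => M * a) (nhds 0) (nhds (M * 0)) :=
        (continuous_const.mul continuous_id).tendsto 0
      rw [mul_zero] at this
      exact this.mono_left nhdsWithin_le_nhds
  have h2 := hlim.sub h1
  rw [sub_zero] at h2
  have h3 : (fun a => J a - ∫ s in Ioc 0 a, G s) =ᶠ[nhdsWithin 0 (Ioi 0)]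
      fun _ => J t - ∫ s in Ioc 0 t, G s := by
    filter_upwards [Ioc_mem_nhdsGT ht.1] with a ha
    have h4 : ∫ s in Ioc 0 t, G s = (∫ s in Ioc 0 a, G s) + ∫ s in Ioc a t, G s := by
      rw [← Ioc_union_Ioc_eq_Ioc ha.1.le ha.2, setIntegral_union (Ioc_disjoint_Ioc_of_le le_rfl)
        measurableSet_Ioc]
      · exact hGi.mono_set fun s hs => ⟨hs.1.le, hs.2.trans (ha.2.trans ht.2)⟩
      · exact hGi.mono_set fun s hs => ⟨ha.1.le.trans hs.1.le, hs.2.trans ht.2⟩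
    rw [h4, ← hJ a t ha.1 ha.2 ht.2]
    ring
  have h5 := tendsto_nhds_unique (tendsto_const_nhds.congr' h3.symm) h2
  rw [fracInt_one, ← integral_Ioc_eq_integral_Ioo]
  exact sub_eq_zero.1 h5

end Volterra

/-! ### Fourier coefficients of functions depending on time. -/

section Parametric

lemma fourierCoef_congr_ae {g h : (Fin N → ℝ) → ℂ} (hgh : g =ᵐ[volume] h) (n : Fin N → ℤ) :
    fourierCoef g n = fourierCoef h n := by
  rw [fourierCoef, fourierCoef]
  congr 1
  refine integral_congr_ae ?_
  filter_upwards [ae_restrict_of_ae hgh] with x hx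
  rw [hx]

lemma continuousOn_fourierCoef {w : (Fin N → ℝ) → ℝ → ℂ} {a b : ℝ} (hab : a ≤ b)
    (hw : ContinuousOn (fun p : (Fin N → ℝ) × ℝ => w p.1 p.2) (univ ×ˢ Icc a b))
    (n : Fin N → ℤ) : ContinuousOn (fun t => fourierCoef (fun x => w x t) n) (Icc a b) := by
  -- `projIcc` clamps time to [a, b], which makes the integrand continuous for all real times.
  have hc : Continuous fun p : ℝ × (Fin N → ℝ) => w p.2 (projIcc a b hab p.1) * expMode (-n) p.2 := by
    refine Continuous.mul ?_ ((continuous_expMode _).comp continuous_snd)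
    exact hw.comp_continuous (f := fun p : ℝ × (Fin N → ℝ) => (p.2, (projIcc a b hab p.1 : ℝ)))
      (continuous_snd.prodMk (continuous_subtype_val.comp (continuous_projIcc.comp continuous_fst)))
      fun p => ⟨mem_univ _, (projIcc a b hab p.1).2⟩
  have hcpt : IsCompact (Icc (fun _ : Fin N => -Real.pi) (fun _ => Real.pi)) := isCompact_Icc
  have h := continuous_parametric_integral_of_continuous (μ := volume)
    (f := fun t x => w x (projIcc a b hab t) * expMode (-n) x) hc hcpt
  have h2 : ∀ t, ∫ x in Icc (fun _ : Fin N => -Real.pi) (fun _ => Real.pi),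
      w x (projIcc a b hab t) * expMode (-n) x =
      ∫ x in cube N, w x (projIcc a b hab t) * expMode (-n) x := fun t =>
    (setIntegral_congr_set Measure.univ_pi_Ioc_ae_eq_Icc).symm
  simp only [h2] at h
  refine ((h.const_mul (((2 * Real.pi : ℝ) : ℂ)⁻¹ ^ N)).continuousOn (s := Icc a b)).congr
    fun t ht => ?_
  simp only [fourierCoef, projIcc_of_mem hab ht]

/-- Fubini for the Fourier coefficients of a time integral. -/
lemma fourierCoef_integral {w : (Fin N → ℝ) → ℝ → ℂ} {a b : ℝ}
    (hw : ContinuousOn (fun p : (Fin N → ℝ) × ℝ => w p.1 p.2) (univ ×ˢ Icc a b)) {κ : ℝ → ℝ}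
    (hκ : IntegrableOn κ (Ioo a b)) (n : Fin N → ℤ) :
    IntegrableOn (fun x => (∫ s in Ioo a b, κ s • w x s) * expMode (-n) x) (cube N) ∧
    fourierCoef (fun x => ∫ s in Ioo a b, κ s • w x s) n =
      ∫ s in Ioo a b, κ s • fourierCoef (fun x => w x s) n := by
  have hfin : IsFiniteMeasure (volume.restrict (cube N)) := ⟨by simpa using volume_cube_lt_top N⟩
  have hcpt : IsCompact ((Set.pi univ fun _ : Fin N => Icc (-Real.pi) Real.pi) ×ˢ Icc a b) :=
    (isCompact_univ_pi fun _ => isCompact_Icc).prod isCompact_Icc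
  have hc : ContinuousOn (fun p : (Fin N → ℝ) × ℝ => w p.1 p.2 * expMode (-n) p.1)
      (univ ×ˢ Icc a b) :=
    hw.mul ((continuous_expMode _).comp continuous_fst).continuousOn
  obtain ⟨M, hM⟩ := hcpt.exists_bound_of_continuousOn (hc.mono (prod_mono_left (subset_univ _)))
  have hsub : cube N ×ˢ Ioo a b ⊆
      (Set.pi univ fun _ : Fin N => Icc (-Real.pi) Real.pi) ×ˢ Icc a b :=
    prod_mono (pi_mono fun _ _ => Ioc_subset_Icc_self) Ioo_subset_Icc_self
  have hms : MeasurableSet (cube N ×ˢ Ioo a b) := (measurableSet_cube N).prod measurableSet_Ioo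
  have hint : Integrable (Function.uncurry fun x s => κ s • (w x s * expMode (-n) x))
      ((volume.restrict (cube N)).prod (volume.restrict (Ioo a b))) := by
    refine Integrable.smul_bdd (C := M) (hκ.comp_snd _) ?_ ?_
    · rw [Measure.prod_restrict]
      exact (hc.mono (prod_mono (subset_univ _) Ioo_subset_Icc_self)).aestronglyMeasurable hms
    · rw [Measure.prod_restrict]
      filter_upwards [ae_restrict_mem hms] with p hp
      exact hM p (hsub hp)
  have hx : ∀ x, (∫ s in Ioo a b, κ s • w x s) * expMode (-n) x =
      ∫ s in Ioo a b, κ s • (w x s * expMode (-n) x) := fun x => by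
    rw [← integral_mul_const]
    simp only [smul_mul_assoc]
  constructor
  · simp only [hx]
    exact hint.integral_prod_left
  · rw [fourierCoef]
    simp only [hx]
    rw [integral_integral_swap hint, ← integral_const_mul]
    simp only [fourierCoef, integral_smul, mul_smul_comm]

lemma fourierCoef_sub_of_integrable {g h : (Fin N → ℝ) → ℂ} {n : Fin N → ℤ}
    (hg : IntegrableOn (fun x => g x * expMode (-n) x) (cube N))
    (hh : IntegrableOn (fun x => h x * expMode (-n) x) (cube N)) :
    fourierCoef (fun x => g x - h x) n = fourierCoef g n - fourierCoef h n := by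
  simp only [fourierCoef, sub_mul]
  rw [integral_sub hg hh, mul_sub]

lemma continuous_slice {w : (Fin N → ℝ) → ℝ → ℂ} {s : Set ℝ}
    (hw : ContinuousOn (fun p : (Fin N → ℝ) × ℝ => w p.1 p.2) (univ ×ˢ s)) {t : ℝ} (ht : t ∈ s) :
    Continuous fun x => w x t :=
  hw.comp_continuous (f := fun x => (x, t)) (by fun_prop) fun _ => ⟨mem_univ _, ht⟩

lemma continuousOn_slice {w : (Fin N → ℝ) → ℝ → ℂ} {s : Set ℝ}
    (hw : ContinuousOn (fun p : (Fin N → ℝ) × ℝ => w p.1 p.2) (univ ×ˢ s)) (x : Fin N → ℝ) :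
    ContinuousOn (w x) s :=
  hw.comp (f := fun t => (x, t)) (by fun_prop) fun _ ht => ⟨mem_univ _, ht⟩

lemma integrableOn_mul_expMode {g : (Fin N → ℝ) → ℂ} (hg : Continuous g) (n : Fin N → ℤ) :
    IntegrableOn (fun x => g x * expMode n x) (cube N) :=
  continuous_integrableOn_cube (hg.mul (continuous_expMode n))

end Parametric

/-! ### Mode equations for an arbitrary classical solution. -/

section Unique

variable {m : ℕ} {A : MvPolynomial (Fin N) ℂ} {ρ T : ℝ} {φ Ψ : (Fin N → ℝ) → ℂ}
  {v : (Fin N → ℝ) → ℝ → ℂ} {g : (Fin N → ℝ) → ℂ}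

lemma IsSolution.fourierCoef_caputo (hv : IsSolution m A ρ T φ Ψ v g)
    (hA : IsEllipticSymmPos m A) {t : ℝ} (ht : t ∈ Ioc 0 T) (n : Fin N → ℤ) :
    fourierCoef (fun x => caputo ρ T (v x) t) n =
      fourierCoef g n - eigenval A n * fourierCoef (fun x => v x t) n := by
  have h : (fun x => caputo ρ T (v x) t) = fun x => g x - diffOp A (fun y => v y t) x := by
    ext x
    rw [← hv.equation x t ht]; ring
  rw [h, fourierCoef_sub_of_integrable (integrableOn_mul_expMode hv.continuous_f _)
    (integrableOn_mul_expMode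
      (continuous_slice (w := fun x t => diffOp A (fun y => v y t) x) hv.continuous_diffOp ht) _)]
  congr 1
  exact fourierCoef_diffOp hA (hv.periodic_u t (Ioc_subset_Icc_self ht)) (hv.contDiff_u t ht) n

/-- The interval stays away from 0 because the Caputo derivative is assumed continuous only on (0,
T]. -/
lemma IsSolution.fourierCoef_integral_caputo (hv : IsSolution m A ρ T φ Ψ v g)
    (hA : IsEllipticSymmPos m A) {a b : ℝ} (ha : 0 < a) (hb : b ≤ T) (n : Fin N → ℤ) :
    fourierCoef (fun x => ∫ s in Ioc a b, caputo ρ T (v x) s) n =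
      ∫ s in Ioc a b, (fourierCoef g n - eigenval A n * fourierCoef (fun x => v x s) n) := by
  have hsub : Icc a b ⊆ Ioc 0 T := fun s hs => ⟨ha.trans_le hs.1, hs.2.trans hb⟩
  have h := (fourierCoef_integral (w := fun x t => caputo ρ T (v x) t) (κ := fun _ => 1)
    (hv.continuous_caputo.mono (prod_mono_right hsub)) (integrableOn_const (by simp)) n).2
  simp only [one_smul] at h
  simp only [integral_Ioc_eq_integral_Ioo]
  rw [h]
  exact setIntegral_congr_fun measurableSet_Ioo fun s hs =>
    hv.fourierCoef_caputo hA (hsub (Ioo_subset_Icc_self hs)) n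

lemma IsSolution.continuousOn_coef (hv : IsSolution m A ρ T φ Ψ v g) (hT : 0 < T)
    (n : Fin N → ℤ) : ContinuousOn (fun t => fourierCoef (fun x => v x t) n) (Icc 0 T) :=
  continuousOn_fourierCoef hT.le hv.continuous_u n

lemma IsSolution.coef_equation_one (hv : IsSolution m A 1 T φ Ψ v g)
    (hA : IsEllipticSymmPos m A) (hT : 0 < T) (n : Fin N → ℤ) {t : ℝ} (ht : t ∈ Ioc 0 T) :
    fourierCoef (fun x => v x t) n - fourierCoef (fun x => v x 0) n =
      fracInt 1 (fun s => fourierCoef g n - eigenval A n * fourierCoef (fun x => v x s) n) t := by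
  have hV := hv.continuousOn_coef hT n
  refine eq_integral_of_tendsto_zero
    (J := fun t => fourierCoef (fun x => v x t) n - fourierCoef (fun x => v x 0) n)
    (G := fun s => fourierCoef g n - eigenval A n * fourierCoef (fun x => v x s) n)
    (continuousOn_const.sub (continuousOn_const.mul hV)) (fun a b ha hab hb => ?_) ?_ ht
  · have hsub : Icc a b ⊆ Ioc 0 T := fun s hs => ⟨ha.trans_le hs.1, hs.2.trans hb⟩
    have hsub' : Icc a b ⊆ Icc 0 T := hsub.trans Ioc_subset_Icc_self
    have hx : ∀ x, ∫ s in Ioc a b, caputo 1 T (v x) s = v x b - v x a := fun x => by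
      rw [← intervalIntegral.integral_of_le hab]
      refine intervalIntegral.integral_eq_sub_of_hasDerivAt_of_le hab
        ((continuousOn_slice hv.continuous_u x).mono hsub') (fun s hs => ?_) ?_
      · have h1 := hv.hasCaputo x s (hsub (Ioo_subset_Icc_self hs))
        rw [HasCaputo, if_pos rfl] at h1
        rw [caputo, if_pos rfl]
        exact h1.hasDerivWithinAt.hasDerivAt (Icc_mem_nhds (ha.trans hs.1) (hs.2.trans_le hb))
      · exact ContinuousOn.intervalIntegrable_of_Icc hab
          ((continuousOn_slice (w := fun x t => caputo 1 T (v x) t)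
            hv.continuous_caputo x).mono hsub)
    have h2 := hv.fourierCoef_integral_caputo hA ha hb n
    simp only [hx] at h2
    rw [← h2, fourierCoef_sub_of_integrable]
    · ring
    · exact integrableOn_mul_expMode
        (continuous_slice hv.continuous_u (hsub' (right_mem_Icc.2 hab))) _
    · exact integrableOn_mul_expMode
        (continuous_slice hv.continuous_u (hsub' (left_mem_Icc.2 hab))) _
  · have h0 : Filter.Tendsto (fun t => fourierCoef (fun x => v x t) n)
        (nhdsWithin 0 (Ioi 0)) (nhds (fourierCoef (fun x => v x 0) n)) :=
      (hV 0 (left_mem_Icc.2 hT.le)).tendsto.mono_left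
        (nhdsWithin_le_iff.2 (Filter.mem_of_superset (Ioc_mem_nhdsGT hT) Ioc_subset_Icc_self))
    simpa using h0.sub_const (fourierCoef (fun x => v x 0) n)

/-- The time-integrated equation on one mode. Increments of I^{1-ρ}(v - v(0)) are integrals of the
Caputo derivative for each x; Fubini passes to Fourier coefficients. -/
lemma IsSolution.coef_equation (hv : IsSolution m A ρ T φ Ψ v g)
    (hA : IsEllipticSymmPos m A) (hρ : 0 < ρ) (hρ1 : ρ < 1) (hT : 0 < T) (n : Fin N → ℤ) {t : ℝ}
    (ht : t ∈ Ioc 0 T) :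
    fracInt (1 - ρ) (fun s => fourierCoef (fun x => v x s) n - fourierCoef (fun x => v x 0) n) t =
      fracInt 1 (fun s => fourierCoef g n - eigenval A n * fourierCoef (fun x => v x s) n) t := by
  have hV := hv.continuousOn_coef hT n
  have h1ρ : 0 < 1 - ρ := sub_pos.2 hρ1
  have h0T : (0 : ℝ) ∈ Icc 0 T := left_mem_Icc.2 hT.le
  have hw : ContinuousOn (fun p : (Fin N → ℝ) × ℝ => v p.1 p.2 - v p.1 0) (univ ×ˢ Icc 0 T) :=
    hv.continuous_u.sub ((continuous_slice hv.continuous_u h0T).comp continuous_fst).continuousOn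
  have hcoef : ∀ s ∈ Icc 0 T, fourierCoef (fun x => v x s - v x 0) n =
      fourierCoef (fun x => v x s) n - fourierCoef (fun x => v x 0) n := fun s hs =>
    fourierCoef_sub_of_integrable (integrableOn_mul_expMode (continuous_slice hv.continuous_u hs) _)
      (integrableOn_mul_expMode (continuous_slice hv.continuous_u h0T) _)
  have hJ : ∀ t ∈ Ioc 0 T, IntegrableOn (fun x => fracInt (1 - ρ) (fun s => v x s - v x 0) t *
        expMode (-n) x) (cube N) ∧
      fourierCoef (fun x => fracInt (1 - ρ) (fun s => v x s - v x 0) t) n =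
      fracInt (1 - ρ)
        (fun s => fourierCoef (fun x => v x s) n - fourierCoef (fun x => v x 0) n) t := by
    intro t ht
    obtain ⟨h1, h2⟩ := fourierCoef_integral (w := fun x s => v x s - v x 0)
      (hw.mono (prod_mono_right (Icc_subset_Icc_right ht.2)))
      (integrableOn_fracKernel_sub (t := t) h1ρ) n
    refine ⟨h1, h2.trans ?_⟩
    exact fracInt_congr (f := fun s => fourierCoef (fun x => v x s - v x 0) n) fun s hs =>
      hcoef s ⟨hs.1.le, hs.2.le.trans ht.2⟩
  refine eq_integral_of_tendsto_zero (J := fracInt (1 - ρ)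
    (fun s => fourierCoef (fun x => v x s) n - fourierCoef (fun x => v x 0) n))
    (G := fun s => fourierCoef g n - eigenval A n * fourierCoef (fun x => v x s) n)
    (continuousOn_const.sub (continuousOn_const.mul hV)) (fun a b ha hab hb => ?_) ?_ ht
  · have hbm : b ∈ Ioc 0 T := ⟨ha.trans_le hab, hb⟩
    have ham : a ∈ Ioc 0 T := ⟨ha, hab.trans hb⟩
    have hx : ∀ x, ∫ s in Ioc a b, caputo ρ T (v x) s =
        fracInt (1 - ρ) (fun s => v x s - v x 0) b -
          fracInt (1 - ρ) (fun s => v x s - v x 0) a := fun x => by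
      have hvx := continuousOn_slice hv.continuous_u x
      obtain ⟨hib, hb1⟩ := integral_caputo hρ hρ1 hvx hbm (hv.hasCaputo x b hbm)
      obtain ⟨-, ha1⟩ := integral_caputo hρ hρ1 hvx ham (hv.hasCaputo x a ham)
      rw [← hb1, ← ha1]
      simp only [← integral_Ioc_eq_integral_Ioo]
      rw [← integrableOn_Ioc_iff_integrableOn_Ioo] at hib
      rw [← Ioc_union_Ioc_eq_Ioc ha.le hab, setIntegral_union (Ioc_disjoint_Ioc_of_le le_rfl)
        measurableSet_Ioc (hib.mono_set (Ioc_subset_Ioc_right hab))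
        (hib.mono_set (Ioc_subset_Ioc_left ha.le))]
      ring
    have h2 := hv.fourierCoef_integral_caputo hA ha hb n
    simp only [hx] at h2
    rw [← h2, fourierCoef_sub_of_integrable (hJ b hbm).1 (hJ a ham).1, (hJ b hbm).2, (hJ a ham).2]
  -- The coefficient is bounded in time, so its integral of order 1 - ρ is O(a^{1-ρ}) and vanishes
  -- as a → 0.
  · obtain ⟨M, hM⟩ := isCompact_Icc.exists_bound_of_continuousOn
      (hV.sub (continuousOn_const (c := fourierCoef (fun x => v x 0) n)))
    refine squeeze_zero_norm' (a := fun a => fracKernel (1 - ρ + 1) a * M) ?_ ?_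
    · filter_upwards [Ioc_mem_nhdsGT hT] with a ha
      exact norm_fracInt_le h1ρ ha.1 fun s hs => hM s ⟨hs.1.le, hs.2.le.trans ha.2⟩
    · have hc : Continuous fun a : ℝ => fracKernel (1 - ρ + 1) a * M := by
        unfold fracKernel
        exact ((Real.continuous_rpow_const (by linarith)).div_const _).mul_const _
      have := hc.tendsto 0
      rw [fracKernel, add_sub_cancel_right, Real.zero_rpow h1ρ.ne', zero_div, zero_mul] at this
      exact this.mono_left nhdsWithin_le_nhds

lemma solCoef_sub_initial (hρ : 0 < ρ) (a b : (Fin N → ℤ) → ℂ) (n : Fin N → ℤ) (t : ℝ) :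
    solCoef A ρ a b t n - a n =
      (b n - eigenval A n * a n) * (mlFun ρ (eigenval A n) (ρ + 1) t : ℝ) := by
  rw [solCoef, mlFun_one_eq hρ]
  push_cast; ring

lemma continuous_solCoef (hρ : 0 < ρ) (a b : (Fin N → ℤ) → ℂ) (n : Fin N → ℤ) :
    Continuous fun t => solCoef A ρ a b t n := by
  have h1 := continuous_mlFun hρ (eigenval A n) (le_refl (1 : ℝ))
  have h2 := continuous_mlFun hρ (eigenval A n) (show 1 ≤ ρ + 1 by linarith)
  unfold solCoef
  fun_prop

/-- For the explicit coefficients the other side of the integrated equation, I^{1-ρ} of `solCoef`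
minus its initial value, is the same multiple of `mlFun` at index (ρ+1) + (1-ρ) = 2. -/
lemma fracInt_one_solCoef (hρ : 0 < ρ) (a b : (Fin N → ℤ) → ℂ) (n : Fin N → ℤ) {t : ℝ}
    (ht : 0 < t) : fracInt 1 (fun s => b n - eigenval A n * solCoef A ρ a b s n) t =
      (b n - eigenval A n * a n) * (mlFun ρ (eigenval A n) 2 t : ℝ) := by
  simp only [eigenval_mul_solCoef hρ, sub_sub_cancel, caputoCoef]
  rw [fracInt_const_mul, fracInt_ofReal, fracInt_mlFun hρ _ one_pos one_pos ht]
  norm_num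

/-- The Fourier coefficients of any classical solution are given by the Mittag-Leffler formula. -/
theorem IsSolution.coef_eq (hv : IsSolution m A ρ T φ Ψ v g) (hA : IsEllipticSymmPos m A)
    (hρ : 0 < ρ) (hρ1 : ρ ≤ 1) (hT : 0 < T) (n : Fin N → ℤ) {t : ℝ} (ht : t ∈ Icc 0 T) :
    fourierCoef (fun x => v x t) n = solCoef A ρ (fourierCoef φ) (fourierCoef g) t n := by
  have hV := hv.continuousOn_coef hT n
  have hS : ContinuousOn (fun t => solCoef A ρ (fourierCoef φ) (fourierCoef g) t n) (Icc 0 T) :=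
    (continuous_solCoef hρ _ _ n).continuousOn
  have h0 : fourierCoef (fun x => v x 0) n = fourierCoef φ n := fourierCoef_congr_ae hv.initial n
  set V : ℝ → ℂ := fun t => fourierCoef (fun x => v x t) n with hVdef
  set S : ℝ → ℂ := fun t => solCoef A ρ (fourierCoef φ) (fourierCoef g) t n with hSdef
  have hsub : ∀ t ∈ Ioc 0 T, fracInt 1 (fun s => fourierCoef g n - eigenval A n * V s) t -
      fracInt 1 (fun s => fourierCoef g n - eigenval A n * S s) t =
      -(eigenval A n : ℂ) * fracInt 1 (fun s => V s - S s) t := by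
    intro t ht
    rw [← fracInt_sub_fun (f := fun s => fourierCoef g n - eigenval A n * V s)
      (g := fun s => fourierCoef g n - eigenval A n * S s) one_pos (continuousOn_const.sub (continuousOn_const.mul hV))
      (continuousOn_const.sub (continuousOn_const.mul hS)) ht.2, ← fracInt_const_mul]
    congr 1; ext s; ring
  have hD : ∀ t ∈ Icc 0 T, V t - S t = 0 := by
    -- The difference V - S solves the homogeneous integrated equation. The case ρ = 1 is separate
    -- because `fracInt 0` is not the identity: its kernel is 0 by the convention Γ(0) = 0.
    rcases hρ1.eq_or_lt with rfl | hρ1'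
    · refine eq_zero_of_eq_fracInt (Y := fun t => V t - S t) one_pos (eigenval A n)
        (hV.sub hS) fun t ht => ?_
      rcases ht.1.eq_or_lt with rfl | ht0
      · rw [fracInt_of_nonpos _ _ le_rfl, mul_zero]
        change fourierCoef (fun x => v x 0) n - solCoef A 1 (fourierCoef φ) (fourierCoef g) 0 n = 0
        rw [h0, solCoef, mlFun_one_zero hρ, mlFun_add_one_zero hρ]
        simp
      · have ht' : t ∈ Ioc 0 T := ⟨ht0, ht.2⟩
        have h1 := hv.coef_equation_one hA hT n ht'
        have h2 := fracInt_one_solCoef (A := A) hρ (fourierCoef φ) (fourierCoef g) n ht0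
        have h3 := solCoef_sub_initial (A := A) hρ (fourierCoef φ) (fourierCoef g) n t
        rw [one_add_one_eq_two, ← h2] at h3
        rw [← hsub t ht', ← h1, ← h3, h0]
        ring
    · refine eq_zero_of_fracInt_eq hρ hρ1' hT (eigenval A n) (hV.sub hS) fun t ht => ?_
      have h1ρ : 0 < 1 - ρ := sub_pos.2 hρ1'
      have h1 := hv.coef_equation hA hρ hρ1' hT n ht
      have h2 := fracInt_one_solCoef (A := A) hρ (fourierCoef φ) (fourierCoef g) n ht.1
      have h3 : fracInt (1 - ρ) (fun s => S s - fourierCoef φ n) t =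
          fracInt 1 (fun s => fourierCoef g n - eigenval A n * S s) t := by
        rw [h2]
        simp only [hSdef, solCoef_sub_initial hρ]
        rw [fracInt_const_mul, fracInt_ofReal, fracInt_mlFun hρ _ h1ρ (by linarith) ht.1]
        congr 3; ring
      rw [← hsub t ht, ← h1, ← h3, h0, ← fracInt_sub_fun (f := fun s => V s - fourierCoef φ n)
        (g := fun s => S s - fourierCoef φ n) h1ρ (hV.sub continuousOn_const)
        (hS.sub continuousOn_const) ht.2]
      congr 1; ext s; ring
  exact sub_eq_zero.1 (hD t ht)

end Unique

/-! ### Source coefficients and the constructed solution. -/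

section Existence

variable {m : ℕ} {A : MvPolynomial (Fin N) ℂ} {ρ T : ℝ} {φ Ψ : (Fin N → ℝ) → ℂ}

lemma mlMode_eq_realML (hA : IsEllipticSymmPos m A) (ρ μ t : ℝ) (n : Fin N → ℤ) :
    mlMode A ρ μ t n = realML ρ μ (-eigenval A n * t ^ ρ) := by
  rw [mlMode, symbolAt_eq_eigenval hA, ← mittagLeffler_ofReal]
  push_cast; rfl

lemma mlMode_one (hA : IsEllipticSymmPos m A) (ρ t : ℝ) (n : Fin N → ℤ) :
    mlMode A ρ 1 t n = mlFun ρ (eigenval A n) 1 t := by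
  rw [mlMode_eq_realML hA, mlFun_one]

lemma rpow_mul_mlMode_add_one (hA : IsEllipticSymmPos m A) (ρ t : ℝ) (n : Fin N → ℤ) :
    ((t ^ ρ : ℝ) : ℂ) * mlMode A ρ (ρ + 1) t n = mlFun ρ (eigenval A n) (ρ + 1) t := by
  rw [mlMode_eq_realML hA, mlFun_add_one, Complex.ofReal_mul]

lemma sourceCoefFinal_eq (hA : IsEllipticSymmPos m A) (n : Fin N → ℤ) :
    sourceCoefFinal A ρ T Ψ n = fourierCoef Ψ n / mlFun ρ (eigenval A n) (ρ + 1) T := by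
  rw [sourceCoefFinal, rpow_mul_mlMode_add_one hA]

lemma sourceCoefInitial_eq (hA : IsEllipticSymmPos m A) (n : Fin N → ℤ) :
    sourceCoefInitial A ρ T φ n = fourierCoef φ n * mlFun ρ (eigenval A n) 1 T /
      mlFun ρ (eigenval A n) (ρ + 1) T := by
  rw [sourceCoefInitial, rpow_mul_mlMode_add_one hA, mlMode_one hA]

/-- Dividing by e(T) costs a factor of order 1 + lam, comparable with (1 + ‖n‖)^m: this is why Ψ has
m more derivatives than φ. -/
lemma summable_sourceCoefFinal (hA : IsEllipticSymmPos m A) (hρ : 0 < ρ) (hρ1 : ρ ≤ 1)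
    (hT : 0 < T) (hΨ : WeightSummable m (fourierCoef Ψ)) :
    Summable fun n => ‖sourceCoefFinal A ρ T Ψ n‖ := by
  obtain ⟨C, hC, hbd⟩ := exists_eigenval_bounds hA
  have hG := Real.Gamma_pos_of_pos (add_pos hρ one_pos)
  have hp := Real.rpow_pos_of_pos hT ρ
  -- Chosen so that T^ρ K = Γ(ρ+1) + T^ρ, whence Γ(ρ+1) + lam T^ρ ≤ T^ρ K (1 + lam).
  set K := Real.Gamma (ρ + 1) / T ^ ρ + 1 with hK
  have hK0 : 0 < K := by positivity
  refine Summable.of_nonneg_of_le (fun _ => norm_nonneg _) (fun n => ?_) (hΨ.mul_left (K * C))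
  have hl := eigenval_nonneg hA n
  have he := mlFun_add_one_pos hρ hρ1 hl hT
  rw [sourceCoefFinal_eq hA, norm_div, norm_ofReal_nonneg he.le, div_eq_mul_inv]
  have h1 : (mlFun ρ (eigenval A n) (ρ + 1) T)⁻¹ ≤ K * (1 + eigenval A n) := by
    have h2 := rpow_le_mul_mlFun_add_one hρ hρ1 hl hT
    rw [inv_le_iff_one_le_mul₀ he]
    have h3 : Real.Gamma (ρ + 1) + eigenval A n * T ^ ρ ≤ T ^ ρ * (K * (1 + eigenval A n)) := by
      have : T ^ ρ * K = Real.Gamma (ρ + 1) + T ^ ρ := by rw [hK]; field_simp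
      rw [← mul_assoc, this]
      nlinarith [mul_nonneg hG.le hl]
    have h4 := h2.trans (mul_le_mul_of_nonneg_right h3 he.le)
    rw [mul_assoc] at h4
    exact (le_mul_iff_one_le_right hp).1 h4
  calc ‖fourierCoef Ψ n‖ * (mlFun ρ (eigenval A n) (ρ + 1) T)⁻¹
      ≤ ‖fourierCoef Ψ n‖ * (K * (1 + eigenval A n)) := by gcongr
    _ ≤ ‖fourierCoef Ψ n‖ * (K * (C * (1 + ‖n‖) ^ m)) := by
        gcongr; exact (hbd n).2
    _ = _ := by ring

/-- The ratio y(T)/e(T) is at most Γ(ρ+1)/T^ρ for every mode, so no smoothness of φ is lost. -/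
lemma summable_sourceCoefInitial (hA : IsEllipticSymmPos m A) (hρ : 0 < ρ) (hρ1 : ρ ≤ 1)
    (hT : 0 < T) (hφ : Summable fun n => ‖fourierCoef φ n‖) :
    Summable fun n => ‖sourceCoefInitial A ρ T φ n‖ := by
  have hp := Real.rpow_pos_of_pos hT ρ
  refine Summable.of_nonneg_of_le (fun _ => norm_nonneg _) (fun n => ?_)
    (hφ.mul_right (Real.Gamma (ρ + 1) / T ^ ρ))
  have hl := eigenval_nonneg hA n
  have he := mlFun_add_one_pos hρ hρ1 hl hT
  rw [sourceCoefInitial_eq hA, norm_div, norm_mul, norm_ofReal_nonneg he.le,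
    norm_ofReal_nonneg (mlFun_one_nonneg hρ hρ1 hl hT.le), mul_div_assoc]
  gcongr ?_ * ?_
  rw [div_le_div_iff₀ he hp, mul_comm]
  exact rpow_mul_mlFun_one_le hρ hρ1 hl hT

lemma solCoef_zero (hρ : 0 < ρ) (a b : (Fin N → ℤ) → ℂ) : solCoef A ρ a b 0 = a := by
  ext n
  rw [solCoef, mlFun_one_zero hρ, mlFun_add_one_zero hρ]
  simp

lemma solCoef_final (hA : IsEllipticSymmPos m A) (hρ : 0 < ρ) (hρ1 : ρ ≤ 1) (hT : 0 < T) :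
    solCoef A ρ (fourierCoef φ) (sourceCoef A ρ T φ Ψ) T = fourierCoef Ψ := by
  ext n
  have he : ((mlFun ρ (eigenval A n) (ρ + 1) T : ℝ) : ℂ) ≠ 0 := by
    exact_mod_cast (mlFun_add_one_pos hρ hρ1 (eigenval_nonneg hA n) hT).ne'
  rw [solCoef, sourceCoef, sourceCoefFinal_eq hA, sourceCoefInitial_eq hA]
  field_simp
  ring

/-- The source coefficient is determined by the final condition. -/
lemma eq_sourceCoef_of_final (hA : IsEllipticSymmPos m A) (hρ : 0 < ρ) (hρ1 : ρ ≤ 1) (hT : 0 < T)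
    {b : (Fin N → ℤ) → ℂ} {n : Fin N → ℤ}
    (h : solCoef A ρ (fourierCoef φ) b T n = fourierCoef Ψ n) :
    b n = sourceCoef A ρ T φ Ψ n := by
  have he : ((mlFun ρ (eigenval A n) (ρ + 1) T : ℝ) : ℂ) ≠ 0 := by
    exact_mod_cast (mlFun_add_one_pos hρ hρ1 (eigenval_nonneg hA n) hT).ne'
  rw [sourceCoef, sourceCoefFinal_eq hA, sourceCoefInitial_eq hA, ← h, solCoef]
  field_simp
  ring

lemma MemSobolev.trigSeries_ae_eq {τ : ℝ} {g : (Fin N → ℝ) → ℂ} (hg : MemSobolev τ g)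
    (hs : Summable fun n => ‖fourierCoef g n‖) : trigSeries (fourierCoef g) =ᵐ[volume] g :=
  ae_eq_of_fourierCoef_eq (isPeriodic_trigSeries _) hg.periodic
    (memLp_cube_of_continuous (continuous_trigSeries hs)) hg.memLp (fourierCoef_trigSeries hs)

theorem isSolution_trigSeries (hA : IsEllipticSymmPos m A) (hρ : 0 < ρ) (hρ1 : ρ ≤ 1) (hT : 0 < T)
    {τ σ : ℝ} (hφ : MemSobolev τ φ) (hΨ : MemSobolev σ Ψ)
    (ha : Summable fun n => ‖fourierCoef φ n‖) (hc : Summable fun n => ‖fourierCoef Ψ n‖)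
    (hb : Summable fun n => ‖sourceCoef A ρ T φ Ψ n‖) :
    IsSolution m A ρ T φ Ψ
      (fun x t => trigSeries (solCoef A ρ (fourierCoef φ) (sourceCoef A ρ T φ Ψ) t) x)
      (trigSeries (sourceCoef A ρ T φ Ψ)) := by
  have hsub : (univ : Set (Fin N → ℝ)) ×ˢ Ioc 0 T ⊆ univ ×ˢ Ioi 0 := prod_mono_right fun t ht => ht.1
  have hcap := (continuousOn_caputoSeries hA hρ hρ1 ha hb).mono hsub
  exact
    { periodic_f := isPeriodic_trigSeries _
      continuous_f := continuous_trigSeries hb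
      periodic_u := fun t _ => isPeriodic_trigSeries _
      continuous_u := continuousOn_solution hA hρ hρ1 ha hb T
      contDiff_u := fun t ht => contDiff_trigSeries (weightSummable_solCoef hA hρ hρ1 ha hb ht.1)
      continuous_diffOp :=
        (((continuous_trigSeries hb).comp continuous_fst).continuousOn.sub hcap).congr
          fun p hp => diffOp_solution hA hρ hρ1 ha hb hp.2.1 p.1
      hasCaputo := fun x t ht => (caputo_solution hA hρ hρ1 ha hb ht x).1
      continuous_caputo := hcap.congr fun p hp => (caputo_solution hA hρ hρ1 ha hb hp.2 p.1).2
      equation := fun x t ht => by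
        rw [(caputo_solution hA hρ hρ1 ha hb ht x).2]
        change _ + diffOp A (trigSeries _) x = _
        rw [diffOp_solution hA hρ hρ1 ha hb ht.1]
        ring
      initial := by
        simp only [solCoef_zero hρ]
        exact hφ.trigSeries_ae_eq ha
      final := by
        simp only [solCoef_final hA hρ hρ1 hT]
        exact hΨ.trigSeries_ae_eq hc }

end Existence

end Subdiffusion
end

/-! ### Existence, uniqueness and the series formulas. -/

theorem theorem2p1 (N m : ℕ) (hN : 1 ≤ N) (hm : 1 ≤ m)
    (A : MvPolynomial (Fin N) ℂ) (hA : Subdiffusion.IsEllipticSymmPos m A)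
    (ρ T τ : ℝ) (hρ0 : 0 < ρ) (hρ1 : ρ ≤ 1) (hT : 0 < T) (hτ : (N : ℝ) / 2 < τ)
    (φ Ψ : (Fin N → ℝ) → ℂ)
    (hφ : Subdiffusion.MemSobolev τ φ) (hΨ : Subdiffusion.MemSobolev (τ + m) Ψ) :
    ∃ (u : (Fin N → ℝ) → ℝ → ℂ) (f : (Fin N → ℝ) → ℂ),
      Subdiffusion.IsSolution m A ρ T φ Ψ u f ∧
      (∀ (v : (Fin N → ℝ) → ℝ → ℂ) (g : (Fin N → ℝ) → ℂ),
        Subdiffusion.IsSolution m A ρ T φ Ψ v g →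
          (∀ x, ∀ t ∈ Set.Icc 0 T, v x t = u x t) ∧ g = f) ∧
      (∀ x, ∀ t ∈ Set.Icc 0 T, Subdiffusion.IsSumOfTwoSeries (u x t)
        (fun n : Fin N → ℤ => Subdiffusion.fourierCoef φ n *
          Subdiffusion.mlMode A ρ 1 t n * Subdiffusion.expMode n x)
        (fun n : Fin N → ℤ => Subdiffusion.sourceCoef A ρ T φ Ψ n * ((t ^ ρ : ℝ) : ℂ) *
          Subdiffusion.mlMode A ρ (ρ + 1) t n * Subdiffusion.expMode n x)) ∧
      (∀ x, Subdiffusion.IsSumOfTwoSeries (f x)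
        (fun n : Fin N → ℤ => Subdiffusion.sourceCoefFinal A ρ T Ψ n *
          Subdiffusion.expMode n x)
        (fun n : Fin N → ℤ => -(Subdiffusion.sourceCoefInitial A ρ T φ n *
          Subdiffusion.expMode n x))) := by
  open Subdiffusion in
  have ha : Summable fun n => ‖fourierCoef φ n‖ :=
    weightSummable_zero.1 (MemSobolev.weightSummable hτ (by simpa using hφ))
  have hΨw : WeightSummable m (fourierCoef Ψ) := MemSobolev.weightSummable hτ hΨ
  have hF := summable_sourceCoefFinal hA hρ0 hρ1 hT hΨw
  have hI := summable_sourceCoefInitial hA hρ0 hρ1 hT ha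
  have hb : Summable fun n => ‖sourceCoef A ρ T φ Ψ n‖ :=
    Summable.of_nonneg_of_le (fun _ => norm_nonneg _) (fun n => norm_sub_le _ _) (hF.add hI)
  refine ⟨fun x t => trigSeries (solCoef A ρ (fourierCoef φ) (sourceCoef A ρ T φ Ψ) t) x,
    trigSeries (sourceCoef A ρ T φ Ψ),
    isSolution_trigSeries hA hρ0 hρ1 hT hφ hΨ ha hΨw.norm hb, fun v g hv => ?_,
    fun x t ht => ?_, fun x => ?_⟩
  -- The source is identified first, from the mode formula at t = T; the solution at all other times
  -- then follows from the same formula.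
  · have hg : fourierCoef g = sourceCoef A ρ T φ Ψ := funext fun n =>
      eq_sourceCoef_of_final hA hρ0 hρ1 hT (by
        rw [← hv.coef_eq hA hρ0 hρ1 hT n (right_mem_Icc.2 hT.le)]
        exact fourierCoef_congr_ae hv.final n)
    refine ⟨fun x t ht => ?_, ?_⟩
    · have hs := summable_solCoef hA hρ0 hρ1 ha hb ht.1
      refine congrFun (eq_of_fourierCoef_eq (hv.periodic_u t ht) (isPeriodic_trigSeries _)
        (continuous_slice hv.continuous_u ht) (continuous_trigSeries hs) fun n => ?_) x
      rw [fourierCoef_trigSeries hs, hv.coef_eq hA hρ0 hρ1 hT n ht, hg]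
    · refine eq_of_fourierCoef_eq hv.periodic_f (isPeriodic_trigSeries _) hv.continuous_f
        (continuous_trigSeries hb) fun n => ?_
      rw [fourierCoef_trigSeries hb, hg]
  · have h1 : Summable fun n => fourierCoef φ n * mlMode A ρ 1 t n * expMode n x := by
      refine summable_trigSeries (Summable.of_nonneg_of_le (fun _ => norm_nonneg _) (fun n => ?_) ha)
        x
      have hl := eigenval_nonneg hA n
      rw [norm_mul, mlMode_one hA, norm_ofReal_nonneg (mlFun_one_nonneg hρ0 hρ1 hl ht.1)]
      exact mul_le_of_le_one_right (norm_nonneg _) (mlFun_one_le_one hρ0 hρ1 hl ht.1)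
    have h2 : Summable fun n => sourceCoef A ρ T φ Ψ n * ((t ^ ρ : ℝ) : ℂ) *
        mlMode A ρ (ρ + 1) t n * expMode n x := by
      refine summable_trigSeries (Summable.of_nonneg_of_le (fun _ => norm_nonneg _) (fun n => ?_)
        (hb.mul_right (t ^ ρ / Real.Gamma (ρ + 1)))) x
      have hl := eigenval_nonneg hA n
      rw [mul_assoc, rpow_mul_mlMode_add_one hA, norm_mul,
        norm_ofReal_nonneg (mlFun_add_one_nonneg hρ0 hρ1 hl ht.1)]
      gcongr
      exact mlFun_add_one_le hρ0 hρ1 hl ht.1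
    refine ⟨h1, h2, ?_⟩
    rw [← h1.tsum_add h2]
    refine tsum_congr fun n => ?_
    rw [solCoef, mlMode_one hA, mul_assoc (sourceCoef A ρ T φ Ψ n), rpow_mul_mlMode_add_one hA]
    ring
  · have h1 := summable_trigSeries hF x
    have h2 := (summable_trigSeries hI x).neg
    refine ⟨h1, h2, ?_⟩
    rw [← h1.tsum_add h2, trigSeries]
    congr 1; ext n
    rw [sourceCoef]
    ring
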